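/- Let $n\ge 2$, let $B_1$ be the open unit ball of $\mathbb{R}^n$, let $\mathbb{S}^{n-1}=\partial B_1$ carry its surface measure $\mathcal{H}^{n-1}$, and let $\nabla_\tau$ denote the tangential gradient on $\mathbb{S}^{n-1}$. Let $G:\mathbb{R}^n\to[0,\infty)$ be a measurable kernel such that (H1) $G(x)=g(|x|)$ for a.e. $x$, with $g:(0,\infty)\to[0,\infty)$ measurable; (H2) $\int_{\mathbb{R}^n}|x|\,G(x)\,dx=1/\mathbf{K}_{1,n}<\infty$, where $\mathbf{K}_{1,n}=\frac{1}{\mathcal{H}^{n-1}(\mathbb{S}^{n-1})}\int_{\mathbb{S}^{n-1}}|\sigma\cdot\nu|\,d\mathcal{H}^{n-1}_\sigma$ for any unit vector $\nu$; (H3) $G\in W^{1,1}_{\mathrm{loc}}(\mathbb{R}^n\setminus\{0\})$, $\int_{\mathbb{R}^n}|x|^2|\partial_rG(x)|\,dx<\infty$ and $g'(r)=O(r^{-(n+1)})$ as $r\to\infty$. For $\varepsilon>0$ put $G_\varepsilon(x)=\varepsilon^{-(n+1)}G(\varepsilon^{-1}x)$, and $P_{G_\varepsilon}(E)=2\iint_{E\times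 E^c}G_\varepsilon(x-y)\,dx\,dy$ for measurable $E\subseteq\mathbb{R}^n$. Put $\eta(r)=2r^2g(r)$ and $\eta_\varepsilon(r)=\varepsilon^{-(n-1)}\eta(\varepsilon^{-1}r)$. For $t\in(0,\frac12)$, a centered $t$-nearly spherical set is a measurable set $E_t\subseteq\mathbb{R}^n$ with $|E_t|=|B_1|$ and $\int_{E_t}x\,dx=0$, for which there is a Lipschitz function $u:\mathbb{S}^{n-1}\to\mathbb{R}$ with $\|u\|_{L^\infty(\mathbb{S}^{n-1})}+\|\nabla_\tau u\|_{L^\infty(\mathbb{S}^{n-1})}\le1$ and $\partial E_t=\{(1+tu(x))x: x\in\mathbb{S}^{n-1}\}$. There is a constant $t_0>0$ depending only on $n$, and there are constants $\bar\varepsilon_5>0$, $C>0$ and a function $q_\eta:(0,\infty)\to\mathbb{R}$ depending only on $n$ and $G$, with $q_\eta(\varepsilon)\to0$ as $\varepsilon\to0^+$ and $$\iint_{\mathbb{S}^{n-1}\times\mathbb{S}^{n-1}}\frac{(v(x)-v(y))^2}{|x-y|^2}\,\eta_\varepsilon(|x-y|)\,d\mathcal{H}^{n-1}_x\,d\mathcal{H}^{n-1}_y\le(1+q_\eta(\varepsilon))\int_{\mathbb{S}^{n-1}}|\nabla_\tau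 v|^2\,d\mathcal{H}^{n-1}$$ for all $\varepsilon>0$ and all Lipschitz $v:\mathbb{S}^{n-1}\to\mathbb{R}$, such that the following holds. For every centered $t$-nearly spherical set $E_t$ with $0<t<t_0$, with boundary described by $u$ as above, and every $0<\varepsilon<\bar\varepsilon_5$, the quantities $P_{G_\varepsilon}(E_t)$ and $P_{G_\varepsilon}(B_1)$ are finite and $$P_{G_\varepsilon}(E_t)\le P_{G_\varepsilon}(B_1)+\frac{t^2}{2}\Big((1+Cq_\eta(\varepsilon))\|\nabla_\tau u\|_{L^2(\mathbb{S}^{n-1})}^2-(n-1)\|u\|_{L^2(\mathbb{S}^{n-1})}^2\Big)+Ct^3\Big(\|\nabla_\tau u\|_{L^2(\mathbb{S}^{n-1})}^2+\|u\|_{L^2(\mathbb{S}^{n-1})}^2\Big).$$ -/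

import Mathlib

open Set Filter Topology MeasureTheory
open scoped ENNReal NNReal ContDiff RealInnerProductSpace

namespace NonlocalPerimeter

noncomputable section

/-- The Euclidean space `ℝⁿ`. -/
abbrev Rn (n : ℕ) : Type := EuclideanSpace ℝ (Fin n)

/-- The unit sphere `𝕊ⁿ⁻¹` of `ℝⁿ`. -/
abbrev Sph (n : ℕ) : Type := Metric.sphere (0 : Rn n) 1

/-- The surface measure on `𝕊ⁿ⁻¹`, of total mass `n |B₁|`. -/
def surf (n : ℕ) : Measure (Sph n) := (volume : Measure (Rn n)).toSphere

/-- The rescaled kernel `G_ε(x) = ε^{-(n+1)} G(ε⁻¹ x)`. -/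
def rescale {n : ℕ} (G : Rn n → ℝ) (ε : ℝ) (x : Rn n) : ℝ :=
  (ε ^ (n + 1))⁻¹ * G (ε⁻¹ • x)

/-- The nonlocal perimeter `P_G(E) = 2 ∬_{E × Eᶜ} G(x - y) dx dy`, with values in `[0, ∞]`. -/
def nonlocalPer {n : ℕ} (G : Rn n → ℝ) (E : Set (Rn n)) : ℝ≥0∞ :=
  2 * ∫⁻ x in E, ∫⁻ y in Eᶜ, ENNReal.ofReal (G (x - y))

/-- `K_{1,n}`: the average over the sphere of `|σ · ν|`, where `ν` is a unit vector
(the value does not depend on `ν`). -/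
def K1 {n : ℕ} (ν : Sph n) : ℝ := ⨍ σ, |⟪(σ : Rn n), (ν : Rn n)⟫| ∂(surf n)

/-- `G` is measurable, nonnegative and radial with profile `g`. -/
structure IsRadialKernel {n : ℕ} (G : Rn n → ℝ) (g : ℝ → ℝ) : Prop where
  measurable : Measurable G
  nonneg : ∀ x, 0 ≤ G x
  profile_measurable : Measurable g
  profile_nonneg : ∀ r, 0 < r → 0 ≤ g r
  radial : ∀ᵐ x : Rn n, G x = g ‖x‖

/-- The first moment `∫ |x| G(x) dx` is finite and equal to `1 / K_{1,n}`. -/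
structure HasUnitFirstMoment {n : ℕ} (G : Rn n → ℝ) : Prop where
  integrable : Integrable fun x : Rn n => ‖x‖ * G x
  moment_eq : ∀ ν : Sph n, ∫ x : Rn n, ‖x‖ * G x = 1 / K1 ν

/-- `G ∈ W^{1,1}_loc(U)` with weak gradient `DG`. -/
structure HasWeakGradient {n : ℕ} (U : Set (Rn n)) (G : Rn n → ℝ) (DG : Rn n → Rn n) :
    Prop where
  locallyIntegrable : LocallyIntegrableOn G U
  gradient_locallyIntegrable : LocallyIntegrableOn DG U
  integration_by_parts : ∀ φ : Rn n → ℝ, ContDiff ℝ ∞ φ → HasCompactSupport φ →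
    tsupport φ ⊆ U → ∀ v : Rn n,
      ∫ x, G x * fderiv ℝ φ x v = - ∫ x, φ x * ⟪DG x, v⟫

/-- The radial component of a vector field; for the weak gradient of a radial function
`G(x) = g(|x|)` this is the radial derivative `∂_r G(x) = g'(|x|)`. -/
def radialPart {n : ℕ} (DG : Rn n → Rn n) (x : Rn n) : ℝ := ⟪DG x, ‖x‖⁻¹ • x⟫

/-- `G ∈ W^{1,1}_loc(ℝⁿ ∖ {0})`, the second moment `∫ |x|² |∂_r G(x)| dx` of the radial
derivative is finite, and `g'(r) = O(r^{-(n+1)})` as `r → ∞`. -/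
def HasHigherMoment {n : ℕ} (G : Rn n → ℝ) : Prop :=
  ∃ DG : Rn n → Rn n, HasWeakGradient {0}ᶜ G DG ∧
    Integrable (fun x : Rn n => ‖x‖ ^ 2 * |radialPart DG x|) ∧
    ∃ C₀ R₀ : ℝ, 0 < R₀ ∧
      ∀ᵐ x : Rn n, R₀ < ‖x‖ → |radialPart DG x| ≤ C₀ * (‖x‖ ^ (n + 1))⁻¹

/-- The extension of a function on the sphere to `ℝⁿ ∖ {0}`, constant along rays
(and `0` at the origin). -/
def homExt {n : ℕ} (u : Sph n → ℝ) (y : Rn n) : ℝ :=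
  open Classical in
  if h : y = 0 then 0
  else u ⟨‖y‖⁻¹ • y, by
    rw [mem_sphere_zero_iff_norm, norm_smul, norm_inv, norm_norm,
      inv_mul_cancel₀ (norm_ne_zero_iff.2 h)]⟩

/-- The tangential gradient `∇_τ u` of a function on the sphere: the gradient, at points of the
sphere, of the extension of `u` that is constant along rays. For Lipschitz `u` it is defined
almost everywhere. -/
def tanGrad {n : ℕ} (u : Sph n → ℝ) (x : Sph n) : Rn n := gradient (homExt u) (x : Rn n)

/-- `‖u‖²` in `L²(𝕊ⁿ⁻¹)`. -/
def normSqL2 {n : ℕ} (u : Sph n → ℝ) : ℝ := ∫ x, u x ^ 2 ∂(surf n)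

/-- `‖∇_τ u‖²` in `L²(𝕊ⁿ⁻¹)`. -/
def gradNormSqL2 {n : ℕ} (u : Sph n → ℝ) : ℝ := ∫ x, ‖tanGrad u x‖ ^ 2 ∂(surf n)

/-- `E` is a centered `t`-nearly spherical set, with the volume of the unit ball, whose boundary
is described by the Lipschitz function `u` on the sphere. -/
structure IsCenteredNearlySpherical {n : ℕ} (t : ℝ) (E : Set (Rn n)) (u : Sph n → ℝ) :
    Prop where
  t_pos : 0 < t
  t_lt_half : t < 1 / 2
  nullMeasurableSet : NullMeasurableSet E
  volume_eq : volume E = volume (Metric.ball (0 : Rn n) 1)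
  centered : ∫ x in E, x = 0
  lipschitz : ∃ L : ℝ≥0, LipschitzWith L u
  norm_le : eLpNorm u ⊤ (surf n) + eLpNorm (tanGrad u) ⊤ (surf n) ≤ 1
  frontier_eq : frontier E = range fun x : Sph n => (1 + t * u x) • (x : Rn n)

/-- `η_ε(r) = ε^{-(n-1)} η(ε⁻¹ r)` with `η(r) = 2 r² g(r)`. -/
def etaEps (n : ℕ) (g : ℝ → ℝ) (ε r : ℝ) : ℝ :=
  (ε ^ (n - 1))⁻¹ * (2 * (ε⁻¹ * r) ^ 2 * g (ε⁻¹ * r))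

/-- `q` is an admissible error term `q_η` in the comparison of the nonlocal seminorms associated
with `η_ε` to the `H¹` seminorm on the sphere: it vanishes as `ε → 0⁺` and, for all `ε > 0`,
`∬ (u(x) - u(y))² / |x - y|² η_ε(|x - y|) ≤ (1 + q(ε)) ∫ |∇_τ u|²` for Lipschitz `u`. -/
structure IsSeminormError (n : ℕ) (g : ℝ → ℝ) (q : ℝ → ℝ) : Prop where
  tendsto_zero : Tendsto q (𝓝[>] 0) (𝓝 0)
  seminorm_le : ∀ ε : ℝ, 0 < ε → ∀ u : Sph n → ℝ, (∃ L : ℝ≥0, LipschitzWith L u) →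
    ∫⁻ x, ∫⁻ y, ENNReal.ofReal ((u x - u y) ^ 2 / ‖(x : Rn n) - (y : Rn n)‖ ^ 2 *
        etaEps n g ε ‖(x : Rn n) - (y : Rn n)‖) ∂(surf n) ∂(surf n)
      ≤ ENNReal.ofReal ((1 + q ε) * gradNormSqL2 u)

end

end NonlocalPerimeter

/-! Up to a null set the nearly spherical set is the star-shaped region of radius `R = 1 + t u`. In
polar coordinates for both points, the interaction between two directions `x` and `y` is a measure
on pairs of radii, unchanged when the directions are exchanged. Adding the contributions of `(x, y)`
and `(y, x)`, the corners with vertices `(R x, R y)` and `(R y, R x)` become the corners at equal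
radii `(R x, R x)` and `(R y, R y)`, plus a square of side `|R x - R y|` (`measure_prod_exchange`).
By rotation invariance the equal-radius corners are perimeters of balls. Hence the perimeter is
exactly the spherical average of the perimeters of the balls of radius `R x`, plus an interaction
term `J` quadratic in `t` (`sphArea_mul_radialPer_starSet`).

Balls. The volume that a translation moves out of a ball is an integral of `min r (R ℓ)` over
chords, concave in `R` up to the factor `R ^ (n - 1)`. The tangent line at `R = 1` gives `P(B_R) ≤ R
^ n P(B_1) + (R ^ (n - 1) - R ^ n) c_ε`, where `c_ε` tends to the area of the sphere
(`radialPer_ball_add_le`, `IsProfile.tendsto_capMoment`). The volume constraint fixes the mean of `R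
^ n`, and a Taylor expansion of the mean of `R ^ (n - 1)` under this constraint yields the negative
term `-(n - 1) ‖u‖² t² / 2` (`exists_integral_pow_ge`).

Interaction. The product surface measure disintegrates along great circles whose frame is Haar
distributed in the orthogonal group (`lintegral_surf_surf`). The increment of `u` along an arc is
the integral of its derivative. After Cauchy–Schwarz, invariance of the Haar measure moves the
derivative to the base frame, and isotropy of the second frame vector replaces its square by `|∇u|²
/ (n - 1)` on average (`nonlocal_energy_le`). What remains is a one-dimensional integral of the
kernel along an arc. For angles below a threshold `ϑ` the distance between the two graph points
expands by at least `1 - 19 t - ϑ`, so a change of variables bounds the integral by the `n`-th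
moment of the profile, which the normalization by `K1` makes exactly the right constant. Above `ϑ`
the profile is small.

Smallness of the profile. The radial derivative has finite second moment, so the profile is the
integral of its derivative from infinity and satisfies `g r ≤ M r / r ^ (n + 1)` with `M → 0`
(`exists_profile_bound`). After rescaling, the far part tends to zero for each fixed `ϑ`; taking the
infimum over `ϑ` gives `angularError`.

The admissible `q` is a multiple of `angularError` plus `capError`, the relative defect of `c_ε`.
That defect multiplies `‖u‖²`, which a Poincaré inequality under the volume constraint turns into
`‖∇u‖²`. -/

namespace NonlocalPerimeter

noncomputable section

/-! ### Polar coordinates, slices and zonal functions -/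

/-- Integration in polar coordinates. -/
theorem lintegral_polar {k : ℕ} (f : Rn (k + 1) → ℝ≥0∞) (hf : Measurable f) :
    ∫⁻ x, f x = ∫⁻ σ : Sph (k + 1), (∫⁻ r in Ioi (0 : ℝ),
      ENNReal.ofReal (r ^ k) * f (r • (σ : Rn (k + 1)))) ∂(surf (k + 1)) := by
  have hmp := (volume : Measure (Rn (k + 1))).measurePreserving_homeomorphUnitSphereProd
  have hdim : Module.finrank ℝ (Rn (k + 1)) - 1 = k := by simp
  rw [hdim] at hmp
  have h1 : ∫⁻ x, f x = ∫⁻ x : ({0}ᶜ : Set (Rn (k + 1))), f x ∂(volume.comap Subtype.val) := by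
    rw [lintegral_subtype_comap (measurableSet_singleton _).compl,
      restrict_compl_singleton]
  have h2 := (hmp.symm (homeomorphUnitSphereProd (Rn (k + 1))).toMeasurableEquiv).lintegral_comp
    (hf.comp measurable_subtype_coe)
  rw [h1]
  simp only [Function.comp_def] at h2
  rw [← h2, lintegral_prod]
  · refine lintegral_congr fun σ => ?_
    rw [Measure.volumeIoiPow, lintegral_withDensity_eq_lintegral_mul]
    · rw [← lintegral_subtype_comap measurableSet_Ioi]
      rfl
    · fun_prop
    · fun_prop
  · refine Measurable.aemeasurable ?_
    exact (hf.comp measurable_subtype_coe).comp (MeasurableEquiv.measurable _)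

/-- The point `(a, y)` of `ℝ × ℝᵏ = ℝᵏ⁺¹`. -/
def consPt {k : ℕ} (a : ℝ) (y : Rn k) : Rn (k + 1) := WithLp.toLp 2 (Fin.cons a y.ofLp)

theorem norm_consPt_sq {k : ℕ} (a : ℝ) (y : Rn k) : ‖consPt a y‖ ^ 2 = a ^ 2 + ‖y‖ ^ 2 := by
  simp [consPt, EuclideanSpace.norm_sq_eq, Fin.sum_univ_succ]

@[fun_prop]
theorem measurable_consPt {k : ℕ} : Measurable fun p : ℝ × Rn k => consPt p.1 p.2 := by
  unfold consPt
  refine (WithLp.measurable_toLp 2 _).comp ?_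
  refine measurable_pi_iff.2 fun i => ?_
  refine Fin.cases ?_ (fun j => ?_) i
  · simpa using measurable_fst
  · simp only [Fin.cons_succ]
    fun_prop

theorem measurePreserving_consPt (k : ℕ) :
    MeasurePreserving fun p : ℝ × Rn k => consPt p.1 p.2 := by
  have h1 := PiLp.volume_preserving_toLp (Fin (k + 1))
  have h2 := (volume_preserving_piFinSuccAbove (fun _ : Fin (k + 1) => ℝ) 0).symm
  have h3 : MeasurePreserving (Prod.map id WithLp.ofLp : ℝ × Rn k → ℝ × (Fin k → ℝ)) :=
    (MeasurePreserving.id _).prod (PiLp.volume_preserving_ofLp (Fin k))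
  have h4 := h1.comp (h2.comp h3)
  convert h4 using 1
  ext p i
  refine Fin.cases ?_ (fun j => ?_) i <;>
    simp [consPt, MeasurableEquiv.piFinSuccAbove, Fin.insertNthEquiv]

/-- Integration over `ℝᵏ⁺¹ = ℝ × ℝᵏ`. -/
theorem lintegral_slice {k : ℕ} (f : Rn (k + 1) → ℝ≥0∞) (hf : Measurable f) :
    ∫⁻ x, f x = ∫⁻ y : Rn k, ∫⁻ a : ℝ, f (consPt a y) := by
  rw [← (measurePreserving_consPt k).lintegral_comp hf]
  change ∫⁻ p : ℝ × Rn k, _ ∂(volume.prod volume) = _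
  exact lintegral_prod_symm _ (hf.comp measurable_consPt).aemeasurable

/-- The first vector of the standard basis. -/
def e0 (k : ℕ) : Sph (k + 1) := ⟨EuclideanSpace.single 0 1, by simp⟩

theorem inner_e0_consPt {k : ℕ} (a : ℝ) (y : Rn k) : ⟪(e0 k : Rn (k + 1)), consPt a y⟫ = a := by
  simp [e0, consPt, EuclideanSpace.inner_single_left]

/-- The surface measure of the unit sphere of `ℝᵏ⁺¹`. -/
def sphArea (k : ℕ) : ℝ≥0∞ := surf (k + 1) univ

instance (n : ℕ) : IsFiniteMeasure (surf n) := by unfold surf; infer_instance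
instance (n : ℕ) : (surf n).IsOpenPosMeasure := by unfold surf; infer_instance

theorem sphArea_ne_top (k : ℕ) : sphArea k ≠ ⊤ := measure_ne_top _ _

theorem sphArea_ne_zero (k : ℕ) : sphArea k ≠ 0 := by
  have : Nonempty (Sph (k + 1)) := ⟨e0 k⟩
  exact isOpen_univ.measure_ne_zero _ univ_nonempty

theorem sphArea_eq (k : ℕ) :
    sphArea k = (k + 1 : ℕ) * volume (Metric.ball (0 : Rn (k + 1)) 1) := by
  simp [sphArea, surf]

theorem lintegral_radial {k : ℕ} (h : ℝ → ℝ≥0∞) (hh : Measurable h) :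
    ∫⁻ x : Rn (k + 1), h ‖x‖
      = sphArea k * ∫⁻ r in Ioi (0 : ℝ), ENNReal.ofReal (r ^ k) * h r := by
  rw [lintegral_polar _ (by fun_prop)]
  have : ∀ σ : Sph (k + 1), ∫⁻ r in Ioi (0 : ℝ), ENNReal.ofReal (r ^ k) * h ‖r • (σ : Rn (k + 1))‖
      = ∫⁻ r in Ioi (0 : ℝ), ENNReal.ofReal (r ^ k) * h r := fun σ => by
    refine setLIntegral_congr_fun measurableSet_Ioi fun r hr => ?_
    simp [norm_smul, abs_of_pos (mem_Ioi.1 hr)]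
  simp only [this, lintegral_const, sphArea, mul_comm]

theorem radial_power_integral (k : ℕ) :
    ∫⁻ r in Ioo (0 : ℝ) 1, ENNReal.ofReal (r ^ k) = ENNReal.ofReal (1 / (k + 1)) := by
  rw [Measure.restrict_congr_set Ioo_ae_eq_Ioc,
    ← ofReal_integral_eq_lintegral_ofReal (intervalIntegral.intervalIntegrable_pow _).1,
    ← intervalIntegral.integral_of_le zero_le_one]
  · simp
  · filter_upwards [ae_restrict_mem measurableSet_Ioc] with y hy
    exact pow_nonneg hy.1.le _

/-- Polar coordinates of the plane, restricted to the upper half-plane by the indicator of `ρ > 0`.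
There `a / √(a ^ 2 + ρ ^ 2)` is `cos θ` with `θ ∈ (0, π)`, and the weight `ρ ^ m` times the Jacobian
`r` splits into `r ^ (m + 1)` and `sin θ ^ m`. -/
theorem lintegral_polarCoord_halfPlane {m : ℕ} (h : ℝ → ℝ≥0∞) (hh : Measurable h) :
    ∫⁻ ρ in Ioi (0 : ℝ), ENNReal.ofReal (ρ ^ m) * ∫⁻ a : ℝ,
      (Ioo (0 : ℝ) 1).indicator (fun _ => h (a / √(a ^ 2 + ρ ^ 2))) √(a ^ 2 + ρ ^ 2)
    = (∫⁻ r in Ioo (0 : ℝ) 1, ENNReal.ofReal (r ^ (m + 1))) *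
      ∫⁻ θ in Ioo 0 Real.pi, ENNReal.ofReal (Real.sin θ ^ m) * h (Real.cos θ) := by
  set H : ℝ × ℝ → ℝ≥0∞ := fun p => (Ioi (0 : ℝ)).indicator (fun ρ => ENNReal.ofReal (ρ ^ m)) p.2 *
    ((Ioo (0 : ℝ) 1).indicator (fun _ => (1 : ℝ≥0∞)) √(p.1 ^ 2 + p.2 ^ 2) *
      h (p.1 / √(p.1 ^ 2 + p.2 ^ 2))) with hH
  have hi : Measurable ((Ioi (0 : ℝ)).indicator fun ρ => ENNReal.ofReal (ρ ^ m)) :=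
    Measurable.indicator (by fun_prop) measurableSet_Ioi
  have hi' : Measurable ((Ioo (0 : ℝ) 1).indicator fun _ => (1 : ℝ≥0∞)) :=
    Measurable.indicator (by fun_prop) measurableSet_Ioo
  have hHm : Measurable H := by
    refine (hi.comp measurable_snd).mul ((hi'.comp (by fun_prop)).mul (hh.comp ?_))
    fun_prop
  have hl : ∫⁻ p, H p = ∫⁻ ρ in Ioi (0 : ℝ), ENNReal.ofReal (ρ ^ m) * ∫⁻ a : ℝ,
      (Ioo (0 : ℝ) 1).indicator (fun _ => h (a / √(a ^ 2 + ρ ^ 2))) √(a ^ 2 + ρ ^ 2) := by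
    rw [Measure.volume_eq_prod, lintegral_prod_symm _ hHm.aemeasurable,
      ← lintegral_indicator measurableSet_Ioi]
    refine lintegral_congr fun ρ => ?_
    simp only [hH]
    rw [lintegral_const_mul _ (by
      refine (hi'.comp (by fun_prop)).mul (hh.comp ?_)
      fun_prop)]
    by_cases hρ : ρ ∈ Ioi (0 : ℝ)
    · simp only [indicator_of_mem hρ]
      congr 1
      refine lintegral_congr fun a => ?_
      simp only [indicator_apply]
      split_ifs <;> simp
    · simp only [indicator_of_notMem hρ, zero_mul]
  rw [← hl, ← lintegral_comp_polarCoord_symm]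
  have ht : polarCoord.target = Ioi (0 : ℝ) ×ˢ Ioo (-Real.pi) Real.pi := rfl
  rw [ht, Measure.volume_eq_prod, ← Measure.prod_restrict]
  have hG : ∀ p ∈ Ioi (0 : ℝ) ×ˢ Ioo (-Real.pi) Real.pi,
      ENNReal.ofReal p.1 • H (polarCoord.symm p) =
        (Ioo (0 : ℝ) 1).indicator (fun r => ENNReal.ofReal (r ^ (m + 1))) p.1 *
        (Ioo 0 Real.pi).indicator
          (fun θ => ENNReal.ofReal (Real.sin θ ^ m) * h (Real.cos θ)) p.2 := by
    rintro ⟨r, θ⟩ ⟨hr, hθ⟩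
    simp only [mem_Ioi, mem_Ioo] at hr hθ
    have hs : √((r * Real.cos θ) ^ 2 + (r * Real.sin θ) ^ 2) = r := by
      rw [show (r * Real.cos θ) ^ 2 + (r * Real.sin θ) ^ 2
        = r ^ 2 * (Real.sin θ ^ 2 + Real.cos θ ^ 2) by ring, Real.sin_sq_add_cos_sq, mul_one,
        Real.sqrt_sq hr.le]
    simp only [polarCoord_symm_apply, hH, hs]
    rw [mul_div_cancel_left₀ _ hr.ne']
    by_cases hθ0 : 0 < θ
    · have hsin := Real.sin_pos_of_pos_of_lt_pi hθ0 hθ.2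
      have h2 : r * Real.sin θ ∈ Ioi (0 : ℝ) := mul_pos hr hsin
      have h3 : θ ∈ Ioo 0 Real.pi := ⟨hθ0, hθ.2⟩
      rw [indicator_of_mem h2, indicator_of_mem h3]
      by_cases hr1 : r < 1
      · have h4 : r ∈ Ioo (0 : ℝ) 1 := ⟨hr, hr1⟩
        rw [indicator_of_mem h4, indicator_of_mem h4, smul_eq_mul, mul_pow, pow_succ' r m,
          ENNReal.ofReal_mul hr.le, ENNReal.ofReal_mul (by positivity)]
        ring
      · have h4 : r ∉ Ioo (0 : ℝ) 1 := fun h => hr1 h.2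
        rw [indicator_of_notMem h4, indicator_of_notMem h4]
        simp
    · have hsin : Real.sin θ ≤ 0 := Real.sin_nonpos_of_nonpos_of_neg_pi_le (not_lt.1 hθ0) hθ.1.le
      have h2 : r * Real.sin θ ∉ Ioi (0 : ℝ) := not_lt.2 (mul_nonpos_of_nonneg_of_nonpos hr.le hsin)
      have h3 : θ ∉ Ioo 0 Real.pi := fun h => hθ0 h.1
      rw [indicator_of_notMem h2, indicator_of_notMem h3]
      simp
  rw [Measure.prod_restrict, setLIntegral_congr_fun (measurableSet_Ioi.prod measurableSet_Ioo) hG,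
    ← Measure.prod_restrict, lintegral_prod_mul]
  · rw [setLIntegral_indicator measurableSet_Ioo, setLIntegral_indicator measurableSet_Ioo]
    congr 2
    · congr 1
      exact inter_eq_left.2 fun x hx => hx.1
    · congr 1
      exact inter_eq_left.2 fun x hx => ⟨by linarith [hx.1, Real.pi_pos], hx.2⟩
  · exact (Measurable.indicator (by fun_prop) measurableSet_Ioo).aemeasurable
  · exact (Measurable.indicator (by fun_prop) measurableSet_Ioo).aemeasurable

/-- The integral over the sphere of a zonal function. -/
theorem lintegral_zonal {m : ℕ} (h : ℝ → ℝ≥0∞) (hh : Measurable h) :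
    ∫⁻ σ : Sph (m + 2), h ⟪(e0 (m + 1) : Rn (m + 2)), (σ : Rn (m + 2))⟫ ∂(surf (m + 2))
      = sphArea m *
        ∫⁻ θ in Ioo 0 Real.pi, ENNReal.ofReal (Real.sin θ ^ m) * h (Real.cos θ) := by
  -- The zonal function is extended to the unit ball, constant along rays. Its integral is computed
  -- twice, in polar coordinates and by slices orthogonal to `e0`; the common radial factor cancels
  -- at the end.
  set f : Rn (m + 2) → ℝ≥0∞ := fun x =>
    (Ioo (0 : ℝ) 1).indicator (fun _ => h (⟪(e0 (m + 1) : Rn (m + 2)), x⟫ / ‖x‖)) ‖x‖ with hf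
  have hfm : Measurable f := by
    have : f = indicator {x | ‖x‖ ∈ Ioo (0 : ℝ) 1}
        (fun x => h (⟪(e0 (m + 1) : Rn (m + 2)), x⟫ / ‖x‖)) := by
      ext x; simp only [hf, indicator_apply, mem_ofPred_eq]
    rw [this]
    exact Measurable.indicator (by fun_prop) (measurable_norm measurableSet_Ioo)
  have hl : ∫⁻ x, f x = (∫⁻ r in Ioo (0 : ℝ) 1, ENNReal.ofReal (r ^ (m + 1))) *
      ∫⁻ σ : Sph (m + 2), h ⟪(e0 (m + 1) : Rn (m + 2)), (σ : Rn (m + 2))⟫ ∂(surf (m + 2)) := by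
    rw [lintegral_polar f hfm, ← lintegral_const_mul _ (by fun_prop)]
    refine lintegral_congr fun σ => ?_
    rw [← lintegral_mul_const _ (by fun_prop)]
    rw [show Ioo (0 : ℝ) 1 = Ioo (0 : ℝ) 1 ∩ Ioi 0 from (inter_eq_left.2 fun x hx => hx.1).symm,
      ← setLIntegral_indicator measurableSet_Ioo]
    refine setLIntegral_congr_fun measurableSet_Ioi fun r hr => ?_
    have hr : 0 < r := hr
    simp only [hf, norm_smul, norm_eq_of_mem_sphere, mul_one, Real.norm_eq_abs, abs_of_pos hr,
      inner_smul_right, mul_div_cancel_left₀ _ hr.ne', indicator_apply]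
    split_ifs <;> simp
  have hr : ∫⁻ x, f x = sphArea m * ((∫⁻ r in Ioo (0 : ℝ) 1, ENNReal.ofReal (r ^ (m + 1))) *
      ∫⁻ θ in Ioo 0 Real.pi, ENNReal.ofReal (Real.sin θ ^ m) * h (Real.cos θ)) := by
    have hn : ∀ (a : ℝ) (y : Rn (m + 1)), ‖consPt a y‖ = √(a ^ 2 + ‖y‖ ^ 2) := fun a y => by
      rw [← norm_consPt_sq, Real.sqrt_sq (norm_nonneg _)]
    rw [lintegral_slice f hfm, ← lintegral_polarCoord_halfPlane h hh]
    simp only [hf, inner_e0_consPt, hn]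
    refine lintegral_radial (fun ρ => ∫⁻ a : ℝ, (Ioo (0 : ℝ) 1).indicator
      (fun _ => h (a / √(a ^ 2 + ρ ^ 2))) √(a ^ 2 + ρ ^ 2)) ?_
    have : Measurable fun p : ℝ × ℝ => (Ioo (0 : ℝ) 1).indicator
      (fun _ => h (p.2 / √(p.2 ^ 2 + p.1 ^ 2))) √(p.2 ^ 2 + p.1 ^ 2) := by
      have e : (fun p : ℝ × ℝ => (Ioo (0 : ℝ) 1).indicator
        (fun _ => h (p.2 / √(p.2 ^ 2 + p.1 ^ 2))) √(p.2 ^ 2 + p.1 ^ 2)) =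
        indicator {p : ℝ × ℝ | √(p.2 ^ 2 + p.1 ^ 2) ∈ Ioo (0 : ℝ) 1}
          (fun p => h (p.2 / √(p.2 ^ 2 + p.1 ^ 2))) := by
        ext x; simp only [indicator_apply, mem_ofPred_eq]
      rw [e]
      exact Measurable.indicator (by fun_prop)
        ((by fun_prop : Measurable fun p : ℝ × ℝ => √(p.2 ^ 2 + p.1 ^ 2)) measurableSet_Ioo)
    exact this.lintegral_prod_right'
  rw [hl, mul_left_comm, radial_power_integral] at hr
  refine (ENNReal.mul_right_inj ?_ ENNReal.ofReal_ne_top).1 hr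
  exact (ENNReal.ofReal_pos.2 (by positivity)).ne'

/-! ### The orthogonal group and great circles -/

section

open scoped Pointwise

/-- The orthogonal group of `ℝⁿ`. -/
abbrev Rot (n : ℕ) : Type := unitary (Rn n →L[ℝ] Rn n)

instance (n : ℕ) : ContinuousStar (Rn n →L[ℝ] Rn n) :=
  ⟨(ContinuousLinearMap.adjoint : (Rn n →L[ℝ] Rn n) ≃ₗᵢ⋆[ℝ] _).continuous⟩

instance (n : ℕ) : CompactSpace (Rot n) := by
  refine isCompact_iff_compactSpace.1 (Metric.isCompact_of_isClosed_isBounded isClosed_unitary ?_)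
  refine (Metric.isBounded_closedBall (x := (0 : Rn n →L[ℝ] Rn n)) (r := 1)).subset fun A hA => ?_
  rw [mem_closedBall_zero_iff]
  exact ContinuousLinearMap.opNorm_le_bound _ zero_le_one fun x => by
    rw [one_mul, ContinuousLinearMap.norm_map_of_mem_unitary hA]

/-- The normalized Haar measure of the orthogonal group. -/
def rotHaar (n : ℕ) : Measure (Rot n) := Measure.haarMeasure ⊤

instance (n : ℕ) : IsProbabilityMeasure (rotHaar n) :=
  ⟨by simpa [rotHaar] using Measure.haarMeasure_self (K₀ := (⊤ : TopologicalSpace.PositiveCompacts (Rot n)))⟩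

instance (n : ℕ) : (rotHaar n).IsHaarMeasure := by unfold rotHaar; infer_instance

/-- A right translate of the Haar measure is again a left-invariant probability measure, hence the
same one. Right multiplication replaces the vectors of a frame by fixed combinations of them, which
is the invariance needed for frames. -/
instance (n : ℕ) : (rotHaar n).IsMulRightInvariant := by
  refine ⟨fun g => ?_⟩
  have : IsProbabilityMeasure ((rotHaar n).map (· * g)) :=
    Measure.isProbabilityMeasure_map (by fun_prop)
  exact Measure.isHaarMeasure_eq_of_isProbabilityMeasure _ _

@[simp]
theorem norm_rot_apply {n : ℕ} (A : Rot n) (x : Rn n) : ‖(A : Rn n →L[ℝ] Rn n) x‖ = ‖x‖ :=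
  Unitary.norm_map A x

@[simp]
theorem inner_rot_apply {n : ℕ} (A : Rot n) (x y : Rn n) :
    ⟪(A : Rn n →L[ℝ] Rn n) x, (A : Rn n →L[ℝ] Rn n) y⟫ = ⟪x, y⟫ :=
  Unitary.inner_map_map A x y

@[fun_prop]
theorem continuous_rot_apply {n : ℕ} :
    Continuous fun p : Rot n × Rn n => (p.1 : Rn n →L[ℝ] Rn n) p.2 :=
  (continuous_subtype_val.comp continuous_fst).clm_apply continuous_snd

/-- The action of the orthogonal group on the sphere. -/
def rotSph {n : ℕ} (A : Rot n) (σ : Sph n) : Sph n := ⟨(A : Rn n →L[ℝ] Rn n) σ, by simp⟩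

@[simp]
theorem coe_rotSph {n : ℕ} (A : Rot n) (σ : Sph n) :
    (rotSph A σ : Rn n) = (A : Rn n →L[ℝ] Rn n) σ := rfl

/-- The surface measure of a set is a multiple of the volume of the cone over it in the unit ball,
and a linear isometry maps cones to cones and preserves volume. -/
theorem measurePreserving_rotSph {n : ℕ} (A : Rot n) :
    MeasurePreserving (rotSph A) (surf n) (surf n) := by
  have hc : Continuous (rotSph A) := by
    refine Continuous.subtype_mk ?_ _
    exact (A : Rn n →L[ℝ] Rn n).continuous.comp continuous_subtype_val
  refine ⟨hc.measurable, Measure.ext fun s hs => ?_⟩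
  rw [Measure.map_apply hc.measurable hs, surf, Measure.toSphere_apply' _ (hc.measurable hs),
    Measure.toSphere_apply' _ hs]
  congr 1
  set L := Unitary.linearIsometryEquiv A with hL
  have hLA : ∀ x, L x = (A : Rn n →L[ℝ] Rn n) x := fun x => rfl
  have hpre : L ⁻¹' (Ioo (0 : ℝ) 1 • ((↑) '' s : Set (Rn n))) =
      Ioo (0 : ℝ) 1 • ((↑) '' (rotSph A ⁻¹' s) : Set (Rn n)) := by
    ext x
    constructor
    · rintro ⟨r, hr, _, ⟨σ, hσ, rfl⟩, h⟩
      refine ⟨r, hr, L.symm σ, ⟨⟨L.symm σ, by simp⟩, ?_, rfl⟩, ?_⟩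
      · rw [mem_preimage]
        convert hσ
        ext1
        simp [← hLA]
      · apply L.injective
        simpa using h
    · rintro ⟨r, hr, _, ⟨σ, hσ, rfl⟩, rfl⟩
      exact ⟨r, hr, _, ⟨_, hσ, rfl⟩, by simp [hLA]⟩
  rw [← hpre]
  exact L.measurePreserving.measure_preimage_emb L.toHomeomorph.measurableEmbedding _

theorem lintegral_surf_rot {n : ℕ} (A : Rot n) {f : Rn n → ℝ≥0∞} (hf : Measurable f) :
    ∫⁻ σ : Sph n, f ((A : Rn n →L[ℝ] Rn n) σ) ∂(surf n) = ∫⁻ σ : Sph n, f σ ∂(surf n) :=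
  (measurePreserving_rotSph A).lintegral_comp (hf.comp measurable_subtype_coe)

/-- The second vector of the standard basis. -/
def e1 (m : ℕ) : Rn (m + 2) := EuclideanSpace.single 1 1

theorem exists_rot_of_isometry {n : ℕ} (b : OrthonormalBasis (Fin n) ℝ (Rn n)) :
    ∃ B : Rot n, ∀ i, (B : Rn n →L[ℝ] Rn n) (EuclideanSpace.single i 1) = b i := by
  refine ⟨Unitary.linearIsometryEquiv.symm
    ((EuclideanSpace.basisFun (Fin n) ℝ).equiv b (Equiv.refl _)), fun i => ?_⟩
  have h := (EuclideanSpace.basisFun (Fin n) ℝ).equiv_apply_basis b (Equiv.refl _) i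
  rw [EuclideanSpace.basisFun_apply, Equiv.refl_apply] at h
  exact h

/-- An orthonormal pair extends to an orthonormal basis. The index `j` is left free because isotropy
compares all the frame vectors other than the first. -/
theorem exists_rot_pair {m : ℕ} {x e : Rn (m + 2)} (hx : ‖x‖ = 1) (he : ‖e‖ = 1)
    (hxe : ⟪x, e⟫ = 0) (j : Fin (m + 2)) (hj : j ≠ 0) :
    ∃ B : Rot (m + 2), (B : Rn (m + 2) →L[ℝ] Rn (m + 2)) (e0 (m + 1)) = x ∧
      (B : Rn (m + 2) →L[ℝ] Rn (m + 2)) (EuclideanSpace.single j 1) = e := by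
  have ho : Orthonormal ℝ (({0, j} : Set (Fin (m + 2))).domRestrict
      fun i => if i = 0 then x else e) := by
    refine ⟨fun i => ?_, fun i k hik => ?_⟩
    · simp only [Set.domRestrict_apply]
      split_ifs <;> assumption
    · rcases i with ⟨i, rfl | rfl⟩ <;> rcases k with ⟨k, rfl | rfl⟩
      · exact absurd rfl hik
      · simpa [hj] using hxe
      · simpa [hj, real_inner_comm] using hxe
      · exact absurd rfl hik
  obtain ⟨b, hb⟩ := ho.exists_orthonormalBasis_extension_of_card_eq (by simp)
  obtain ⟨B, hB⟩ := exists_rot_of_isometry b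
  refine ⟨B, ?_, ?_⟩
  · simpa [hb 0 (by simp), e0] using hB 0
  · simpa [hb j (by simp), hj] using hB j

theorem exists_rot_single {m : ℕ} {x : Rn (m + 2)} (hx : ‖x‖ = 1) :
    ∃ B : Rot (m + 2), (B : Rn (m + 2) →L[ℝ] Rn (m + 2)) (e0 (m + 1)) = x := by
  have ho : Orthonormal ℝ (({0} : Set (Fin (m + 2))).domRestrict fun _ => x) := by
    refine ⟨fun i => by simpa using hx, fun i k hik => ?_⟩
    rcases i with ⟨i, rfl⟩; rcases k with ⟨k, rfl⟩
    exact absurd rfl hik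
  obtain ⟨b, hb⟩ := ho.exists_orthonormalBasis_extension_of_card_eq (by simp)
  obtain ⟨B, hB⟩ := exists_rot_of_isometry b
  exact ⟨B, by simpa [hb 0 (by simp), e0] using hB 0⟩

theorem norm_e1 (m : ℕ) : ‖e1 m‖ = 1 := by simp [e1]

theorem inner_e0_e1 (m : ℕ) : ⟪(e0 (m + 1) : Rn (m + 2)), e1 m⟫ = 0 := by
  simp [e0, e1, EuclideanSpace.inner_single_left]

/-- The great circle through the first vector of the frame `A`. -/
def arc {m : ℕ} (A : Rot (m + 2)) (s : ℝ) : Rn (m + 2) :=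
  Real.cos s • (A : Rn (m + 2) →L[ℝ] Rn (m + 2)) (e0 (m + 1)) +
    Real.sin s • (A : Rn (m + 2) →L[ℝ] Rn (m + 2)) (e1 m)

/-- The velocity of the great circle `arc A`. -/
def arcDeriv {m : ℕ} (A : Rot (m + 2)) (s : ℝ) : Rn (m + 2) :=
  -Real.sin s • (A : Rn (m + 2) →L[ℝ] Rn (m + 2)) (e0 (m + 1)) +
    Real.cos s • (A : Rn (m + 2) →L[ℝ] Rn (m + 2)) (e1 m)

theorem inner_frame {m : ℕ} (A : Rot (m + 2)) (a b c d : ℝ) :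
    ⟪a • (A : Rn (m + 2) →L[ℝ] Rn (m + 2)) (e0 (m + 1)) +
      b • (A : Rn (m + 2) →L[ℝ] Rn (m + 2)) (e1 m),
     c • (A : Rn (m + 2) →L[ℝ] Rn (m + 2)) (e0 (m + 1)) +
      d • (A : Rn (m + 2) →L[ℝ] Rn (m + 2)) (e1 m)⟫ = a * c + b * d := by
  have h0 : ⟪(e0 (m + 1) : Rn (m + 2)), (e0 (m + 1) : Rn (m + 2))⟫ = 1 := by simp
  have h1 : ⟪e1 m, e1 m⟫ = 1 := by simp [norm_e1]
  have h2 : ⟪e1 m, (e0 (m + 1) : Rn (m + 2))⟫ = 0 := by rw [real_inner_comm, inner_e0_e1]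
  simp only [inner_add_left, inner_add_right, real_inner_smul_left, real_inner_smul_right,
    inner_rot_apply, inner_e0_e1, h0, h1, h2]
  ring

theorem norm_frame_sq {m : ℕ} (A : Rot (m + 2)) (a b : ℝ) :
    ‖a • (A : Rn (m + 2) →L[ℝ] Rn (m + 2)) (e0 (m + 1)) +
      b • (A : Rn (m + 2) →L[ℝ] Rn (m + 2)) (e1 m)‖ ^ 2 = a ^ 2 + b ^ 2 := by
  rw [← real_inner_self_eq_norm_sq, inner_frame]; ring

@[simp]
theorem norm_arc {m : ℕ} (A : Rot (m + 2)) (s : ℝ) : ‖arc A s‖ = 1 := by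
  rw [← sq_eq_sq₀ (norm_nonneg _) zero_le_one, arc, norm_frame_sq, Real.cos_sq_add_sin_sq, one_pow]

@[simp]
theorem norm_arcDeriv {m : ℕ} (A : Rot (m + 2)) (s : ℝ) : ‖arcDeriv A s‖ = 1 := by
  rw [← sq_eq_sq₀ (norm_nonneg _) zero_le_one, arcDeriv, norm_frame_sq, neg_sq,
    Real.sin_sq_add_cos_sq, one_pow]

@[fun_prop]
theorem continuous_arc {m : ℕ} : Continuous fun p : Rot (m + 2) × ℝ => arc p.1 p.2 := by
  unfold arc
  exact ((Real.continuous_cos.comp continuous_snd).smul (continuous_rot_apply.comp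
    (continuous_fst.prodMk continuous_const))).add ((Real.continuous_sin.comp continuous_snd).smul
    (continuous_rot_apply.comp (continuous_fst.prodMk continuous_const)))

@[fun_prop]
theorem continuous_arcDeriv {m : ℕ} : Continuous fun p : Rot (m + 2) × ℝ => arcDeriv p.1 p.2 := by
  unfold arcDeriv
  exact ((Real.continuous_sin.comp continuous_snd).neg.smul (continuous_rot_apply.comp
    (continuous_fst.prodMk continuous_const))).add ((Real.continuous_cos.comp continuous_snd).smul
    (continuous_rot_apply.comp (continuous_fst.prodMk continuous_const)))

theorem hasDerivAt_arc {m : ℕ} (A : Rot (m + 2)) (s : ℝ) :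
    HasDerivAt (arc A) (arcDeriv A s) s :=
  ((Real.hasDerivAt_cos s).smul_const _).add ((Real.hasDerivAt_sin s).smul_const _)

/-- Invariance of the Haar measure under rotation of frames in the plane of the first two vectors. -/
theorem lintegral_rot_shift {m : ℕ} (H : Rn (m + 2) → Rn (m + 2) → ℝ≥0∞) (s : ℝ) :
    ∫⁻ A : Rot (m + 2), H (arc A s) (arcDeriv A s) ∂(rotHaar (m + 2)) =
      ∫⁻ A : Rot (m + 2), H ((A : Rn (m + 2) →L[ℝ] Rn (m + 2)) (e0 (m + 1)))
        ((A : Rn (m + 2) →L[ℝ] Rn (m + 2)) (e1 m)) ∂(rotHaar (m + 2)) := by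
  -- Moving along the great circle by the angle `s` turns the frame of `A` into the frame of `A *
  -- B`, where `B` is a fixed rotation sending the first two basis vectors to position and velocity
  -- of the standard circle at time `s`.
  obtain ⟨B, hB0, hB1⟩ := exists_rot_pair (m := m) (norm_arc 1 s) (norm_arcDeriv 1 s)
    (by rw [arc, arcDeriv, inner_frame]; ring) 1 (by simp)
  conv_rhs => rw [← lintegral_mul_right_eq_self _ B]
  refine lintegral_congr fun A => ?_
  have : EuclideanSpace.single 1 1 = e1 m := rfl
  rw [this] at hB1
  have hmul : ∀ z, ((A * B : Rot (m + 2)) : Rn (m + 2) →L[ℝ] Rn (m + 2)) z =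
    (A : Rn (m + 2) →L[ℝ] Rn (m + 2)) ((B : Rn (m + 2) →L[ℝ] Rn (m + 2)) z) := fun z => rfl
  rw [hmul, hmul, hB0, hB1]
  simp [arc, arcDeriv]

/-- The first vector of a random frame is uniformly distributed on the sphere. -/
theorem lintegral_rot_e0 {m : ℕ} {f : Rn (m + 2) → ℝ≥0∞} (hf : Measurable f) :
    sphArea (m + 1) * ∫⁻ A : Rot (m + 2), f ((A : Rn (m + 2) →L[ℝ] Rn (m + 2)) (e0 (m + 1)))
      ∂(rotHaar (m + 2)) = ∫⁻ σ : Sph (m + 2), f σ ∂(surf (m + 2)) := by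
  -- Averaging over rotations leaves the integral over the sphere unchanged. After the swap, right
  -- invariance shows that the average over `A` does not depend on `σ`.
  have h1 : ∫⁻ A : Rot (m + 2), ∫⁻ σ : Sph (m + 2),
      f ((A : Rn (m + 2) →L[ℝ] Rn (m + 2)) σ) ∂(surf (m + 2)) ∂(rotHaar (m + 2))
      = ∫⁻ σ : Sph (m + 2), f σ ∂(surf (m + 2)) := by
    simp [lintegral_surf_rot _ hf]
  rw [← h1, lintegral_lintegral_swap]
  · have : ∀ σ : Sph (m + 2), ∫⁻ A : Rot (m + 2), f ((A : Rn (m + 2) →L[ℝ] Rn (m + 2)) σ)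
        ∂(rotHaar (m + 2)) = ∫⁻ A : Rot (m + 2),
          f ((A : Rn (m + 2) →L[ℝ] Rn (m + 2)) (e0 (m + 1))) ∂(rotHaar (m + 2)) := fun σ => by
      obtain ⟨B, hB⟩ := exists_rot_single (m := m) (x := σ) (by simp)
      conv_rhs => rw [← lintegral_mul_right_eq_self _ B]
      refine lintegral_congr fun A => ?_
      rw [← hB]
      rfl
    simp only [this, lintegral_const, sphArea]
    exact mul_comm _ _
  · refine (hf.comp ?_).aemeasurable
    exact (continuous_rot_apply.comp
      (continuous_fst.prodMk (continuous_subtype_val.comp continuous_snd))).measurable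

/-- Disintegration of the product surface measure along great circles. -/
theorem lintegral_surf_surf {m : ℕ} (F : Rn (m + 2) → Rn (m + 2) → ℝ≥0∞)
    (hF : Measurable (Function.uncurry F)) :
    ∫⁻ x : Sph (m + 2), ∫⁻ y : Sph (m + 2), F x y ∂(surf (m + 2)) ∂(surf (m + 2)) =
      sphArea (m + 1) * (sphArea m * ∫⁻ θ in Ioo 0 Real.pi, ENNReal.ofReal (Real.sin θ ^ m) *
        ∫⁻ A : Rot (m + 2), F (arc A 0) (arc A θ) ∂(rotHaar (m + 2))) := by
  set T : Rot (m + 2) → Rn (m + 2) → Rn (m + 2) := fun A => (A : Rn (m + 2) →L[ℝ] Rn (m + 2))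
  -- The model point at inner product `c` with `e0`, on the half circle through `e0` and `e1`; for
  -- `c = cos θ` it is the point at angle `θ`.
  set p : ℝ → Rn (m + 2) := fun c => c • (e0 (m + 1) : Rn (m + 2)) + √(1 - c ^ 2) • e1 m with hp
  set Ψ : ℝ → ℝ≥0∞ := fun c => ∫⁻ A : Rot (m + 2), F (T A (e0 (m + 1))) (T A (p c))
    ∂(rotHaar (m + 2)) with hΨ
  have hpc : Continuous p := by fun_prop
  have hT : Continuous fun q : Rot (m + 2) × Rn (m + 2) => T q.1 q.2 := continuous_rot_apply
  have hΨm : Measurable Ψ := by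
    refine Measurable.lintegral_prod_right' (f := fun q : ℝ × Rot (m + 2) =>
      F (T q.2 (e0 (m + 1))) (T q.2 (p q.1))) ?_
    have hc : Continuous fun q : ℝ × Rot (m + 2) => (T q.2 (e0 (m + 1)), T q.2 (p q.1)) :=
      (hT.comp (continuous_snd.prodMk continuous_const)).prodMk
        (hT.comp (continuous_snd.prodMk (hpc.comp continuous_fst)))
    exact hF.comp hc.measurable
  -- Rotations act transitively on pairs of unit vectors with given inner product. Gram–Schmidt
  -- supplies the second frame vector, except when `y = ±x`, where one vector suffices.
  have key : ∀ x y : Sph (m + 2), ∃ B : Rot (m + 2), T B (e0 (m + 1)) = x ∧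
      T B (p ⟪(x : Rn (m + 2)), (y : Rn (m + 2))⟫) = y := fun x y => by
    set c := ⟪(x : Rn (m + 2)), (y : Rn (m + 2))⟫ with hc
    have hnx : ‖(x : Rn (m + 2))‖ = 1 := by simp
    have hny : ‖(y : Rn (m + 2))‖ = 1 := by simp
    have hsub : ‖(y : Rn (m + 2)) - c • (x : Rn (m + 2))‖ ^ 2 = 1 - c ^ 2 := by
      rw [norm_sub_sq_real, inner_smul_right, real_inner_comm, ← hc, norm_smul, hnx, hny]
      simp; ring
    have hpos : 0 ≤ 1 - c ^ 2 := hsub ▸ sq_nonneg _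
    rcases hpos.eq_or_lt with h | h
    · obtain ⟨B, hB⟩ := exists_rot_single (m := m) hnx
      refine ⟨B, hB, ?_⟩
      rw [← h, sq_eq_zero_iff, norm_eq_zero, sub_eq_zero] at hsub
      simp only [T, hp, ← h, Real.sqrt_zero, zero_smul, add_zero, map_smul, hB]
      exact hsub.symm
    · have hs : 0 < √(1 - c ^ 2) := Real.sqrt_pos.2 h
      obtain ⟨B, hB0, hB1⟩ := exists_rot_pair (m := m) (x := x)
        (e := (√(1 - c ^ 2))⁻¹ • ((y : Rn (m + 2)) - c • (x : Rn (m + 2)))) hnx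
        (by
          rw [norm_smul, norm_inv, Real.norm_eq_abs, abs_of_pos hs,
            inv_mul_eq_one₀ hs.ne', ← sq_eq_sq₀ hs.le (norm_nonneg _), hsub, Real.sq_sqrt hpos])
        (by
          rw [inner_smul_right, inner_sub_right, inner_smul_right, ← hc,
            real_inner_self_eq_norm_sq, hnx]
          simp) 1 (by simp)
      refine ⟨B, hB0, ?_⟩
      change T B (e1 m) = _ at hB1
      change T B (e0 (m + 1)) = _ at hB0
      have : T B (p c) = c • T B (e0 (m + 1)) + √(1 - c ^ 2) • T B (e1 m) := by simp [T, hp]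
      rw [this, hB0, hB1, smul_inv_smul₀ hs.ne']
      abel
  have hFT : ∀ A, Measurable fun q : Rn (m + 2) × Rn (m + 2) => F (T A q.1) (T A q.2) := fun A =>
    hF.comp (((hT.comp (continuous_const (y := A).prodMk continuous_fst)).prodMk
      (hT.comp (continuous_const (y := A).prodMk continuous_snd))).measurable)
  -- After averaging over rotations, the integrand depends on `x` and `y` only through their inner
  -- product, so the inner integral is that of a zonal function.
  have step1 : ∫⁻ x : Sph (m + 2), ∫⁻ y : Sph (m + 2), F x y ∂(surf (m + 2)) ∂(surf (m + 2)) =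
      ∫⁻ A : Rot (m + 2), ∫⁻ x : Sph (m + 2), ∫⁻ y : Sph (m + 2), F (T A x) (T A y)
        ∂(surf (m + 2)) ∂(surf (m + 2)) ∂(rotHaar (m + 2)) := by
    have : ∀ A : Rot (m + 2), ∫⁻ x : Sph (m + 2), ∫⁻ y : Sph (m + 2), F (T A x) (T A y)
        ∂(surf (m + 2)) ∂(surf (m + 2)) = ∫⁻ x : Sph (m + 2), ∫⁻ y : Sph (m + 2), F x y
        ∂(surf (m + 2)) ∂(surf (m + 2)) := fun A => by
      have h1 : ∀ x : Sph (m + 2), ∫⁻ y : Sph (m + 2), F (T A x) (T A y) ∂(surf (m + 2)) =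
          ∫⁻ y : Sph (m + 2), F (T A x) y ∂(surf (m + 2)) := fun x =>
        lintegral_surf_rot A (hF.comp (measurable_const.prodMk measurable_id))
      simp only [h1]
      exact lintegral_surf_rot A (f := fun x => ∫⁻ y : Sph (m + 2), F x y ∂(surf (m + 2)))
        (Measurable.lintegral_prod_right' (f := fun q : Rn (m + 2) × Sph (m + 2) => F q.1 q.2)
          (hF.comp (measurable_fst.prodMk (measurable_subtype_coe.comp measurable_snd))))
    simp [this]
  have step2 : ∀ x y : Sph (m + 2), ∫⁻ A : Rot (m + 2), F (T A x) (T A y) ∂(rotHaar (m + 2)) =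
      Ψ ⟪(x : Rn (m + 2)), (y : Rn (m + 2))⟫ := fun x y => by
    obtain ⟨B, hB0, hB1⟩ := key x y
    rw [hΨ]
    simp only
    conv_rhs => rw [← lintegral_mul_right_eq_self _ B]
    refine lintegral_congr fun A => ?_
    have : ∀ z, T (A * B) z = T A (T B z) := fun z => rfl
    rw [this, this, hB0, hB1]
  have step3 : ∫⁻ x : Sph (m + 2), ∫⁻ y : Sph (m + 2), F x y ∂(surf (m + 2)) ∂(surf (m + 2)) =
      ∫⁻ x : Sph (m + 2), ∫⁻ y : Sph (m + 2), Ψ ⟪(x : Rn (m + 2)), (y : Rn (m + 2))⟫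
        ∂(surf (m + 2)) ∂(surf (m + 2)) := by
    rw [step1, lintegral_lintegral_swap]
    · refine lintegral_congr fun x => ?_
      rw [lintegral_lintegral_swap]
      · exact lintegral_congr fun y => step2 x y
      · have hc : Continuous fun q : Rot (m + 2) × Sph (m + 2) =>
            (T q.1 (x : Rn (m + 2)), T q.1 (q.2 : Rn (m + 2))) :=
          (hT.comp (continuous_fst.prodMk continuous_const)).prodMk
            (hT.comp (continuous_fst.prodMk (continuous_subtype_val.comp continuous_snd)))
        exact (hF.comp hc.measurable).aemeasurable
    · have hc : Continuous fun q : (Rot (m + 2) × Sph (m + 2)) × Sph (m + 2) =>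
          (T q.1.1 (q.1.2 : Rn (m + 2)), T q.1.1 (q.2 : Rn (m + 2))) :=
        (hT.comp (continuous_fst.fst.prodMk (continuous_subtype_val.comp
          continuous_fst.snd))).prodMk
            (hT.comp (continuous_fst.fst.prodMk (continuous_subtype_val.comp continuous_snd)))
      exact (Measurable.lintegral_prod_right'
        (f := fun q : (Rot (m + 2) × Sph (m + 2)) × Sph (m + 2) => F (T q.1.1 q.1.2) (T q.1.1 q.2))
        (hF.comp hc.measurable)).aemeasurable
  have step4 : ∀ x : Sph (m + 2), ∫⁻ y : Sph (m + 2), Ψ ⟪(x : Rn (m + 2)), (y : Rn (m + 2))⟫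
      ∂(surf (m + 2)) = sphArea m *
        ∫⁻ θ in Ioo 0 Real.pi, ENNReal.ofReal (Real.sin θ ^ m) * Ψ (Real.cos θ) := fun x => by
    obtain ⟨B, hB⟩ := exists_rot_single (m := m) (x := x) (by simp)
    rw [← lintegral_zonal Ψ hΨm, ← lintegral_surf_rot B
      (f := fun y => Ψ ⟪(x : Rn (m + 2)), y⟫) (by fun_prop)]
    simp only [← hB, inner_rot_apply]
  rw [step3]
  simp only [step4, lintegral_const]
  rw [mul_comm, sphArea]
  congr 2
  refine setLIntegral_congr_fun measurableSet_Ioo fun θ hθ => ?_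
  simp only [hΨ, hp]
  congr 1
  refine lintegral_congr fun A => ?_
  rw [show 1 - Real.cos θ ^ 2 = Real.sin θ ^ 2 by rw [Real.sin_sq],
    Real.sqrt_sq (Real.sin_nonneg_of_nonneg_of_le_pi hθ.1.le hθ.2.le)]
  simp [T, arc]

/-- Isotropy of the second vector of a random frame. -/
theorem lintegral_inner_sq_le {m : ℕ} {v : Rn (m + 2) → Rn (m + 2)} (hv : Measurable v) :
    (m + 1 : ℕ) * ∫⁻ A : Rot (m + 2), ENNReal.ofReal
      (⟪v ((A : Rn (m + 2) →L[ℝ] Rn (m + 2)) (e0 (m + 1))),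
        (A : Rn (m + 2) →L[ℝ] Rn (m + 2)) (e1 m)⟫ ^ 2) ∂(rotHaar (m + 2)) ≤
    ∫⁻ A : Rot (m + 2), ENNReal.ofReal
      (‖v ((A : Rn (m + 2) →L[ℝ] Rn (m + 2)) (e0 (m + 1)))‖ ^ 2) ∂(rotHaar (m + 2)) := by
  set T : Rot (m + 2) → Rn (m + 2) → Rn (m + 2) := fun A => (A : Rn (m + 2) →L[ℝ] Rn (m + 2))
  have hT : Continuous fun q : Rot (m + 2) × Rn (m + 2) => T q.1 q.2 := continuous_rot_apply
  -- Right multiplication by a rotation fixing `e0` exchanges the remaining frame vectors, so all `m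
  -- + 1` of them contribute equally.
  have hj : ∀ j : Fin (m + 1), ∫⁻ A : Rot (m + 2), ENNReal.ofReal
      (⟪v (T A (e0 (m + 1))), T A (EuclideanSpace.single j.succ 1)⟫ ^ 2) ∂(rotHaar (m + 2)) =
      ∫⁻ A : Rot (m + 2), ENNReal.ofReal
      (⟪v (T A (e0 (m + 1))), T A (e1 m)⟫ ^ 2) ∂(rotHaar (m + 2)) := fun j => by
    obtain ⟨B, hB0, hB1⟩ := exists_rot_pair (m := m) (x := e0 (m + 1)) (e := e1 m) (by simp)
      (norm_e1 m) (inner_e0_e1 m) j.succ (Fin.succ_ne_zero j)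
    conv_lhs => rw [← lintegral_mul_right_eq_self _ B]
    refine lintegral_congr fun A => ?_
    have : ∀ z, T (A * B) z = T A (T B z) := fun z => rfl
    rw [this, this]
    change T B _ = _ at hB0
    change T B _ = _ at hB1
    rw [hB0, hB1]
  have hm : ∀ w : Rn (m + 2), Measurable fun A : Rot (m + 2) => T A w := fun w =>
    (hT.comp (continuous_id.prodMk continuous_const)).measurable
  calc _ = ∑ j : Fin (m + 1), (∫⁻ A : Rot (m + 2), ENNReal.ofReal
      (⟪v (T A (e0 (m + 1))), T A (EuclideanSpace.single j.succ 1)⟫ ^ 2) ∂(rotHaar (m + 2))) := by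
        simp only [hj]
        simp
        rfl
    _ = ∫⁻ A : Rot (m + 2), (∑ j : Fin (m + 1), ENNReal.ofReal
      (⟪v (T A (e0 (m + 1))), T A (EuclideanSpace.single j.succ 1)⟫ ^ 2)) ∂(rotHaar (m + 2)) := by
        rw [lintegral_finsetSum]
        intro j _
        have := hm (EuclideanSpace.single j.succ 1)
        have := hm (e0 (m + 1))
        fun_prop
    _ ≤ _ := by
        refine lintegral_mono fun A => ?_
        rw [← ENNReal.ofReal_sum_of_nonneg fun _ _ => sq_nonneg _]
        refine ENNReal.ofReal_le_ofReal ?_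
        -- The frame vectors other than the first are orthonormal; Bessel's inequality bounds the
        -- sum of squares and discards the component along `A e0`.
        have ho : Orthonormal ℝ fun j : Fin (m + 1) =>
            T A (EuclideanSpace.single j.succ (1 : ℝ)) := by
          have h := (EuclideanSpace.basisFun (Fin (m + 2)) ℝ).orthonormal.comp_linearIsometryEquiv
            (Unitary.linearIsometryEquiv A)
          have h' := h.comp Fin.succ (Fin.succ_injective _)
          have he : (fun j : Fin (m + 1) => T A (EuclideanSpace.single j.succ (1 : ℝ))) =
              ((Unitary.linearIsometryEquiv A) ∘ (EuclideanSpace.basisFun (Fin (m + 2)) ℝ)) ∘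
                Fin.succ := by
            ext1 j
            simp only [Function.comp_apply, EuclideanSpace.basisFun_apply]
            rfl
          rw [he]
          exact h'
        have := ho.sum_inner_products_le (x := v (T A (e0 (m + 1)))) (s := Finset.univ)
        simpa [real_inner_comm] using this

end

/-! ### Extension along rays and the tangential gradient -/

theorem homExt_coe {n : ℕ} (u : Sph n → ℝ) (σ : Sph n) : homExt u σ = u σ := by
  have h : (σ : Rn n) ≠ 0 := ne_zero_of_mem_unit_sphere σ
  have h1 : ‖(σ : Rn n)‖ = 1 := by simp
  simp only [homExt, h, dite_false, h1, inv_one, one_smul]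

theorem homExt_of_norm_one {n : ℕ} (u : Sph n → ℝ) {x : Rn n} (hx : ‖x‖ = 1) :
    homExt u x = u ⟨x, by simpa using hx⟩ :=
  homExt_coe u ⟨x, by simpa using hx⟩

theorem homExt_smul {n : ℕ} (u : Sph n → ℝ) {r : ℝ} (hr : 0 < r) (x : Rn n) :
    homExt u (r • x) = homExt u x := by
  by_cases hx : x = 0
  · simp [hx]
  · have hrx : r • x ≠ 0 := smul_ne_zero hr.ne' hx
    simp only [homExt, hx, hrx, dite_false]
    congr 2
    rw [norm_smul, Real.norm_eq_abs, abs_of_pos hr, smul_smul, mul_inv, mul_right_comm,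
      inv_mul_cancel₀ hr.ne', one_mul]

theorem norm_normalize_sub_le {n : ℕ} {x y : Rn n} (hx : 1 / 2 < ‖x‖) (hy : 1 / 2 < ‖y‖) :
    ‖‖x‖⁻¹ • x - ‖y‖⁻¹ • y‖ ≤ 4 * ‖x - y‖ := by
  have hx0 : 0 < ‖x‖ := by linarith
  have hy0 : 0 < ‖y‖ := by linarith
  have h1 : ‖x‖⁻¹ • x - ‖y‖⁻¹ • y = ‖x‖⁻¹ • ((x - y) + ((‖y‖ - ‖x‖) * ‖y‖⁻¹) • y) := by
    rw [smul_add, smul_sub, smul_smul, sub_mul, mul_inv_cancel₀ hy0.ne', mul_sub, mul_one,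
      ← mul_assoc, inv_mul_cancel₀ hx0.ne', one_mul, sub_smul]
    abel
  rw [h1, norm_smul, norm_inv, norm_norm]
  have h2 : ‖(x - y) + ((‖y‖ - ‖x‖) * ‖y‖⁻¹) • y‖ ≤ 2 * ‖x - y‖ := by
    refine (norm_add_le _ _).trans ?_
    rw [norm_smul, norm_mul, norm_inv, norm_norm, mul_assoc, inv_mul_cancel₀ hy0.ne', mul_one,
      Real.norm_eq_abs, two_mul]
    gcongr
    rw [norm_sub_rev x y]
    exact abs_norm_sub_norm_le y x
  have h3 : ‖x‖⁻¹ ≤ 2 := by rw [inv_le_comm₀ hx0 two_pos]; linarith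
  calc _ ≤ 2 * (2 * ‖x - y‖) := by gcongr
    _ = _ := by ring

/-- Normalization of vectors is `4`-Lipschitz outside the ball of radius `1 / 2`. An open
neighbourhood of the sphere is needed to differentiate the extension at points of the sphere. -/
theorem lipschitzOnWith_homExt {n : ℕ} {u : Sph n → ℝ} {L : ℝ≥0} (hu : LipschitzWith L u) :
    LipschitzOnWith (4 * L) (homExt u) {x | 1 / 2 < ‖x‖} := by
  refine LipschitzOnWith.of_dist_le_mul fun x hx y hy => ?_
  have hx0 : x ≠ 0 := by rintro rfl; simp at hx; linarith
  have hy0 : y ≠ 0 := by rintro rfl; simp at hy; linarith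
  simp only [homExt, hx0, hy0, dite_false]
  refine (hu.dist_le_mul _ _).trans ?_
  rw [Subtype.dist_eq, dist_eq_norm, dist_eq_norm]
  have := norm_normalize_sub_le hx hy
  push_cast
  calc _ ≤ (L : ℝ) * (4 * ‖x - y‖) := by gcongr
    _ = _ := by ring

theorem isOpen_half_lt_norm (n : ℕ) : IsOpen {x : Rn n | 1 / 2 < ‖x‖} :=
  isOpen_lt continuous_const continuous_norm

theorem measurable_homExt {n : ℕ} {u : Sph n → ℝ} {L : ℝ≥0} (hu : LipschitzWith L u) :
    Measurable (homExt u) := by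
  refine measurable_of_continuousOn_compl_singleton 0 (continuousOn_iff_continuous_domRestrict.2 ?_)
  have h : ∀ y : ({0}ᶜ : Set (Rn n)), ‖(y : Rn n)‖⁻¹ • (y : Rn n) ∈ Metric.sphere (0 : Rn n) 1 :=
    fun y => by
      rw [mem_sphere_zero_iff_norm, norm_smul, norm_inv, norm_norm,
        inv_mul_cancel₀ (norm_ne_zero_iff.2 y.2)]
  have he : ({0}ᶜ : Set (Rn n)).domRestrict (homExt u) = fun y => u ⟨_, h y⟩ := by
    ext y
    have hy : (y : Rn n) ≠ 0 := y.2
    simp only [Set.domRestrict_apply, homExt, hy, dite_false]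
  rw [he]
  refine hu.continuous.comp (Continuous.subtype_mk ?_ _)
  exact (continuous_subtype_val.norm.inv₀ fun y => norm_ne_zero_iff.2 y.2).smul
    continuous_subtype_val

theorem measurable_gradient {n : ℕ} (f : Rn n → ℝ) : Measurable (gradient f) :=
  (InnerProductSpace.toDual ℝ (Rn n)).symm.continuous.measurable.comp (measurable_fderiv ℝ f)

/-- Rademacher's theorem controls the extension up to a volume-null set. By polar coordinates almost
every ray contains a point of differentiability of radius greater than `1`, and constancy along rays
carries differentiability back to the sphere. -/
theorem ae_surf_differentiableAt {m : ℕ} {u : Sph (m + 2) → ℝ} {L : ℝ≥0}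
    (hu : LipschitzWith L u) :
    ∀ᵐ σ : Sph (m + 2) ∂(surf (m + 2)), DifferentiableAt ℝ (homExt u) (σ : Rn (m + 2)) := by
  set N : Set (Rn (m + 2)) := {x | 1 / 2 < ‖x‖ ∧ ¬ DifferentiableAt ℝ (homExt u) x} with hN
  have hNm : MeasurableSet N :=
    (isOpen_half_lt_norm _).measurableSet.inter (measurableSet_of_differentiableAt ℝ _).compl
  have hN0 : volume N = 0 := by
    have h := (lipschitzOnWith_homExt hu).ae_differentiableWithinAt_of_mem (μ := volume)
    rw [ae_iff] at h
    refine measure_mono_null ?_ h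
    rintro x ⟨hx, hx'⟩
    simp only [Classical.not_imp, mem_ofPred_eq]
    exact ⟨hx, fun hd => hx' (hd.differentiableAt ((isOpen_half_lt_norm _).mem_nhds hx))⟩
  have h1 := lintegral_polar (N.indicator 1) (measurable_one.indicator hNm)
  rw [lintegral_indicator_one hNm, hN0, eq_comm, lintegral_eq_zero_iff] at h1
  · filter_upwards [h1] with σ hσ
    rw [Pi.zero_apply, lintegral_eq_zero_iff] at hσ
    · have : ∀ᵐ r : ℝ ∂(volume.restrict (Ioi 0)), r • (σ : Rn (m + 2)) ∉ N := by
        filter_upwards [hσ, ae_restrict_mem measurableSet_Ioi] with r hr hr0 hrN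
        rw [Pi.zero_apply, indicator_of_mem hrN] at hr
        simp only [Pi.one_apply, mul_one, ENNReal.ofReal_eq_zero] at hr
        exact absurd (pow_pos (mem_Ioi.1 hr0) _) (not_lt.2 hr)
      obtain ⟨r, hr, hrN⟩ : ∃ r ∈ Ioi (1 : ℝ), r • (σ : Rn (m + 2)) ∉ N := by
        have h2 : ∀ᵐ r : ℝ ∂(volume.restrict (Ioi 1)), r • (σ : Rn (m + 2)) ∉ N :=
          ae_restrict_of_ae_restrict_of_subset (Ioi_subset_Ioi zero_le_one) this
        have h3 : (volume.restrict (Ioi (1 : ℝ))) ≠ 0 := by simp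
        have : NeZero (volume.restrict (Ioi (1 : ℝ))) := ⟨h3⟩
        obtain ⟨r, hr, hr'⟩ := (h2.and (ae_restrict_mem measurableSet_Ioi)).exists
        exact ⟨r, hr', hr⟩
      have hr0 : (0 : ℝ) < r := lt_trans one_pos hr
      have hd : DifferentiableAt ℝ (homExt u) (r • (σ : Rn (m + 2))) := by
        by_contra h
        refine hrN ⟨?_, h⟩
        rw [norm_smul, norm_eq_of_mem_sphere, Real.norm_eq_abs, abs_of_pos hr0]
        linarith [mem_Ioi.1 hr]
      have he : homExt u = fun x => homExt u (r • x) := by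
        ext x; rw [homExt_smul u hr0]
      rw [he]
      exact hd.comp (σ : Rn (m + 2)) (differentiableAt_id.const_smul r)
    · have : Measurable (N.indicator (1 : Rn (m + 2) → ℝ≥0∞)) := measurable_one.indicator hNm
      fun_prop
  · have : Measurable (N.indicator (1 : Rn (m + 2) → ℝ≥0∞)) := measurable_one.indicator hNm
    refine Measurable.lintegral_prod_right' (f := fun q : Sph (m + 2) × ℝ =>
      ENNReal.ofReal (q.2 ^ (m + 1)) * N.indicator 1 (q.2 • (q.1 : Rn (m + 2)))) ?_
    fun_prop

theorem norm_tanGrad_le {n : ℕ} {u : Sph n → ℝ} {L : ℝ≥0} (hu : LipschitzWith L u)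
    (σ : Sph n) : ‖tanGrad u σ‖ ≤ 4 * L := by
  rw [tanGrad, gradient, LinearIsometryEquiv.norm_map]
  have h : {x : Rn n | 1 / 2 < ‖x‖} ∈ 𝓝 (σ : Rn n) := by
    refine (isOpen_half_lt_norm _).mem_nhds ?_
    simp only [mem_ofPred_eq, norm_eq_of_mem_sphere]
    norm_num
  exact_mod_cast norm_fderiv_le_of_lipschitzOn ℝ h (lipschitzOnWith_homExt hu)

theorem measurable_tanGrad {n : ℕ} (u : Sph n → ℝ) : Measurable (tanGrad u) :=
  (measurable_gradient _).comp measurable_subtype_coe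

theorem integrable_norm_tanGrad_sq {n : ℕ} {u : Sph n → ℝ} {L : ℝ≥0} (hu : LipschitzWith L u) :
    Integrable (fun σ => ‖tanGrad u σ‖ ^ 2) (surf n) := by
  refine Integrable.of_bound ((measurable_tanGrad u).norm.pow_const 2).aestronglyMeasurable
    ((4 * L) ^ 2) (ae_of_all _ fun σ => ?_)
  rw [norm_pow, norm_norm]
  gcongr
  exact norm_tanGrad_le hu σ

theorem gradNormSqL2_nonneg {n : ℕ} (u : Sph n → ℝ) : 0 ≤ gradNormSqL2 u :=
  integral_nonneg fun _ => sq_nonneg _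

theorem ofReal_gradNormSqL2 {n : ℕ} {u : Sph n → ℝ} {L : ℝ≥0} (hu : LipschitzWith L u) :
    ENNReal.ofReal (gradNormSqL2 u) =
      ∫⁻ σ : Sph n, ENNReal.ofReal (‖gradient (homExt u) (σ : Rn n)‖ ^ 2) ∂(surf n) :=
  ofReal_integral_eq_lintegral_ofReal (integrable_norm_tanGrad_sq hu)
    (ae_of_all _ fun _ => sq_nonneg _)

/-! ### Lipschitz functions along great circles -/

theorem arc_zero {m : ℕ} (A : Rot (m + 2)) :
    arc A 0 = (A : Rn (m + 2) →L[ℝ] Rn (m + 2)) (e0 (m + 1)) := by simp [arc]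

theorem arcDeriv_zero {m : ℕ} (A : Rot (m + 2)) :
    arcDeriv A 0 = (A : Rn (m + 2) →L[ℝ] Rn (m + 2)) (e1 m) := by simp [arcDeriv]

theorem arc_add {m : ℕ} (A : Rot (m + 2)) (s t : ℝ) :
    arc A (s + t) = Real.cos t • arc A s + Real.sin t • arcDeriv A s := by
  simp only [arc, arcDeriv, Real.cos_add, Real.sin_add, smul_add, smul_smul, sub_smul, add_smul]
  rw [show Real.sin t * -Real.sin s = -(Real.sin s * Real.sin t) by ring, neg_smul,
    mul_comm (Real.cos t) (Real.cos s), mul_comm (Real.cos t) (Real.sin s),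
    mul_comm (Real.sin t) (Real.cos s)]
  abel

theorem measurable_arc (m : ℕ) : Measurable fun q : Rot (m + 2) × ℝ => arc q.1 q.2 :=
  (continuous_arc (m := m)).measurable

theorem measurable_arcDeriv (m : ℕ) : Measurable fun q : Rot (m + 2) × ℝ => arcDeriv q.1 q.2 :=
  (continuous_arcDeriv (m := m)).measurable

theorem measurable_arc_comp {α : Type*} [MeasurableSpace α] {m : ℕ} {f : α → Rot (m + 2)}
    {g : α → ℝ} (hf : Measurable f) (hg : Measurable g) : Measurable fun a => arc (f a) (g a) := by
  have h := Measurable.comp (measurable_arc m) (hf.prodMk hg)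
  exact h

theorem measurable_arcDeriv_comp {α : Type*} [MeasurableSpace α] {m : ℕ} {f : α → Rot (m + 2)}
    {g : α → ℝ} (hf : Measurable f) (hg : Measurable g) :
    Measurable fun a => arcDeriv (f a) (g a) := by
  have h := Measurable.comp (measurable_arcDeriv m) (hf.prodMk hg)
  exact h

/-- For each fixed time the point of a random great circle is uniformly distributed, so it avoids
null sets of the sphere almost surely. -/
theorem ae_rot_arc {m : ℕ} {s : Set (Rn (m + 2))} (hs : MeasurableSet s)
    (h : ∀ᵐ σ : Sph (m + 2) ∂(surf (m + 2)), (σ : Rn (m + 2)) ∈ s) (t : ℝ) :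
    ∀ᵐ A ∂(rotHaar (m + 2)), arc A t ∈ s := by
  have h1 := lintegral_rot_e0 (m := m) (f := sᶜ.indicator 1) (measurable_one.indicator hs.compl)
  have h2 : ∫⁻ σ : Sph (m + 2), sᶜ.indicator 1 (σ : Rn (m + 2)) ∂(surf (m + 2)) = 0 := by
    rw [← lintegral_zero (μ := surf (m + 2))]
    refine lintegral_congr_ae ?_
    filter_upwards [h] with σ hσ
    simp [hσ]
  rw [h2, mul_eq_zero, or_iff_right (sphArea_ne_zero _)] at h1
  have h3 := lintegral_rot_shift (m := m) (fun x _ => sᶜ.indicator (1 : Rn (m + 2) → ℝ≥0∞) x) t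
  rw [h1, lintegral_eq_zero_iff] at h3
  · filter_upwards [h3] with A hA
    by_contra hc
    simp [hc] at hA
  · exact (measurable_one.indicator hs.compl).comp
      (measurable_arc_comp measurable_id measurable_const)

/-- The exceptional set is measurable in frame and time jointly, so Fubini exchanges the two
quantifiers: almost every circle meets the null set only at a null set of times. -/
theorem ae_ae_arc {m : ℕ} {s : Set (Rn (m + 2))} (hs : MeasurableSet s)
    (h : ∀ᵐ σ : Sph (m + 2) ∂(surf (m + 2)), (σ : Rn (m + 2)) ∈ s) {f : ℝ → ℝ} (hf : Measurable f) :
    ∀ᵐ A ∂(rotHaar (m + 2)), ∀ᵐ t : ℝ, arc A (f t) ∈ s := by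
  have hm : Measurable fun p : ℝ × Rot (m + 2) => arc p.2 (f p.1) :=
    measurable_arc_comp measurable_snd (hf.comp measurable_fst)
  have hm' : MeasurableSet {p : ℝ × Rot (m + 2) | arc p.2 (f p.1) ∈ s} :=
    measurableSet_preimage hm hs
  exact (Measure.ae_ae_comm (p := fun t A => arc A (f t) ∈ s) hm').1
    (ae_of_all _ fun t => ae_rot_arc hs h (f t))

theorem norm_arc_sub_le {m : ℕ} (A : Rot (m + 2)) (s t : ℝ) : ‖arc A s - arc A t‖ ≤ |s - t| := by
  have h : LipschitzWith 1 (arc A) := by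
    refine lipschitzWith_of_nnnorm_deriv_le (fun s => (hasDerivAt_arc A s).differentiableAt)
      fun s => ?_
    rw [(hasDerivAt_arc A s).deriv, ← NNReal.coe_le_coe]
    simp
  have := h.dist_le_mul s t
  rwa [dist_eq_norm, NNReal.coe_one, one_mul, Real.dist_eq] at this

theorem lipschitzWith_homExt_arc {m : ℕ} {u : Sph (m + 2) → ℝ} {L : ℝ≥0}
    (hu : LipschitzWith L u) (A : Rot (m + 2)) : LipschitzWith L fun s => homExt u (arc A s) := by
  refine LipschitzWith.of_dist_le_mul fun s t => ?_
  rw [homExt_of_norm_one u (norm_arc A s), homExt_of_norm_one u (norm_arc A t)]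
  refine (hu.dist_le_mul _ _).trans ?_
  rw [Subtype.dist_eq, dist_eq_norm, Real.dist_eq]
  gcongr
  exact norm_arc_sub_le A s t

theorem hasDerivAt_homExt_arc {m : ℕ} {u : Sph (m + 2) → ℝ} {A : Rot (m + 2)} {s : ℝ}
    (h : DifferentiableAt ℝ (homExt u) (arc A s)) :
    HasDerivAt (fun s => homExt u (arc A s)) ⟪gradient (homExt u) (arc A s), arcDeriv A s⟫ s := by
  have h1 := h.hasFDerivAt.comp_hasDerivAt s (hasDerivAt_arc A s)
  rw [gradient, InnerProductSpace.toDual_symm_apply]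
  exact h1

/-- A function with tangential gradient bounded by one is `1`-Lipschitz along almost every great
circle. -/
theorem ae_lipschitzWith_homExt_arc {m : ℕ} {u : Sph (m + 2) → ℝ} {L : ℝ≥0}
    (hu : LipschitzWith L u) (h : ∀ᵐ σ ∂(surf (m + 2)), ‖tanGrad u σ‖ ≤ 1) :
    ∀ᵐ A ∂(rotHaar (m + 2)), ∀ s t : ℝ, |homExt u (arc A s) - homExt u (arc A t)| ≤ |s - t| := by
  have hs : MeasurableSet {x : Rn (m + 2) | DifferentiableAt ℝ (homExt u) x ∧
      ‖gradient (homExt u) x‖ ≤ 1} :=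
    (measurableSet_of_differentiableAt ℝ _).inter
      ((measurable_gradient _).norm measurableSet_Iic)
  have h1 : ∀ᵐ σ : Sph (m + 2) ∂(surf (m + 2)), (σ : Rn (m + 2)) ∈
      {x : Rn (m + 2) | DifferentiableAt ℝ (homExt u) x ∧ ‖gradient (homExt u) x‖ ≤ 1} := by
    filter_upwards [h, ae_surf_differentiableAt hu] with σ h1 h2
    exact ⟨h2, h1⟩
  filter_upwards [ae_ae_arc hs h1 measurable_id] with A hA s t
  -- The given Lipschitz constant only serves to make the restriction absolutely continuous;
  -- integrating its derivative then yields the constant `1` from the gradient bound.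
  have hac := ((lipschitzWith_homExt_arc hu A).lipschitzOnWith
    (s := uIcc t s)).absolutelyContinuousOnInterval
  rw [← hac.integral_deriv_eq_sub, ← one_mul |s - t|]
  refine intervalIntegral.norm_integral_le_of_norm_le_const_ae (E := ℝ) ?_
  filter_upwards [hA] with r hr _
  rw [(hasDerivAt_homExt_arc (s := r) hr.1).deriv]
  refine (abs_real_inner_le_norm _ _).trans ?_
  rw [norm_arcDeriv, mul_one]
  exact hr.2

/-- The fundamental theorem of calculus along the arc, parametrized over the unit interval, followed
by Jensen's inequality for the square. -/
theorem sq_sub_le_lintegral_arc {m : ℕ} {u : Sph (m + 2) → ℝ} {L : ℝ≥0}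
    (hu : LipschitzWith L u) (θ : ℝ) :
    ∀ᵐ A ∂(rotHaar (m + 2)),
      ENNReal.ofReal ((homExt u (arc A 0) - homExt u (arc A θ)) ^ 2) ≤ ENNReal.ofReal (θ ^ 2) *
        ∫⁻ w in Ioo (0 : ℝ) 1, ENNReal.ofReal
          (⟪gradient (homExt u) (arc A (w * θ)), arcDeriv A (w * θ)⟫ ^ 2) := by
  filter_upwards [ae_ae_arc (measurableSet_of_differentiableAt ℝ _) (ae_surf_differentiableAt hu)
    (measurable_id.mul_const θ)] with A hA
  set f : ℝ → ℝ := fun w => homExt u (arc A (w * θ)) with hf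
  set D : ℝ → ℝ := fun w => ⟪gradient (homExt u) (arc A (w * θ)), arcDeriv A (w * θ)⟫ with hD
  have hmul : ∀ w, HasDerivAt (fun w : ℝ => w * θ) θ w := fun w => by
    simpa using (hasDerivAt_id w).mul_const θ
  have hder : ∀ᵐ w : ℝ, HasDerivAt f (D w * θ) w := by
    filter_upwards [hA] with w hw
    exact (hasDerivAt_homExt_arc hw).comp w (hmul w)
  have hlip : LipschitzWith (L * ‖θ‖₊) f := by
    refine (lipschitzWith_homExt_arc hu A).comp (LipschitzWith.of_dist_le_mul fun a b => ?_)
    rw [Real.dist_eq, Real.dist_eq, ← sub_mul, abs_mul, mul_comm]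
    rfl
  have hac := (hlip.lipschitzOnWith (s := uIcc 0 1)).absolutelyContinuousOnInterval
  have hint := hac.integral_deriv_eq_sub
  have hDm : Measurable D := by
    have h1 : Measurable fun w : ℝ => arc A (w * θ) :=
      measurable_arc_comp measurable_const (by fun_prop)
    have h2 : Measurable fun w : ℝ => arcDeriv A (w * θ) :=
      measurable_arcDeriv_comp measurable_const (by fun_prop)
    exact ((measurable_gradient _).comp h1).inner h2
  have hDb : ∀ w, |D w| ≤ 4 * L := fun w => by
    refine (abs_real_inner_le_norm _ _).trans ?_
    rw [norm_arcDeriv, mul_one]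
    exact norm_tanGrad_le hu ⟨arc A (w * θ), by simp⟩
  have hI : ∫ w in Ioo (0 : ℝ) 1, D w * θ = f 1 - f 0 := by
    rw [← hint, intervalIntegral.integral_of_le zero_le_one, integral_Ioc_eq_integral_Ioo]
    refine integral_congr_ae (ae_restrict_of_ae ?_)
    filter_upwards [hder] with w hw
    exact hw.deriv.symm
  have hprob : IsProbabilityMeasure (volume.restrict (Ioo (0 : ℝ) 1)) := ⟨by simp⟩
  have hDi : Integrable D (volume.restrict (Ioo (0 : ℝ) 1)) :=
    Integrable.of_bound hDm.aestronglyMeasurable (4 * L) (ae_of_all _ hDb)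
  have hDi2 : Integrable (fun w => D w ^ 2) (volume.restrict (Ioo (0 : ℝ) 1)) := by
    refine Integrable.of_bound (hDm.pow_const 2).aestronglyMeasurable ((4 * L) ^ 2)
      (ae_of_all _ fun w => ?_)
    rw [norm_pow]
    gcongr
    exact hDb w
  -- Jensen's inequality as nonnegativity of the variance of `D`.
  have hJ : (∫ w in Ioo (0 : ℝ) 1, D w) ^ 2 ≤ ∫ w in Ioo (0 : ℝ) 1, D w ^ 2 := by
    set c := ∫ w in Ioo (0 : ℝ) 1, D w with hc
    have h0 : 0 ≤ ∫ w in Ioo (0 : ℝ) 1, (D w - c) ^ 2 := integral_nonneg fun _ => sq_nonneg _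
    have h1 : ∫ w in Ioo (0 : ℝ) 1, (D w - c) ^ 2 = (∫ w in Ioo (0 : ℝ) 1, D w ^ 2) - c ^ 2 := by
      have : ∀ w, (D w - c) ^ 2 = (D w ^ 2 - 2 * c * D w) + c ^ 2 := fun w => by ring
      simp only [this]
      rw [integral_add (f := fun w => D w ^ 2 - 2 * c * D w) (g := fun _ => c ^ 2)
          (hDi2.sub (hDi.const_mul _)) (integrable_const _),
        integral_sub (g := fun w => 2 * c * D w) hDi2 (hDi.const_mul _), integral_const_mul, ← hc]
      simp
      ring
    linarith
  rw [← ofReal_integral_eq_lintegral_ofReal hDi2 (ae_of_all _ fun _ => sq_nonneg _),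
    ← ENNReal.ofReal_mul (sq_nonneg _)]
  refine ENNReal.ofReal_le_ofReal ?_
  have h01 : homExt u (arc A 0) - homExt u (arc A θ) = -(θ * ∫ w in Ioo (0 : ℝ) 1, D w) := by
    rw [integral_mul_const] at hI
    rw [mul_comm, hI]
    simp [hf]
  rw [h01, neg_sq, mul_pow]
  gcongr

/-! ### Nonlocal energies against the Dirichlet energy -/

theorem measurable_uncurry_comp {α β γ δ : Type*} [MeasurableSpace α] [MeasurableSpace β]
    [MeasurableSpace γ] [MeasurableSpace δ] {F : β → γ → δ} (hF : Measurable (Function.uncurry F))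
    {f : α → β} {g : α → γ} (hf : Measurable f) (hg : Measurable g) :
    Measurable fun a => F (f a) (g a) := by
  have h := Measurable.comp hF (hf.prodMk hg)
  exact h

theorem measurable_uncurry_left {β γ δ : Type*} [MeasurableSpace β]
    [MeasurableSpace γ] [MeasurableSpace δ] {F : β → γ → δ} (hF : Measurable (Function.uncurry F))
    (b : β) : Measurable (F b) :=
  measurable_uncurry_comp hF measurable_const measurable_id

/-- The squared derivative at the first vector of the frame `A`, in the direction of the second
vector, of the function with gradient `g`. -/
def frameEnergy {m : ℕ} (g : Rn (m + 2) → Rn (m + 2)) (A : Rot (m + 2)) : ℝ≥0∞ :=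
  ENNReal.ofReal (⟪g ((A : Rn (m + 2) →L[ℝ] Rn (m + 2)) (e0 (m + 1))),
      (A : Rn (m + 2) →L[ℝ] Rn (m + 2)) (e1 m)⟫ ^ 2)

theorem measurable_frameEnergy_arc {m : ℕ} {g : Rn (m + 2) → Rn (m + 2)} (hg : Measurable g)
    {α : Type*} [MeasurableSpace α] {f : α → Rot (m + 2)} {h : α → ℝ} (hf : Measurable f)
    (hh : Measurable h) : Measurable fun a =>
      ENNReal.ofReal (⟪g (arc (f a) (h a)), arcDeriv (f a) (h a)⟫ ^ 2) := by
  have h1 := measurable_arc_comp hf hh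
  have h2 := measurable_arcDeriv_comp hf hh
  have h3 := Measurable.comp hg h1
  have h4 := h3.inner (𝕜 := ℝ) h2
  exact (h4.pow_const 2).ennreal_ofReal

theorem measurable_frameEnergy {m : ℕ} {g : Rn (m + 2) → Rn (m + 2)} (hg : Measurable g) :
    Measurable (frameEnergy g) := by
  have h := measurable_frameEnergy_arc hg (measurable_id (α := Rot (m + 2)))
    (measurable_const (a := (0 : ℝ)))
  simp only [arc_zero, arcDeriv_zero] at h
  exact h

theorem measurable_kernel_arc {m : ℕ} {K : Rn (m + 2) → Rn (m + 2) → ℝ≥0∞}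
    (hK : Measurable (Function.uncurry K)) {α : Type*} [MeasurableSpace α] {f : α → Rot (m + 2)}
    {h k : α → ℝ} (hf : Measurable f) (hh : Measurable h) (hk : Measurable k) :
    Measurable fun a => K (arc (f a) (h a)) (arc (f a) (k a)) :=
  measurable_uncurry_comp hK (measurable_arc_comp hf hh) (measurable_arc_comp hf hk)

/-- For each `w` the frame is shifted by the angle `w * θ`, which preserves the Haar measure. The
derivative then sits at the base frame for every `w`, and only the endpoints of the arc, now `-(w *
θ)` and `(1 - w) * θ`, depend on `w`. -/
theorem lintegral_arc_energy_le {m : ℕ} {u : Sph (m + 2) → ℝ} {L : ℝ≥0} (hu : LipschitzWith L u)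
    {K : Rn (m + 2) → Rn (m + 2) → ℝ≥0∞} (hK : Measurable (Function.uncurry K)) (θ : ℝ) :
    ∫⁻ A, ENNReal.ofReal ((homExt u (arc A 0) - homExt u (arc A θ)) ^ 2) *
      K (arc A 0) (arc A θ) ∂(rotHaar (m + 2)) ≤ ENNReal.ofReal (θ ^ 2) *
      ∫⁻ A, frameEnergy (gradient (homExt u)) A *
        (∫⁻ w in Ioo (0 : ℝ) 1, K (arc A (-(w * θ))) (arc A ((1 - w) * θ)))
        ∂(rotHaar (m + 2)) := by
  have hg : Measurable (gradient (homExt u)) := measurable_gradient _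
  set g := gradient (homExt u)
  have hwθ : Measurable fun q : Rot (m + 2) × ℝ => q.2 * θ := measurable_snd.mul_const θ
  have hD := measurable_frameEnergy_arc hg (measurable_fst (α := Rot (m + 2)) (β := ℝ)) hwθ
  have hDA : ∀ A, Measurable fun w : ℝ => ENNReal.ofReal
      (⟪g (arc A (w * θ)), arcDeriv A (w * θ)⟫ ^ 2) := fun A =>
    measurable_frameEnergy_arc hg (measurable_const (a := A)) (measurable_id.mul_const θ)
  have hK2 := measurable_kernel_arc hK (measurable_fst (α := Rot (m + 2)) (β := ℝ))
    (measurable_const (a := (0 : ℝ))) (measurable_const (a := θ))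
  have hK3 := measurable_kernel_arc hK (measurable_fst (α := Rot (m + 2)) (β := ℝ))
    hwθ.neg ((measurable_const (a := (1 : ℝ))).sub measurable_snd |>.mul_const θ)
  have hKA : ∀ A, Measurable fun w : ℝ => K (arc A (-(w * θ))) (arc A ((1 - w) * θ)) := fun A =>
    measurable_kernel_arc hK (measurable_const (a := A)) (measurable_id.mul_const θ).neg
      ((measurable_const.sub measurable_id).mul_const θ)
  have ha : Measurable fun q : Rot (m + 2) × ℝ => frameEnergy g q.1 :=
    (measurable_frameEnergy hg).comp measurable_fst
  calc _ ≤ ∫⁻ A, ENNReal.ofReal (θ ^ 2) * (∫⁻ w in Ioo (0 : ℝ) 1, ENNReal.ofReal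
        (⟪g (arc A (w * θ)), arcDeriv A (w * θ)⟫ ^ 2) * K (arc A 0) (arc A θ))
        ∂(rotHaar (m + 2)) := by
        refine lintegral_mono_ae ?_
        filter_upwards [sq_sub_le_lintegral_arc hu θ] with A hA
        rw [lintegral_mul_const _ (hDA A), ← mul_assoc]
        gcongr
    _ = ENNReal.ofReal (θ ^ 2) * ∫⁻ w in Ioo (0 : ℝ) 1, (∫⁻ A, ENNReal.ofReal
        (⟪g (arc A (w * θ)), arcDeriv A (w * θ)⟫ ^ 2) * K (arc A 0) (arc A θ)
        ∂(rotHaar (m + 2))) := by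
        rw [lintegral_const_mul, lintegral_lintegral_swap]
        · exact (hD.mul hK2).aemeasurable
        · exact (hD.mul hK2).lintegral_prod_right'
    _ = ENNReal.ofReal (θ ^ 2) * ∫⁻ w in Ioo (0 : ℝ) 1, (∫⁻ A,
        frameEnergy g A * K (arc A (-(w * θ))) (arc A ((1 - w) * θ)) ∂(rotHaar (m + 2))) := by
        congr 1
        refine lintegral_congr fun w => ?_
        -- Both arguments of the kernel are rewritten as combinations of position and velocity at
        -- time `w * θ`, so that the integrand is a function of the shifted frame alone.
        have h := lintegral_rot_shift (m := m) (fun x e => ENNReal.ofReal (⟪g x, e⟫ ^ 2) *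
          K (Real.cos (-(w * θ)) • x + Real.sin (-(w * θ)) • e)
            (Real.cos ((1 - w) * θ) • x + Real.sin ((1 - w) * θ) • e)) (w * θ)
        simp only [← arc_add] at h
        rw [show w * θ + -(w * θ) = 0 by ring, show w * θ + (1 - w) * θ = θ by ring] at h
        exact h
    _ = _ := by
        congr 1
        rw [← lintegral_lintegral_swap]
        · refine lintegral_congr fun A => ?_
          exact lintegral_const_mul _ (hKA A)
        · exact (ha.mul hK3).aemeasurable

/-- The frame energy no longer depends on the angle, so integrating over `θ` first leaves a weight
that can be bounded one great circle at a time. The hypothesis is needed only for almost every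
frame, since `u` is controlled only along almost every circle. -/
theorem nonlocal_energy_le_frame {m : ℕ} {u : Sph (m + 2) → ℝ} {L : ℝ≥0} (hu : LipschitzWith L u)
    {K : Rn (m + 2) → Rn (m + 2) → ℝ≥0∞} (hK : Measurable (Function.uncurry K)) {Λ : ℝ≥0∞}
    (hΛ : ∀ᵐ A ∂(rotHaar (m + 2)), ∫⁻ θ in Ioo 0 Real.pi, ENNReal.ofReal (Real.sin θ ^ m * θ ^ 2) *
      ∫⁻ w in Ioo (0 : ℝ) 1, K (arc A (-(w * θ))) (arc A ((1 - w) * θ)) ≤ Λ) :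
    ∫⁻ x : Sph (m + 2), ∫⁻ y : Sph (m + 2), ENNReal.ofReal ((u x - u y) ^ 2) * K x y
        ∂(surf (m + 2)) ∂(surf (m + 2)) ≤ sphArea (m + 1) *
      (sphArea m * (Λ * ∫⁻ A, frameEnergy (gradient (homExt u)) A ∂(rotHaar (m + 2)))) := by
  have hU : Measurable (homExt u) := measurable_homExt hu
  have hg : Measurable (gradient (homExt u)) := measurable_gradient _
  have h1 := lintegral_surf_surf (m := m)
    (fun x y => ENNReal.ofReal ((homExt u x - homExt u y) ^ 2) * K x y)
    ((((hU.comp measurable_fst).sub (hU.comp measurable_snd)).pow_const 2).ennreal_ofReal.mul hK)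
  simp only [homExt_coe] at h1
  rw [h1]
  gcongr
  set a := frameEnergy (gradient (homExt u))
  have ham : Measurable a := measurable_frameEnergy hg
  have hK4 := measurable_kernel_arc hK
    (f := fun q : (Rot (m + 2) × ℝ) × ℝ => q.1.1) (h := fun q => -(q.2 * q.1.2))
    (k := fun q => (1 - q.2) * q.1.2) measurable_fst.fst
    (by fun_prop) (by fun_prop)
  have hK5 : Measurable fun q : Rot (m + 2) × ℝ => ∫⁻ w in Ioo (0 : ℝ) 1,
      K (arc q.1 (-(w * q.2))) (arc q.1 ((1 - w) * q.2)) :=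
    hK4.lintegral_prod_right'
  have hKθ : ∀ θ : ℝ, Measurable fun A : Rot (m + 2) => ∫⁻ w in Ioo (0 : ℝ) 1,
      K (arc A (-(w * θ))) (arc A ((1 - w) * θ)) := fun θ =>
    measurable_uncurry_comp (F := fun A θ => ∫⁻ w in Ioo (0 : ℝ) 1,
      K (arc A (-(w * θ))) (arc A ((1 - w) * θ))) hK5 measurable_id (measurable_const (a := θ))
  have hsin : Measurable fun q : Rot (m + 2) × ℝ =>
      ENNReal.ofReal (Real.sin q.2 ^ m * q.2 ^ 2) :=
    (((Real.measurable_sin.comp measurable_snd).pow_const m).mul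
      (measurable_snd.pow_const 2)).ennreal_ofReal
  have hm2 := hsin.mul hK5
  have hm3 : ∀ A, Measurable fun θ : ℝ => ENNReal.ofReal (Real.sin θ ^ m * θ ^ 2) *
      ∫⁻ w in Ioo (0 : ℝ) 1, K (arc A (-(w * θ))) (arc A ((1 - w) * θ)) := fun A =>
    measurable_uncurry_left (F := fun A θ => ENNReal.ofReal (Real.sin θ ^ m * θ ^ 2) *
      ∫⁻ w in Ioo (0 : ℝ) 1, K (arc A (-(w * θ))) (arc A ((1 - w) * θ))) hm2 A
  calc _ ≤ ∫⁻ θ in Ioo 0 Real.pi, ENNReal.ofReal (Real.sin θ ^ m) * (ENNReal.ofReal (θ ^ 2) *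
        ∫⁻ A, a A * (∫⁻ w in Ioo (0 : ℝ) 1, K (arc A (-(w * θ))) (arc A ((1 - w) * θ)))
        ∂(rotHaar (m + 2))) := by
        refine lintegral_mono fun θ => ?_
        gcongr
        exact lintegral_arc_energy_le hu hK θ
    _ = ∫⁻ θ in Ioo 0 Real.pi, (∫⁻ A, a A * (ENNReal.ofReal (Real.sin θ ^ m * θ ^ 2) *
        ∫⁻ w in Ioo (0 : ℝ) 1, K (arc A (-(w * θ))) (arc A ((1 - w) * θ)))
        ∂(rotHaar (m + 2))) := by
        refine setLIntegral_congr_fun measurableSet_Ioo fun θ hθ => ?_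
        have hs : 0 ≤ Real.sin θ ^ m :=
          pow_nonneg (Real.sin_nonneg_of_nonneg_of_le_pi hθ.1.le hθ.2.le) _
        rw [← mul_assoc, ← ENNReal.ofReal_mul hs]
        exact (lintegral_const_mul _ (ham.mul (hKθ θ))).symm.trans
          (lintegral_congr fun A => mul_left_comm _ _ _)
    _ = ∫⁻ A, a A * (∫⁻ θ in Ioo 0 Real.pi, ENNReal.ofReal (Real.sin θ ^ m * θ ^ 2) *
        ∫⁻ w in Ioo (0 : ℝ) 1, K (arc A (-(w * θ))) (arc A ((1 - w) * θ)))
        ∂(rotHaar (m + 2)) := by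
        rw [← lintegral_lintegral_swap]
        · exact lintegral_congr fun A => lintegral_const_mul _ (hm3 A)
        · exact ((ham.comp measurable_fst).mul hm2).aemeasurable
    _ ≤ ∫⁻ A, Λ * a A ∂(rotHaar (m + 2)) := by
        refine lintegral_mono_ae ?_
        filter_upwards [hΛ] with A hA
        rw [mul_comm]
        gcongr
    _ = _ := lintegral_const_mul _ ham

/-- Estimate of a nonlocal energy on the sphere by the Dirichlet energy. -/
theorem nonlocal_energy_le {m : ℕ} {u : Sph (m + 2) → ℝ} {L : ℝ≥0} (hu : LipschitzWith L u)
    {K : Rn (m + 2) → Rn (m + 2) → ℝ≥0∞} (hK : Measurable (Function.uncurry K)) {Λ : ℝ≥0∞}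
    (hΛ : ∀ᵐ A ∂(rotHaar (m + 2)), ∫⁻ θ in Ioo 0 Real.pi, ENNReal.ofReal (Real.sin θ ^ m * θ ^ 2) *
      ∫⁻ w in Ioo (0 : ℝ) 1, K (arc A (-(w * θ))) (arc A ((1 - w) * θ)) ≤ Λ) :
    (m + 1 : ℕ) * ∫⁻ x : Sph (m + 2), ∫⁻ y : Sph (m + 2), ENNReal.ofReal ((u x - u y) ^ 2) * K x y
        ∂(surf (m + 2)) ∂(surf (m + 2)) ≤
      sphArea m * Λ * ENNReal.ofReal (gradNormSqL2 u) := by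
  have hg : Measurable (gradient (homExt u)) := measurable_gradient _
  have hiso := lintegral_inner_sq_le hg
  have huni := lintegral_rot_e0 (m := m)
    (f := fun x => ENNReal.ofReal (‖gradient (homExt u) x‖ ^ 2)) (hg.norm.pow_const 2).ennreal_ofReal
  rw [ofReal_gradNormSqL2 hu, ← huni]
  set a := frameEnergy (gradient (homExt u)) with ha
  calc _ ≤ (m + 1 : ℕ) * (sphArea (m + 1) * (sphArea m * (Λ * ∫⁻ A, a A ∂(rotHaar (m + 2))))) := by
        gcongr
        exact nonlocal_energy_le_frame hu hK hΛ
    _ = sphArea m * Λ * (sphArea (m + 1) * ((m + 1 : ℕ) * ∫⁻ A, a A ∂(rotHaar (m + 2)))) := by ring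
    _ ≤ _ := by
        gcongr
        exact hiso

/-! ### Decay of the profile from its weak derivative -/

theorem LocallyIntegrableOn.integrable_mul_of_tsupport {n : ℕ} {U : Set (Rn n)} {G f : Rn n → ℝ}
    (hG : LocallyIntegrableOn G U) (hf : Continuous f) (hfc : HasCompactSupport f)
    (hfU : tsupport f ⊆ U) : Integrable fun x => G x * f x := by
  have h1 : IntegrableOn G (tsupport f) := hG.integrableOn_compact_subset hfU hfc
  have h2 : IntegrableOn (fun x => G x * f x) (tsupport f) :=
    h1.mul_continuousOn hf.continuousOn hfc
  refine (integrableOn_iff_integrable_of_support_subset fun x hx => ?_).1 h2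
  refine subset_tsupport f fun h => hx ?_
  simp only [h, mul_zero]

/-- Weak differentiability of a function tested against radial vector fields. -/
theorem HasWeakGradient.integral_radial_deriv {m : ℕ} {G : Rn (m + 2) → ℝ}
    {DG : Rn (m + 2) → Rn (m + 2)} (h : HasWeakGradient {0}ᶜ G DG) {ψ : ℝ → ℝ}
    (hψ : ContDiff ℝ ∞ ψ) {a b : ℝ} (ha : 0 < a) (hab : ∀ r, r ∉ Icc a b → ψ r = 0) :
    ∫ x, G x * ((‖x‖ ^ (m + 1))⁻¹ * deriv ψ ‖x‖) =
      - ∫ x, ψ ‖x‖ * ((‖x‖ ^ (m + 1))⁻¹ * radialPart DG x) := by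
  -- With `n = m + 2`, the field `F(|x|) x` has divergence `|x| ^ (1 - n) ψ'(|x|)`: the exponent
  -- `-n` cancels the term without `ψ'`. It vanishes near the origin, so its components are smooth
  -- and admissible.
  set F : ℝ → ℝ := fun r => ψ r * (r ^ (m + 2))⁻¹ with hF
  have hF0 : ∀ r, r ∉ Icc a b → F r = 0 := fun r hr => by simp [hF, hab r hr]
  have hFd : ∀ r, 0 < r → ContDiffAt ℝ ∞ F r := fun r hr =>
    hψ.contDiffAt.mul (((contDiff_id.pow _).contDiffAt).inv (pow_pos hr _).ne')
  have hFder : ∀ r, 0 < r → HasDerivAt F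
      (deriv ψ r * (r ^ (m + 2))⁻¹ - (m + 2 : ℕ) * (ψ r * (r ^ (m + 3))⁻¹)) r := fun r hr => by
    have h1 := (hψ.differentiable (by simp)).differentiableAt (x := r) |>.hasDerivAt
    have h2 := (hasDerivAt_pow (m + 2) r).inv (pow_pos hr _).ne'
    refine (h1.mul h2).congr_deriv ?_
    rw [show m + 2 - 1 = m + 1 from rfl, Pi.inv_apply]
    field_simp
    ring
  set φ : Fin (m + 2) → Rn (m + 2) → ℝ := fun i x => F ‖x‖ * x i with hφ
  have hball : ∀ x : Rn (m + 2), ‖x‖ < a → F ‖x‖ = 0 := fun x hx =>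
    hF0 _ fun hx' => absurd hx'.1 (not_le.2 hx)
  have hφ1 : ∀ i, ContDiff ℝ ∞ (φ i) := fun i => by
    rw [contDiff_iff_contDiffAt]
    intro x
    by_cases hx : x = 0
    · have : φ i =ᶠ[𝓝 x] fun _ => 0 := by
        filter_upwards [Metric.ball_mem_nhds x ha] with y hy
        rw [hx, mem_ball_zero_iff] at hy
        simp [hφ, hball y hy]
      exact contDiffAt_const.congr_of_eventuallyEq this
    · have h1 : ContDiffAt ℝ ∞ (fun x : Rn (m + 2) => ‖x‖) x := contDiffAt_norm ℝ hx
      have h2 : ContDiffAt ℝ ∞ (fun x : Rn (m + 2) => F ‖x‖) x :=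
        (hFd _ (norm_pos_iff.2 hx)).comp x h1
      exact h2.mul (by fun_prop)
  have hφs : ∀ i, tsupport (φ i) ⊆ {x | a ≤ ‖x‖} ∩ Metric.closedBall 0 b := fun i => by
    refine closure_minimal (fun x hx => ?_)
      ((isClosed_le continuous_const continuous_norm).inter Metric.isClosed_closedBall)
    have : ‖x‖ ∈ Icc a b := by
      by_contra hc
      exact hx (by simp [hφ, hF0 _ hc])
    exact ⟨this.1, by simpa using this.2⟩
  have hφc : ∀ i, HasCompactSupport (φ i) := fun i =>
    (isCompact_closedBall (0 : Rn (m + 2)) b).of_isClosed_subset (isClosed_tsupport _)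
      ((hφs i).trans inter_subset_right)
  have hφU : ∀ i, tsupport (φ i) ⊆ {0}ᶜ := fun i x hx => by
    have := (hφs i hx).1
    rintro rfl
    simp at this
    linarith
  set e : Fin (m + 2) → Rn (m + 2) := fun i => EuclideanSpace.single i 1
  have key := fun i => h.integration_by_parts (φ i) (hφ1 i) (hφc i) (hφU i) (e i)
  have hsum := Finset.sum_congr rfl fun i (_ : i ∈ Finset.univ) => key i
  have hfc : ∀ i, Continuous fun x => fderiv ℝ (φ i) x (e i) := fun i =>
    ((hφ1 i).continuous_fderiv (by simp)).clm_apply continuous_const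
  have hfs : ∀ i, tsupport (fun x => fderiv ℝ (φ i) x (e i)) ⊆ tsupport (φ i) := fun i =>
    tsupport_fderiv_apply_subset ℝ (e i)
  have hI1 : ∀ i, Integrable fun x => G x * fderiv ℝ (φ i) x (e i) := fun i =>
    LocallyIntegrableOn.integrable_mul_of_tsupport h.locallyIntegrable (hfc i)
      ((hφc i).of_isClosed_subset (isClosed_tsupport _) (hfs i)) ((hfs i).trans (hφU i))
  have hDG : ∀ i, LocallyIntegrableOn (fun x => ⟪DG x, e i⟫) ({0}ᶜ : Set (Rn (m + 2))) := fun i =>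
    fun x hx => by
      obtain ⟨s, hs, hsi⟩ := h.gradient_locallyIntegrable x hx
      exact ⟨s, hs, hsi.inner_const (e i)⟩
  have hI2 : ∀ i, Integrable fun x => φ i x * ⟪DG x, e i⟫ := fun i => by
    simp only [mul_comm (φ i _)]
    exact LocallyIntegrableOn.integrable_mul_of_tsupport (hDG i) (hφ1 i).continuous (hφc i) (hφU i)
  rw [Finset.sum_neg_distrib, ← integral_finsetSum _ fun i _ => hI1 i,
    ← integral_finsetSum _ fun i _ => hI2 i] at hsum
  have hA : ∀ x, G x * ((‖x‖ ^ (m + 1))⁻¹ * deriv ψ ‖x‖) =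
      ∑ i, G x * fderiv ℝ (φ i) x (e i) := fun x => by
    rw [← Finset.mul_sum]
    congr 1
    by_cases hx : x = 0
    · have hz : ∀ i, φ i =ᶠ[𝓝 x] fun _ => 0 := fun i => by
        filter_upwards [Metric.ball_mem_nhds x ha] with y hy
        rw [hx, mem_ball_zero_iff] at hy
        simp [hφ, hball y hy]
      have hz' : ∀ i, fderiv ℝ (φ i) x = 0 := fun i => by rw [(hz i).fderiv_eq]; simp
      rw [Finset.sum_eq_zero fun i _ => by rw [hz']; rfl, hx]
      simp
    · have hx0 := norm_pos_iff.2 hx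
      have hn : HasFDerivAt (fun x : Rn (m + 2) => ‖x‖) (‖x‖⁻¹ • innerSL ℝ x) x := by
        have h1 := (hasStrictFDerivAt_norm_sq x).hasFDerivAt.sqrt (pow_pos hx0 2).ne'
        have h2 : (fun x : Rn (m + 2) => √(‖x‖ ^ 2)) = fun x => ‖x‖ := by
          ext y; exact Real.sqrt_sq (norm_nonneg _)
        rw [h2, Real.sqrt_sq hx0.le] at h1
        refine h1.congr_fderiv ?_
        ext y
        simp only [smul_apply, innerSL_apply_apply, smul_eq_mul,
          nsmul_eq_mul, Nat.cast_ofNat]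
        field_simp
      have hd : ∀ i, fderiv ℝ (φ i) x (e i) = F ‖x‖ +
          x i * ((deriv ψ ‖x‖ * (‖x‖ ^ (m + 2))⁻¹ -
            (m + 2 : ℕ) * (ψ ‖x‖ * (‖x‖ ^ (m + 3))⁻¹)) * (‖x‖⁻¹ * x i)) := fun i => by
        have h1 := (hFder _ hx0).comp_hasFDerivAt x hn
        have h2 : HasFDerivAt (fun x : Rn (m + 2) => x i)
          (EuclideanSpace.proj (𝕜 := ℝ) i : Rn (m + 2) →L[ℝ] ℝ) x :=
          (EuclideanSpace.proj (𝕜 := ℝ) i : Rn (m + 2) →L[ℝ] ℝ).hasFDerivAt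
        have h3 := h1.mul h2
        have h4 : fderiv ℝ (φ i) x = _ := h3.fderiv
        rw [h4]
        simp [e, EuclideanSpace.inner_single_right]
      simp only [hd, Finset.sum_add_distrib, Finset.sum_const, Finset.card_univ, Fintype.card_fin]
      have hs : ∀ c : ℝ, ∑ i, x i * (c * (‖x‖⁻¹ * x i)) = c * ‖x‖ := fun c => by
        have : ∀ i, x i * (c * (‖x‖⁻¹ * x i)) = (c * ‖x‖⁻¹) * (x i ^ 2) := fun i => by ring
        simp only [this]
        rw [← Finset.mul_sum, ← EuclideanSpace.real_norm_sq_eq]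
        field_simp
      rw [hs, hF]
      simp only [nsmul_eq_mul]
      field_simp
      ring
  have hB : ∀ x, ψ ‖x‖ * ((‖x‖ ^ (m + 1))⁻¹ * radialPart DG x) =
      ∑ i, φ i x * ⟪DG x, e i⟫ := fun x => by
    have hsx : ∑ i, x i * ⟪DG x, e i⟫ = ⟪DG x, x⟫ := by
      rw [PiLp.inner_apply]
      refine Finset.sum_congr rfl fun i _ => ?_
      simp [e, EuclideanSpace.inner_single_right]
    have : ∀ i, φ i x * ⟪DG x, e i⟫ = F ‖x‖ * (x i * ⟪DG x, e i⟫) := fun i => by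
      simp only [hφ]; ring
    simp only [this]
    rw [← Finset.mul_sum, hsx, radialPart, inner_smul_right, hF]
    by_cases hx : x = 0
    · simp [hx]
    · have hx0 := norm_pos_iff.2 hx
      field_simp
      ring
  simp only [hA, hB]
  exact hsum

theorem isCompact_subset_Icc_of_subset_Ioi {K : Set ℝ} (hK : IsCompact K) (hK0 : K ⊆ Ioi 0) :
    ∃ a b : ℝ, 0 < a ∧ K ⊆ Icc a b := by
  rcases K.eq_empty_or_nonempty with rfl | hne
  · exact ⟨1, 1, one_pos, empty_subset _⟩
  · exact ⟨sInf K, sSup K, hK0 (hK.sInf_mem hne), fun x hx =>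
      ⟨csInf_le hK.bddBelow hx, le_csSup hK.bddAbove hx⟩⟩

theorem integrable_mul_of_support_Icc {f θ : ℝ → ℝ} (hf : LocallyIntegrableOn f (Ioi 0))
    (hθ : Continuous θ) {a b : ℝ} (ha : 0 < a) (hab : ∀ r, r ∉ Icc a b → θ r = 0) :
    IntegrableOn (fun r => f r * θ r) (Ioi 0) := by
  have h0 : Icc a b ⊆ Ioi 0 := fun x hx => ha.trans_le hx.1
  have h1 : IntegrableOn (fun r => f r * θ r) (Icc a b) :=
    (hf.integrableOn_compact_subset h0 isCompact_Icc).mul_continuousOn hθ.continuousOn isCompact_Icc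
  have h2 : Integrable (fun r => f r * θ r) :=
    (integrableOn_iff_integrable_of_support_subset fun r hr => by
      by_contra hc
      exact hr (by simp [hab r hc])).1 h1
  exact h2.integrableOn

/-- The lemma of du Bois-Reymond on the half line. -/
theorem ae_eq_const_of_integral_mul_deriv_eq_zero {f : ℝ → ℝ} (hf : LocallyIntegrableOn f (Ioi 0))
    (h : ∀ ψ : ℝ → ℝ, ContDiff ℝ ∞ ψ → ∀ a b : ℝ, 0 < a → (∀ r, r ∉ Icc a b → ψ r = 0) →
      (∀ r, r ∉ Icc a b → deriv ψ r = 0) → ∫ r in Ioi 0, f r * deriv ψ r = 0) :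
    ∃ k : ℝ, ∀ᵐ r ∂(volume.restrict (Ioi (0 : ℝ))), f r = k := by
  set β : ContDiffBump (2 : ℝ) := ⟨1 / 2, 1, by norm_num, by norm_num⟩
  set χ₀ : ℝ → ℝ := β.normed volume with hχ₀
  have hχ₀c : ContDiff ℝ ∞ χ₀ := β.contDiff_normed
  have hχ₀1 : ∫ r, χ₀ r = 1 := β.integral_normed
  have hχ₀s : ∀ r, r ∉ Icc (1 : ℝ) 3 → χ₀ r = 0 := fun r hr => by
    have h1 : r ∉ Function.support χ₀ := by
      rw [hχ₀, β.support_normed_eq]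
      refine fun h2 => hr ?_
      rw [Metric.mem_ball, Real.dist_eq, abs_lt] at h2
      change -1 < r - 2 ∧ r - 2 < 1 at h2
      constructor <;> linarith [h2.1, h2.2]
    simpa using h1
  set k := ∫ r in Ioi 0, f r * χ₀ r with hk
  refine ⟨k, ?_⟩
  have hloc : LocallyIntegrableOn (fun r => f r - k) (Ioi 0) (volume.restrict (Ioi (0 : ℝ))) :=
    (hf.sub ((continuous_const.locallyIntegrable).locallyIntegrableOn _)).mono_measure
      Measure.restrict_le_self
  have key := isOpen_Ioi.ae_eq_zero_of_integral_contDiff_smul_eq_zero hloc ?_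
  · filter_upwards [key, ae_restrict_mem measurableSet_Ioi] with r hr hr0
    linarith [hr hr0]
  intro χ hχ hχc hχU
  obtain ⟨a, b, ha, hab⟩ := isCompact_subset_Icc_of_subset_Ioi hχc hχU
  have hχs : ∀ r, r ∉ Icc a b → χ r = 0 := fun r hr => by
    by_contra hc
    exact hr (hab (subset_tsupport _ hc))
  set c := ∫ r, χ r with hc
  -- Subtracting a multiple of the fixed bump makes the mean zero, so the primitive of `η` has
  -- compact support in the open half line and can be used as a test function.
  set η : ℝ → ℝ := fun r => χ r - c * χ₀ r with hη
  set a' := min a 1 with ha'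
  set b' := max b 3 with hb'
  have ha'0 : 0 < a' := lt_min ha one_pos
  have hsub : ∀ r, r ∉ Icc a' b' → χ r = 0 ∧ χ₀ r = 0 := fun r hr => by
    refine ⟨hχs r fun h => hr ⟨(min_le_left _ _).trans h.1, h.2.trans (le_max_left _ _)⟩,
      hχ₀s r fun h => hr ⟨(min_le_right _ _).trans h.1, h.2.trans (le_max_right _ _)⟩⟩
  have hηs : ∀ r, r ∉ Icc a' b' → η r = 0 := fun r hr => by
    simp [hη, (hsub r hr).1, (hsub r hr).2]
  have hηc : ContDiff ℝ ∞ η := hχ.sub (contDiff_const.mul hχ₀c)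
  have hχi : Integrable χ := hχ.continuous.integrable_of_hasCompactSupport hχc
  have hχ₀i : Integrable χ₀ := hχ₀c.continuous.integrable_of_hasCompactSupport
    β.hasCompactSupport_normed
  have hη0 : ∫ r, η r = 0 := by
    rw [hη, integral_sub hχi (hχ₀i.const_mul c), integral_const_mul, hχ₀1, ← hc]
    ring
  set ψ : ℝ → ℝ := fun r => ∫ s in a'..r, η s with hψ
  have hψd : ∀ r, HasDerivAt ψ (η r) r := fun r =>
    intervalIntegral.integral_hasDerivAt_right (hηc.continuous.intervalIntegrable _ _)
      (hηc.continuous.stronglyMeasurableAtFilter _ _) hηc.continuous.continuousAt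
  have hψd' : deriv ψ = η := funext fun r => (hψd r).deriv
  have hψc : ContDiff ℝ ∞ ψ :=
    contDiff_infty_iff_deriv.2 ⟨fun r => (hψd r).differentiableAt, hψd' ▸ hηc⟩
  have hψs : ∀ r, r ∉ Icc a' b' → ψ r = 0 := fun r hr => by
    rcases lt_or_ge r a' with h1 | h1
    · simp only [hψ]
      rw [intervalIntegral.integral_symm, neg_eq_zero, intervalIntegral.integral_of_le h1.le,
        integral_Ioc_eq_integral_Ioo]
      exact setIntegral_eq_zero_of_forall_eq_zero fun x hx =>
        hηs x fun h2 => absurd h2.1 (not_le.2 hx.2)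
    · have h2 : b' < r := by
        by_contra h3
        exact hr ⟨h1, not_lt.1 h3⟩
      simp only [hψ]
      rw [intervalIntegral.integral_of_le h1, ← integral_Icc_eq_integral_Ioc,
        setIntegral_eq_integral_of_forall_compl_eq_zero, hη0]
      exact fun x hx => hηs x fun h3 => hx ⟨h3.1, h3.2.trans h2.le⟩
  have hz := h ψ hψc a' b' ha'0 hψs fun r hr => by rw [hψd', hηs r hr]
  have hI1 : IntegrableOn (fun r => f r * χ r) (Ioi 0) :=
    integrable_mul_of_support_Icc hf hχ.continuous ha hχs
  have hI2 : IntegrableOn (fun r => f r * χ₀ r) (Ioi 0) :=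
    integrable_mul_of_support_Icc hf hχ₀c.continuous one_pos hχ₀s
  rw [hψd'] at hz
  have h1 : ∫ r in Ioi 0, f r * χ r = c * k := by
    have : ∀ r, f r * η r = f r * χ r - c * (f r * χ₀ r) := fun r => by simp only [hη]; ring
    simp only [this] at hz
    rw [integral_sub hI1 (hI2.const_mul c), integral_const_mul, sub_eq_zero] at hz
    exact hz
  have h2 : ∫ r in Ioi 0, χ r = c :=
    setIntegral_eq_integral_of_forall_compl_eq_zero fun r hr =>
      hχs r fun h3 => hr (ha.trans_le h3.1)
  have : ∀ r, χ r • (f r - k) = f r * χ r - k * χ r := fun r => by rw [smul_eq_mul]; ring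
  simp only [this]
  rw [integral_sub hI1 (hχi.integrableOn.const_mul k), integral_const_mul, h1, h2]
  ring

/-- Justifies Fubini for the tail integrals `W`. Since `θ` vanishes below `a`, the constraint `r <
‖x‖` forces `‖x‖ > a` wherever the product is nonzero, away from the possible singularity at the
origin. -/
theorem integrable_prod_tail {n : ℕ} {w : Rn n → ℝ} (hw : AEStronglyMeasurable w) {a : ℝ}
    (hwa : IntegrableOn w {x | a < ‖x‖}) {θ : ℝ → ℝ} (hθ : Integrable θ)
    (hθa : ∀ r, r < a → θ r = 0) :
    Integrable (Function.uncurry fun (r : ℝ) (x : Rn n) =>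
      θ r * {x | r < ‖x‖}.indicator w x) (volume.prod volume) := by
  have hma : MeasurableSet {x : Rn n | a < ‖x‖} := measurableSet_lt measurable_const measurable_norm
  have h1 : Integrable (fun q : ℝ × Rn n => θ q.1 * {x | a < ‖x‖}.indicator w q.2)
      (volume.prod volume) := hθ.mul_prod ((integrable_indicator_iff hma).2 hwa)
  refine h1.mono ?_ (ae_of_all _ fun q => ?_)
  · have hm : MeasurableSet {q : ℝ × Rn n | q.1 < ‖q.2‖} :=
      measurableSet_lt measurable_fst measurable_snd.norm
    have h2 : (Function.uncurry fun (r : ℝ) (x : Rn n) => θ r * {x | r < ‖x‖}.indicator w x) =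
        fun q => θ q.1 * {q : ℝ × Rn n | q.1 < ‖q.2‖}.indicator (fun q => w q.2) q := by
      ext ⟨r, x⟩
      simp only [Function.uncurry, indicator_apply, mem_ofPred_eq]
    rw [h2]
    exact hθ.aestronglyMeasurable.comp_fst.mul (hw.comp_snd.indicator hm)
  · simp only [Function.uncurry, norm_mul]
    rcases lt_or_ge q.1 a with h2 | h2
    · simp [hθa _ h2]
    · refine mul_le_mul_of_nonneg_left ?_ (norm_nonneg _)
      refine norm_indicator_le_of_subset (fun x hx => ?_) _ _
      exact h2.trans_lt hx

/-- A radial kernel whose radial derivative has finite second moment is dominated by a multiple of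
`r^{-(n+1)}` that vanishes at infinity. -/
theorem exists_profile_bound {m : ℕ} {G : Rn (m + 2) → ℝ} {g : ℝ → ℝ} (hG : IsRadialKernel G g)
    (hG1 : HasUnitFirstMoment G) (hG2 : HasHigherMoment G) :
    ∃ M : ℝ → ℝ, Antitone M ∧ Tendsto M atTop (𝓝 0) ∧ (∀ r, 0 ≤ M r) ∧
      ∀ᵐ r ∂(volume.restrict (Ioi (0 : ℝ))), g r ≤ M r / r ^ (m + 3) := by
  obtain ⟨DG, hDG, hmom, -⟩ := hG2
  set c : ℝ := (sphArea (m + 1)).toReal with hc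
  have hc0 : 0 < c := ENNReal.toReal_pos (sphArea_ne_zero _) (sphArea_ne_top _)
  have hpol : ∀ f : ℝ → ℝ, ∫ x : Rn (m + 2), f ‖x‖ = c * ∫ r in Ioi 0, r ^ (m + 1) * f r := by
    intro f
    rw [integral_fun_norm_addHaar, hc, sphArea, surf, Measure.toSphere_apply_univ,
      ENNReal.toReal_mul, ENNReal.toReal_natCast, nsmul_eq_mul, mul_assoc, measureReal_def,
      finrank_euclideanSpace_fin]
    rfl
  have hpoli : ∀ f : ℝ → ℝ, Integrable (fun x : Rn (m + 2) => f ‖x‖) →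
      IntegrableOn (fun r => r ^ (m + 1) * f r) (Ioi 0) := by
    intro f hf
    have := (integrable_fun_norm_addHaar (volume : Measure (Rn (m + 2))) (f := f)).1 hf
    simpa using this
  have hgi : IntegrableOn (fun r => r ^ (m + 1) * (r * g r)) (Ioi 0) := by
    refine hpoli (fun r => r * g r) (hG1.integrable.congr ?_)
    filter_upwards [hG.radial] with x hx
    rw [hx]
  have hgl : LocallyIntegrableOn g (Ioi 0) := by
    have h1 : LocallyIntegrableOn (fun r : ℝ => (r ^ (m + 2))⁻¹ * (r ^ (m + 1) * (r * g r)))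
        (Ioi 0) := by
      refine hgi.locallyIntegrableOn.continuousOn_mul (fun r hr => ?_) isOpen_Ioi.isLocallyClosed
      exact ((continuous_pow _).continuousAt.inv₀ (pow_pos hr _).ne').continuousWithinAt
    refine h1.congr ?_
    filter_upwards [ae_restrict_mem measurableSet_Ioi] with r hr
    have hr0 : (0 : ℝ) < r := hr
    field_simp
    ring
  set w : Rn (m + 2) → ℝ := fun x => (‖x‖ ^ (m + 1))⁻¹ * radialPart DG x with hw
  have hDGm : AEStronglyMeasurable DG := by
    have := hDG.gradient_locallyIntegrable.aestronglyMeasurable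
    rwa [restrict_compl_singleton] at this
  have hrm : AEStronglyMeasurable (radialPart DG) := by
    refine hDGm.inner (𝕜 := ℝ) (Measurable.aestronglyMeasurable ?_)
    fun_prop
  have hwm : AEStronglyMeasurable w :=
    (by fun_prop : Measurable fun x : Rn (m + 2) => (‖x‖ ^ (m + 1))⁻¹).aestronglyMeasurable.mul hrm
  have hset : ∀ a : ℝ, MeasurableSet {x : Rn (m + 2) | a < ‖x‖} := fun a =>
    measurableSet_lt measurable_const measurable_norm
  have hwb : ∀ a : ℝ, 0 < a → ∀ x : Rn (m + 2), a < ‖x‖ →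
      |w x| ≤ (a ^ (m + 3))⁻¹ * (‖x‖ ^ 2 * |radialPart DG x|) := fun a ha x hx => by
    have hx0 : 0 < ‖x‖ := ha.trans hx
    rw [hw, abs_mul, abs_of_pos (by positivity), ← mul_assoc]
    gcongr
    rw [inv_mul_eq_div, le_div_iff₀ (by positivity), inv_mul_le_iff₀ (by positivity)]
    calc a ^ (m + 3) ≤ ‖x‖ ^ (m + 3) := by gcongr
      _ = ‖x‖ ^ (m + 1) * ‖x‖ ^ 2 := by ring
  have hwi : ∀ a : ℝ, 0 < a → IntegrableOn w {x | a < ‖x‖} := fun a ha => by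
    refine Integrable.mono' ((hmom.const_mul (a ^ (m + 3))⁻¹).integrableOn) hwm.restrict ?_
    filter_upwards [ae_restrict_mem (hset a)] with x hx
    exact hwb a ha x hx
  -- In radial terms `W r` is the sphere area times the integral of `g'` over `(r, ∞)`, so `c * g +
  -- W` should be constant; this is shown weakly.
  set W : ℝ → ℝ := fun r => ∫ x, {x | r < ‖x‖}.indicator w x with hW
  have hWl : LocallyIntegrableOn W (Ioi 0) := by
    intro r hr
    have hr0 : (0 : ℝ) < r := hr
    have h1 : Integrable ((Icc (r / 2) (2 * r)).indicator (1 : ℝ → ℝ)) :=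
      (integrable_indicator_iff measurableSet_Icc).2 (integrableOn_const (by simp))
    have h2 := integrable_prod_tail hwm (hwi (r / 2) (by positivity)) h1 fun s hs =>
      indicator_of_notMem (fun h => absurd h.1 (not_le.2 hs)) _
    have h3 := h2.integral_prod_left
    refine ⟨Icc (r / 2) (2 * r), mem_nhdsWithin_of_mem_nhds
      (Icc_mem_nhds (by linarith) (by linarith)), ?_⟩
    rw [← integrable_indicator_iff measurableSet_Icc]
    refine h3.congr (ae_of_all _ fun s => ?_)
    simp only [Function.uncurry, integral_const_mul, indicator_apply, Pi.one_apply]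
    split_ifs <;> simp [hW, indicator_apply]
  have hdual : ∀ ψ : ℝ → ℝ, ContDiff ℝ ∞ ψ → ∀ a b : ℝ, 0 < a → (∀ r, r ∉ Icc a b → ψ r = 0) →
      (∀ r, r ∉ Icc a b → deriv ψ r = 0) →
      ∫ r in Ioi 0, (c * g r + W r) * deriv ψ r = 0 := by
    intro ψ hψ a b ha hψs hψs'
    have hd : Continuous (deriv ψ) := hψ.continuous_deriv (by simp)
    have hdc : HasCompactSupport (deriv ψ) :=
      HasCompactSupport.of_support_subset_isCompact isCompact_Icc fun r hr => by
        by_contra h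
        exact hr (hψs' r h)
    have h1 := hDG.integral_radial_deriv hψ ha hψs
    have h2 : ∫ x, G x * ((‖x‖ ^ (m + 1))⁻¹ * deriv ψ ‖x‖) =
        c * ∫ r in Ioi 0, g r * deriv ψ r := by
      have h3 : ∫ x, G x * ((‖x‖ ^ (m + 1))⁻¹ * deriv ψ ‖x‖) =
          ∫ x : Rn (m + 2), (fun r => g r * ((r ^ (m + 1))⁻¹ * deriv ψ r)) ‖x‖ := by
        refine integral_congr_ae ?_
        filter_upwards [hG.radial] with x hx
        rw [hx]
      rw [h3]
      refine (hpol fun r => g r * ((r ^ (m + 1))⁻¹ * deriv ψ r)).trans ?_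
      congr 1
      refine setIntegral_congr_fun measurableSet_Ioi fun r hr => ?_
      have hr0 : (0 : ℝ) < r := hr
      field_simp
    -- Since `ψ ‖x‖` is the integral of `ψ'` over radii below `‖x‖`, exchanging the integrals puts
    -- the tail integral `W` against `ψ'`.
    have h4 : ∫ x, ψ ‖x‖ * ((‖x‖ ^ (m + 1))⁻¹ * radialPart DG x) =
        ∫ r, deriv ψ r * W r := by
      have h5 := integral_integral_swap (integrable_prod_tail hwm
        (hwi (a / 2) (by positivity)) (hd.integrable_of_hasCompactSupport hdc) fun s hs =>
        hψs' s fun h => absurd h.1 (by linarith))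
      simp only [integral_const_mul] at h5
      change _ = ∫ r, deriv ψ r * ∫ x, {x | r < ‖x‖}.indicator w x
      rw [h5]
      congr 1
      ext x
      have h6 : ∀ r, deriv ψ r * {x | r < ‖x‖}.indicator w x =
          (Iio ‖x‖).indicator (deriv ψ) r * w x := fun r => by
        simp only [indicator_apply, mem_ofPred_eq, mem_Iio]
        split_ifs <;> simp
      simp only [h6]
      rw [integral_mul_const, integral_indicator measurableSet_Iio]
      congr 1
      have h7 : ∫ r in Iic ‖x‖, deriv ψ r = ψ ‖x‖ - 0 := by
        refine integral_Iic_of_hasDerivAt_of_tendsto' (fun r _ =>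
          ((hψ.differentiable (by simp)).differentiableAt).hasDerivAt)
          (hd.integrable_of_hasCompactSupport hdc).integrableOn ?_
        refine tendsto_const_nhds.congr' ?_
        filter_upwards [eventually_lt_atBot a] with r hr
        exact (hψs r fun h => absurd h.1 (not_le.2 hr)).symm
      rw [← integral_Iic_eq_integral_Iio, h7, sub_zero]
    have h8 : ∫ r, deriv ψ r * W r = ∫ r in Ioi 0, W r * deriv ψ r := by
      simp only [mul_comm (W _)]
      refine (setIntegral_eq_integral_of_forall_compl_eq_zero fun r hr => ?_).symm
      rw [hψs' r fun h => hr (ha.trans_le h.1), zero_mul]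
    have hI1 := integrable_mul_of_support_Icc hgl hd ha hψs'
    have hI2 := integrable_mul_of_support_Icc hWl hd ha hψs'
    have h9 : ∀ r, (c * g r + W r) * deriv ψ r = c * (g r * deriv ψ r) + W r * deriv ψ r :=
      fun r => by ring
    simp only [h9]
    rw [integral_add (hI1.const_mul c) hI2, integral_const_mul, ← h2, h1, h4, h8]
    ring
  have hcl : LocallyIntegrableOn (fun r => c * g r + W r) (Ioi 0) :=
    (hgl.continuousOn_mul continuousOn_const isOpen_Ioi.isLocallyClosed).add hWl
  obtain ⟨k, hk⟩ := ae_eq_const_of_integral_mul_deriv_eq_zero hcl hdual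
  -- The tail of the second moment. It decreases to zero, and on `‖x‖ > r` the density of `W` is at
  -- most `r ^ (-(m + 3))` times the integrand of `J`.
  set J : ℝ → ℝ := fun r => ∫ x in {x | r < ‖x‖}, ‖x‖ ^ 2 * |radialPart DG x| with hJ
  have hJ0 : ∀ r, 0 ≤ J r := fun r => integral_nonneg fun x => by positivity
  have hJa : Antitone J := fun r s hrs => by
    refine setIntegral_mono_set hmom.integrableOn (ae_of_all _ fun x => by positivity) ?_
    exact Eventually.of_forall fun x hx => hrs.trans_lt hx
  have hJt : Tendsto J atTop (𝓝 0) := by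
    have h1 := tendsto_setIntegral_of_antitone (μ := (volume : Measure (Rn (m + 2))))
      (f := fun x => ‖x‖ ^ 2 * |radialPart DG x|) (s := fun r : ℝ => {x | r < ‖x‖}) hset
      (fun r s hrs x hx => lt_of_le_of_lt hrs hx) ⟨0, hmom.integrableOn⟩
    have h2 : ⋂ r : ℝ, {x : Rn (m + 2) | r < ‖x‖} = ∅ := by
      ext x
      simp only [mem_iInter, mem_ofPred_eq, mem_empty_iff_false, iff_false, not_forall, not_lt]
      exact ⟨‖x‖, le_rfl⟩
    rw [h2, setIntegral_empty] at h1
    exact h1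
  have hWJ : ∀ r, 0 < r → |W r| ≤ (r ^ (m + 3))⁻¹ * J r := fun r hr => by
    rw [hW]
    simp only
    rw [integral_indicator (hset r), hJ]
    simp only
    rw [← integral_const_mul, ← Real.norm_eq_abs]
    refine norm_integral_le_of_norm_le (hmom.const_mul _).integrableOn ?_
    filter_upwards [ae_restrict_mem (hset r)] with x hx
    exact hwb r hr x hx
  -- Since `W → 0` at infinity, a nonzero constant would keep `c * g` above `|k| / 2` for large
  -- radii, against the finiteness of the first moment.
  have hk0 : k = 0 := by
    by_contra hk1
    have hk2 : 0 < |k| := abs_pos.2 hk1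
    obtain ⟨R, hR⟩ := (hJt.eventually (gt_mem_nhds (half_pos hk2))).exists_forall_of_atTop
    set R' := max R 1
    have hR1 : 1 ≤ R' := le_max_right _ _
    have h1 : IntegrableOn (fun _ : ℝ => |k| / 2) (Ioi R') := by
      refine Integrable.mono' (((hgi.mono_set (Ioi_subset_Ioi
        (zero_le_one.trans hR1))).const_mul c)) aestronglyMeasurable_const ?_
      filter_upwards [ae_restrict_of_ae_restrict_of_subset
        (Ioi_subset_Ioi (zero_le_one.trans hR1)) hk, ae_restrict_mem measurableSet_Ioi] with r h2 h3
      have h4 : 1 ≤ r := hR1.trans (le_of_lt h3)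
      have h5 : |W r| ≤ |k| / 2 := by
        refine (hWJ r (by linarith)).trans ((mul_le_of_le_one_left (hJ0 r) ?_).trans
          (hR r ((le_max_left _ _).trans (le_of_lt h3))).le)
        exact inv_le_one_of_one_le₀ (one_le_pow₀ h4)
      have h6 : 0 ≤ g r := hG.profile_nonneg r (by linarith)
      have h7 : |k| ≤ c * g r + |W r| := by
        rw [← h2]
        refine (abs_add_le _ _).trans ?_
        rw [abs_of_nonneg (mul_nonneg hc0.le h6)]
      rw [Real.norm_eq_abs, abs_of_pos (half_pos hk2)]
      have h8 : g r ≤ r ^ (m + 1) * (r * g r) := by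
        rw [← mul_assoc, ← pow_succ]
        exact le_mul_of_one_le_left h6 (one_le_pow₀ h4)
      nlinarith
    rw [integrableOn_const_iff (by simp)] at h1
    rcases h1 with h1 | h1
    · rw [enorm_eq_zero] at h1
      linarith
    · simp at h1
  refine ⟨fun r => J r / c, fun r s hrs => div_le_div_of_nonneg_right (hJa hrs) hc0.le, by simpa using hJt.div_const c,
    fun r => div_nonneg (hJ0 r) hc0.le, ?_⟩
  filter_upwards [hk, ae_restrict_mem measurableSet_Ioi] with r h1 h2
  have hr0 : (0 : ℝ) < r := h2
  rw [hk0] at h1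
  have h3 := hWJ r hr0
  have h4 : c * g r ≤ (r ^ (m + 3))⁻¹ * J r := by
    have := neg_abs_le (W r)
    linarith
  rw [div_div, le_div_iff₀ (by positivity)]
  rw [inv_mul_eq_div, le_div_iff₀ (by positivity)] at h4
  linarith

/-! ### Change of variables for an expanding distance -/

/-- The inverse of an expanding map is Lipschitz with constant `B⁻¹`, and on the line Lebesgue
measure is one-dimensional Hausdorff measure, which scales by at most that constant. -/
theorem volume_inter_preimage_le {z : ℝ → ℝ} {B : ℝ} (hB : 0 < B) {I : Set ℝ}
    (hz : ∀ s ∈ I, ∀ s' ∈ I, s ≤ s' → B * (s' - s) ≤ z s' - z s) (T : Set ℝ) :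
    volume (I ∩ z ⁻¹' T) ≤ ENNReal.ofReal B⁻¹ * volume (z '' I ∩ T) := by
  have hab : ∀ s ∈ I, ∀ s' ∈ I, |s - s'| ≤ B⁻¹ * |z s - z s'| := by
    intro s hs s' hs'
    rw [le_inv_mul_iff₀ hB]
    rcases le_total s s' with h | h
    · rw [abs_sub_comm s, abs_sub_comm (z s), abs_of_nonneg (sub_nonneg.2 h)]
      exact (hz s hs s' hs' h).trans (le_abs_self _)
    · rw [abs_of_nonneg (sub_nonneg.2 h)]
      exact (hz s' hs' s hs h).trans (le_abs_self _)
  have hinj : InjOn z I := fun s hs s' hs' h => by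
    have := hab s hs s' hs'
    rw [h, sub_self, abs_zero, mul_zero] at this
    exact sub_eq_zero.1 (abs_eq_zero.1 (this.antisymm (abs_nonneg _)))
  have hL : LipschitzOnWith (Real.toNNReal B⁻¹) (Function.invFunOn z I) (z '' I ∩ T) := by
    refine LipschitzOnWith.of_dist_le_mul fun x hx y hy => ?_
    obtain ⟨⟨s, hs, rfl⟩, -⟩ := hx
    obtain ⟨⟨s', hs', rfl⟩, -⟩ := hy
    rw [hinj.leftInvOn_invFunOn hs, hinj.leftInvOn_invFunOn hs', Real.dist_eq, Real.dist_eq,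
      Real.coe_toNNReal _ (inv_pos.2 hB).le]
    exact hab s hs s' hs'
  have h1 := hL.hausdorffMeasure_image_le zero_le_one
  rw [hausdorffMeasure_real, ENNReal.rpow_one] at h1
  refine (measure_mono fun s hs => ?_).trans h1
  exact ⟨z s, ⟨mem_image_of_mem z hs.1, hs.2⟩, hinj.leftInvOn_invFunOn hs.1⟩

/-- The image of Lebesgue measure on `I` under `z` is at most `B⁻¹` times Lebesgue measure on the
half line. No derivative of `z` is needed, which suits heights that are merely Lipschitz. -/
theorem lintegral_comp_le_of_expanding {z : ℝ → ℝ} {B : ℝ} (hB : 0 < B) {I : Set ℝ}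
    (hI : MeasurableSet I) (hz : ∀ s ∈ I, ∀ s' ∈ I, s ≤ s' → B * (s' - s) ≤ z s' - z s)
    (hz0 : ∀ s ∈ I, 0 < z s) {F : ℝ → ℝ≥0∞} (hF : Measurable F) :
    ∫⁻ s in I, F (z s) ≤ ENNReal.ofReal B⁻¹ * ∫⁻ x in Ioi 0, F x := by
  have hmono : MonotoneOn z I := fun s hs s' hs' h =>
    sub_nonneg.1 ((mul_nonneg hB.le (sub_nonneg.2 h)).trans (hz s hs s' hs' h))
  have hzm : AEMeasurable z (volume.restrict I) := aemeasurable_restrict_of_monotoneOn hI hmono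
  rw [← lintegral_map' hF.aemeasurable hzm, ← smul_eq_mul, ← lintegral_smul_measure]
  refine lintegral_mono' (Measure.le_iff.2 fun T hT => ?_) le_rfl
  rw [Measure.map_apply_of_aemeasurable hzm hT, Measure.restrict_apply' hI, inter_comm,
    Measure.smul_apply, smul_eq_mul, Measure.restrict_apply hT]
  refine (volume_inter_preimage_le hB hz T).trans ?_
  refine mul_le_mul' le_rfl (measure_mono ?_)
  rintro _ ⟨⟨s, hs, rfl⟩, h⟩
  exact ⟨h, hz0 s hs⟩

theorem sin_half_bounds {ϑ s : ℝ} (hϑ : ϑ < 1) (h0 : 0 < s) (h1 : s < ϑ) :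
    (1 - ϑ) * s ≤ 2 * Real.sin (s / 2) ∧ 15 / 16 * s ≤ 2 * Real.sin (s / 2) ∧
      Real.sin (s / 2) ≤ 1 / 2 := by
  have h2 := Real.sin_gt_sub_cube (x := s / 2) (by linarith)
  have h3 := Real.sin_lt (x := s / 2) (by linarith)
  have h4 : s ^ 2 ≤ s := by nlinarith
  have h5 : s ^ 3 ≤ s ^ 2 := by nlinarith
  refine ⟨?_, ?_, by linarith⟩
  · nlinarith
  · nlinarith

theorem sin_half_sub_ge {ϑ s s' : ℝ} (hϑ : ϑ < 1) (h0 : 0 < s) (h01 : s ≤ s') (h1 : s' < ϑ) :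
    (1 - ϑ) * (s' - s) ≤ 2 * (Real.sin (s' / 2) - Real.sin (s / 2)) := by
  have h := Convex.mul_sub_le_image_sub_of_le_deriv (convex_Icc s s')
    (f := fun x => 2 * Real.sin (x / 2)) (C := 1 - ϑ) (by fun_prop) (by fun_prop) ?_
    s (left_mem_Icc.2 h01) s' (right_mem_Icc.2 h01) h01
  · linarith
  intro x hx
  rw [interior_Icc] at hx
  have h2 : HasDerivAt (fun x : ℝ => 2 * Real.sin (x / 2)) (2 * (Real.cos (x / 2) * (1 / 2))) x :=
    (((Real.hasDerivAt_sin _).comp x ((hasDerivAt_id x).div_const 2))).const_mul 2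
  rw [h2.deriv]
  have h3 := Real.one_sub_sq_div_two_le_cos (x := x / 2)
  have h4 : x < ϑ := hx.2.trans h1
  have h5 : 0 < x := h0.trans hx.1
  nlinarith

/-- Distance of two points at angle `s` and radii `r s`, `ρ s` close to `1`: for small angles it
expands by almost `1`. -/
theorem expanding_of_polar_dist {t ϑ : ℝ} (ht : 0 ≤ t) (hϑ : 0 < ϑ) (htϑ : 19 * t + ϑ < 1)
    {r ρ z : ℝ → ℝ} {I : Set ℝ} (hI : I ⊆ Ioo 0 ϑ) (hr : ∀ s ∈ I, |r s - 1| ≤ t)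
    (hρ : ∀ s ∈ I, |ρ s - 1| ≤ t) (hrl : ∀ s ∈ I, ∀ s' ∈ I, |r s - r s'| ≤ t * |s - s'|)
    (hρl : ∀ s ∈ I, ∀ s' ∈ I, |ρ s - ρ s'| ≤ t * |s - s'|) (hd : ∀ s ∈ I, |r s - ρ s| ≤ t * s)
    (hz0 : ∀ s ∈ I, 0 ≤ z s)
    (hz : ∀ s ∈ I, z s ^ 2 = (r s - ρ s) ^ 2 + 4 * (r s * ρ s) * Real.sin (s / 2) ^ 2) :
    (∀ s ∈ I, (1 - 19 * t - ϑ) * s ≤ z s) ∧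
    ∀ s ∈ I, ∀ s' ∈ I, s ≤ s' → (1 - 19 * t - ϑ) * (s' - s) ≤ z s' - z s := by
  have ht1 : t < 1 / 19 := by linarith
  have hϑ1 : ϑ < 1 := by linarith
  have hS : ∀ s ∈ I, 0 < Real.sin (s / 2) := fun s hs =>
    Real.sin_pos_of_pos_of_lt_pi (by linarith [(hI hs).1]) (by linarith [(hI hs).2, Real.pi_gt_three])
  have hP1 : ∀ s ∈ I, (1 - t) ^ 2 ≤ r s * ρ s := fun s hs => by
    have h1 := abs_le.1 (hr s hs)
    have h2 := abs_le.1 (hρ s hs)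
    rw [pow_two]
    exact mul_le_mul (by linarith) (by linarith) (by linarith) (by linarith)
  have hP2 : ∀ s ∈ I, r s * ρ s ≤ (1 + t) ^ 2 := fun s hs => by
    have h1 := abs_le.1 (hr s hs)
    have h2 := abs_le.1 (hρ s hs)
    rw [pow_two]
    exact mul_le_mul (by linarith) (by linarith) (by linarith) (by linarith)
  have hzd : ∀ s ∈ I, |r s - ρ s| ≤ z s := fun s hs => by
    refine abs_le_of_sq_le_sq ?_ (hz0 s hs)
    rw [hz s hs]
    have := hP1 s hs
    have : 0 ≤ r s * ρ s := (sq_nonneg _).trans this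
    linarith [mul_nonneg this (sq_nonneg (Real.sin (s / 2)))]
  have hzS : ∀ s ∈ I, 2 * (1 - t) * Real.sin (s / 2) ≤ z s := fun s hs => by
    refine le_of_sq_le_sq ?_ (hz0 s hs)
    rw [hz s hs]
    nlinarith [mul_le_mul_of_nonneg_right (hP1 s hs) (sq_nonneg (Real.sin (s / 2))),
      sq_nonneg (r s - ρ s)]
  have hzu : ∀ s ∈ I, z s ≤ (2 + 6 * t) * Real.sin (s / 2) := fun s hs => by
    have hS0 := hS s hs
    refine le_of_sq_le_sq ?_ (by positivity)
    rw [hz s hs]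
    have h1 := (sin_half_bounds hϑ1 (hI hs).1 (hI hs).2).2.1
    have h2 : (r s - ρ s) ^ 2 ≤ (t * (32 / 15 * Real.sin (s / 2))) ^ 2 := by
      rw [← sq_abs]
      refine pow_le_pow_left₀ (abs_nonneg _) ((hd s hs).trans ?_) 2
      exact mul_le_mul_of_nonneg_left (by linarith) ht
    have h3 := mul_le_mul_of_nonneg_right (hP2 s hs) (sq_nonneg (Real.sin (s / 2)))
    have h4 : 0 ≤ t * Real.sin (s / 2) ^ 2 := by positivity
    have h5 : 0 ≤ t ^ 2 * Real.sin (s / 2) ^ 2 := by positivity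
    linarith
  refine ⟨fun s hs => ?_, fun s hs s' hs' hss => ?_⟩
  · have h1 := (sin_half_bounds hϑ1 (hI hs).1 (hI hs).2).1
    have h2 := hzS s hs
    have h3 : 0 < s := (hI hs).1
    have h4 : (1 - t) * ((1 - ϑ) * s) ≤ (1 - t) * (2 * Real.sin (s / 2)) :=
      mul_le_mul_of_nonneg_left h1 (by linarith)
    have h5 : 0 ≤ t * ϑ * s := by positivity
    nlinarith [mul_nonneg ht h3.le]
  · have hs0 : 0 < s := (hI hs).1
    have hA := sin_half_sub_ge hϑ1 hs0 hss (hI hs').2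
    have hS1 := hS s hs
    have hS2 := hS s' hs'
    have hS12 := (sin_half_bounds hϑ1 hs0 (hI hs).2).2.2
    have hz1 := hzS s hs
    have hz2 := hzS s' hs'
    set S := Real.sin (s / 2)
    set S' := Real.sin (s' / 2)
    have hzz : 0 < z s + z s' := by
      have h1 : 0 < 2 * (1 - t) * S := by apply mul_pos <;> linarith
      linarith [hz0 s' hs']
    set Δ := s' - s with hΔ
    have hΔ0 : 0 ≤ Δ := sub_nonneg.2 hss
    have hr' := hrl s' hs' s hs
    have hρ' := hρl s' hs' s hs
    rw [abs_of_nonneg hΔ0] at hr' hρ'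
    have hD : -(2 * t * Δ * (z s + z s')) ≤ (r s' - ρ s') ^ 2 - (r s - ρ s) ^ 2 := by
      have h1 : |(r s' - ρ s') ^ 2 - (r s - ρ s) ^ 2| ≤ 2 * t * Δ * (z s + z s') := by
        have h2 : (r s' - ρ s') ^ 2 - (r s - ρ s) ^ 2 =
            ((r s' - r s) - (ρ s' - ρ s)) * ((r s - ρ s) + (r s' - ρ s')) := by ring
        rw [h2, abs_mul]
        refine mul_le_mul ((abs_sub _ _).trans (by linarith)) ((abs_add_le _ _).trans
          (add_le_add (hzd s hs) (hzd s' hs'))) (abs_nonneg _) (by positivity)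
      exact (abs_le.1 h1).1
    have hP : -(3 * t * Δ) ≤ r s' * ρ s' - r s * ρ s := by
      have h1 : |r s' * ρ s' - r s * ρ s| ≤ 3 * t * Δ := by
        have h2 : r s' * ρ s' - r s * ρ s = r s' * (ρ s' - ρ s) + ρ s * (r s' - r s) := by ring
        have h3 : |r s'| ≤ 3 / 2 := by
          have := abs_le.1 (hr s' hs')
          exact abs_le.2 ⟨by linarith, by linarith⟩
        have h4 : |ρ s| ≤ 3 / 2 := by
          have := abs_le.1 (hρ s hs)
          exact abs_le.2 ⟨by linarith, by linarith⟩
        rw [h2]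
        refine (abs_add_le _ _).trans ?_
        rw [abs_mul, abs_mul]
        have h5 := mul_le_mul h3 hρ' (abs_nonneg _) (by norm_num)
        have h6 := mul_le_mul h4 hr' (abs_nonneg _) (by norm_num)
        linarith
      exact (abs_le.1 h1).1
    -- The distance is not differentiated: the increment of its square is split, and the common
    -- factor `z s + z s'` is cancelled at the end. The middle term carries the growth of the angle;
    -- the other two come from the variation of the heights and are `O(t)`.
    have hmain : z s' ^ 2 - z s ^ 2 = ((r s' - ρ s') ^ 2 - (r s - ρ s) ^ 2) +
        4 * (r s' * ρ s') * ((S' - S) * (S + S')) + 4 * (r s' * ρ s' - r s * ρ s) * S ^ 2 := by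
      rw [hz s hs, hz s' hs']
      ring
    have h1 : (1 - 5 * t) * (1 - ϑ) * Δ * (z s + z s') ≤
        4 * (r s' * ρ s') * ((S' - S) * (S + S')) := by
      have e1 : (1 - t) ^ 2 * ((1 - ϑ) * Δ * (2 * (S + S'))) ≤
          4 * (r s' * ρ s') * ((S' - S) * (S + S')) := by
        have := mul_le_mul (hP1 s' hs') (mul_le_mul_of_nonneg_right hA
          (by linarith : 0 ≤ 2 * (S + S'))) (mul_nonneg (mul_nonneg (by linarith) hΔ0)
            (by linarith)) ((sq_nonneg _).trans (hP1 s' hs'))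
        linarith
      refine le_trans ?_ e1
      have e2 : z s + z s' ≤ (1 + 3 * t) * (2 * (S + S')) := by
        linarith [hzu s hs, hzu s' hs']
      have e3 : 0 ≤ (1 - ϑ) * Δ := mul_nonneg (by linarith) hΔ0
      have e4 : (1 - 5 * t) * (z s + z s') ≤ (1 - t) ^ 2 * (2 * (S + S')) := by
        refine (mul_le_mul_of_nonneg_left e2 (by linarith)).trans ?_
        rw [← mul_assoc]
        exact mul_le_mul_of_nonneg_right (by nlinarith) (by linarith)
      calc _ = (1 - ϑ) * Δ * ((1 - 5 * t) * (z s + z s')) := by ring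
        _ ≤ (1 - ϑ) * Δ * ((1 - t) ^ 2 * (2 * (S + S'))) := mul_le_mul_of_nonneg_left e4 e3
        _ = _ := by ring
    have h2 : -(12 * t * Δ * (z s + z s')) ≤ 4 * (r s' * ρ s' - r s * ρ s) * S ^ 2 := by
      have e1 : S ^ 2 ≤ z s + z s' := by nlinarith [hz0 s' hs']
      have e2 := mul_le_mul_of_nonneg_right hP (sq_nonneg S)
      have e3 : t * Δ * S ^ 2 ≤ t * Δ * (z s + z s') := by gcongr
      linarith
    -- The constant collects the losses `5 t + ϑ` from `h1`, `2 t` from `hD` and `12 t` from `h2`.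
    have h3 : (1 - 19 * t - ϑ) * Δ * (z s + z s') ≤ (z s' - z s) * (z s + z s') := by
      have e1 : (1 - 5 * t - ϑ) * (Δ * (z s + z s')) ≤
          (1 - 5 * t) * (1 - ϑ) * (Δ * (z s + z s')) :=
        mul_le_mul_of_nonneg_right (by nlinarith [mul_nonneg ht hϑ.le]) (mul_nonneg hΔ0 hzz.le)
      linarith
    exact le_of_mul_le_mul_right h3 hzz

/-- The integral of a kernel along an arc, split at the angle `ϑ`. -/
theorem arc_bracket_le {m : ℕ} {h : ℝ → ℝ≥0∞} (hh : Measurable h) {N : ℝ≥0∞} {t ϑ : ℝ}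
    (ht : 0 ≤ t) (hϑ : 0 < ϑ) (htϑ : 19 * t + ϑ < 1) (hN : ∀ x, ϑ / Real.pi ≤ x → h x ≤ N)
    {r ρ z : ℝ → ℝ} (hr : ∀ s ∈ Ioo 0 Real.pi, |r s - 1| ≤ t)
    (hρ : ∀ s ∈ Ioo 0 Real.pi, |ρ s - 1| ≤ t)
    (hrl : ∀ s ∈ Ioo 0 Real.pi, ∀ s' ∈ Ioo 0 Real.pi, |r s - r s'| ≤ t * |s - s'|)
    (hρl : ∀ s ∈ Ioo 0 Real.pi, ∀ s' ∈ Ioo 0 Real.pi, |ρ s - ρ s'| ≤ t * |s - s'|)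
    (hd : ∀ s ∈ Ioo 0 Real.pi, |r s - ρ s| ≤ t * s) (hz0 : ∀ s ∈ Ioo 0 Real.pi, 0 ≤ z s)
    (hz : ∀ s ∈ Ioo 0 Real.pi,
      z s ^ 2 = (r s - ρ s) ^ 2 + 4 * (r s * ρ s) * Real.sin (s / 2) ^ 2) :
    ∫⁻ s in Ioo 0 Real.pi, ENNReal.ofReal (Real.sin s ^ m * s ^ 2) *
        (ENNReal.ofReal ((r s * ρ s) ^ (m + 1)) * h (z s)) ≤
      ENNReal.ofReal (((1 - 19 * t - ϑ)⁻¹) ^ (3 * m + 5)) *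
          (∫⁻ x in Ioi 0, ENNReal.ofReal (x ^ (m + 2)) * h x) +
        ENNReal.ofReal (Real.pi ^ 3 * 4 ^ (m + 1)) * N := by
  have hReal.pi := Real.pi_gt_three
  set B := 1 - 19 * t - ϑ with hB
  have hB0 : 0 < B := by linarith
  have hB1 : B < 1 := by linarith
  have hrρ : ∀ s ∈ Ioo 0 Real.pi, 0 ≤ r s * ρ s ∧ r s * ρ s ≤ (1 + t) ^ 2 := fun s hs => by
    have h1 := abs_le.1 (hr s hs)
    have h2 := abs_le.1 (hρ s hs)
    refine ⟨mul_nonneg (by linarith) (by linarith), ?_⟩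
    rw [pow_two]
    exact mul_le_mul (by linarith) (by linarith) (by linarith) (by linarith)
  have hsplit : Ioo (0 : ℝ) Real.pi = Ioo 0 ϑ ∪ Ico ϑ Real.pi := (Ioo_union_Ico_eq_Ioo hϑ (by linarith)).symm
  have hsub : Ioo (0 : ℝ) ϑ ⊆ Ioo 0 Real.pi := Ioo_subset_Ioo_right (by linarith)
  have hsub' : Ico ϑ Real.pi ⊆ Ioo 0 Real.pi := Ico_subset_Ioo_left hϑ
  obtain ⟨hlow, hexp⟩ := expanding_of_polar_dist (z := z) (I := Ioo 0 ϑ) ht hϑ htϑ subset_rfl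
    (fun s hs => hr s (hsub hs)) (fun s hs => hρ s (hsub hs))
    (fun s hs s' hs' => hrl s (hsub hs) s' (hsub hs'))
    (fun s hs s' hs' => hρl s (hsub hs) s' (hsub hs')) (fun s hs => hd s (hsub hs))
    (fun s hs => hz0 s (hsub hs)) (fun s hs => hz s (hsub hs))
  rw [hsplit]
  refine (lintegral_union_le _ _ _).trans (add_le_add ?_ ?_)
  -- Near part. The exponent `3 * m + 5` is `m + 2` from replacing `s` by `B⁻¹ * z s`, `2 * (m + 1)`
  -- from the heights, each at most `1 + t ≤ B⁻¹`, and one more from the change of variables.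
  · have h1 : ∀ s ∈ Ioo 0 ϑ, ENNReal.ofReal (Real.sin s ^ m * s ^ 2) *
        (ENNReal.ofReal ((r s * ρ s) ^ (m + 1)) * h (z s)) ≤
        ENNReal.ofReal (B⁻¹ ^ (3 * m + 4)) * (ENNReal.ofReal (z s ^ (m + 2)) * h (z s)) := by
      intro s hs
      rw [← mul_assoc, ← mul_assoc, ← ENNReal.ofReal_mul' (pow_nonneg (hrρ s (hsub hs)).1 _),
        ← ENNReal.ofReal_mul (by positivity)]
      refine mul_le_mul' (ENNReal.ofReal_le_ofReal ?_) le_rfl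
      have h2 : Real.sin s ≤ s := Real.sin_le hs.1.le
      have h3 : 0 ≤ Real.sin s := Real.sin_nonneg_of_nonneg_of_le_pi hs.1.le (hsub hs).2.le
      have h4 : s ≤ B⁻¹ * z s := by
        rw [le_inv_mul_iff₀ hB0]
        exact hlow s hs
      have h5 : 1 + t ≤ B⁻¹ := by
        rw [le_inv_comm₀ (by linarith) hB0, ← one_div, le_div_iff₀ (by linarith)]
        nlinarith [mul_nonneg ht hϑ.le]
      have hs0 : 0 ≤ s := hs.1.le
      have hz1 := hz0 s (hsub hs)
      calc Real.sin s ^ m * s ^ 2 * (r s * ρ s) ^ (m + 1)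
          ≤ s ^ m * s ^ 2 * ((1 + t) ^ 2) ^ (m + 1) :=
            mul_le_mul (mul_le_mul_of_nonneg_right (pow_le_pow_left₀ h3 h2 _) (sq_nonneg s))
              (pow_le_pow_left₀ (hrρ s (hsub hs)).1 (hrρ s (hsub hs)).2 _)
              (pow_nonneg (hrρ s (hsub hs)).1 _) (by positivity)
        _ = s ^ (m + 2) * ((1 + t) ^ 2) ^ (m + 1) := by ring
        _ ≤ (B⁻¹ * z s) ^ (m + 2) * ((B⁻¹) ^ 2) ^ (m + 1) := by gcongr
        _ = B⁻¹ ^ (3 * m + 4) * z s ^ (m + 2) := by ring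
    refine (setLIntegral_mono' measurableSet_Ioo h1).trans ?_
    rw [lintegral_const_mul' _ _ ENNReal.ofReal_ne_top]
    have h2 := lintegral_comp_le_of_expanding hB0 measurableSet_Ioo hexp
      (fun s hs => (mul_pos hB0 hs.1).trans_le (hlow s hs))
      (F := fun x => ENNReal.ofReal (x ^ (m + 2)) * h x) (by fun_prop)
    refine (mul_le_mul' le_rfl h2).trans ?_
    rw [← mul_assoc, ← ENNReal.ofReal_mul (by positivity), ← pow_succ]
  -- Far part. Jordan's inequality gives `sin (s / 2) ≥ s / π`, and the product of the heights is at
  -- least `1 / 4`, so the distance is at least `ϑ / π` and the kernel is at most `N`.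
  · have h1 : ∀ s ∈ Ico ϑ Real.pi, ENNReal.ofReal (Real.sin s ^ m * s ^ 2) *
        (ENNReal.ofReal ((r s * ρ s) ^ (m + 1)) * h (z s)) ≤
        ENNReal.ofReal (Real.pi ^ 2 * 4 ^ (m + 1)) * N := by
      intro s hs
      have hs1 := hsub' hs
      have h3 : 0 ≤ Real.sin s := Real.sin_nonneg_of_nonneg_of_le_pi hs1.1.le hs1.2.le
      rw [← mul_assoc, ← ENNReal.ofReal_mul' (pow_nonneg (hrρ s hs1).1 _)]
      refine mul_le_mul' (ENNReal.ofReal_le_ofReal ?_) (hN _ ?_)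
      · calc Real.sin s ^ m * s ^ 2 * (r s * ρ s) ^ (m + 1) ≤ 1 ^ m * Real.pi ^ 2 * 4 ^ (m + 1) :=
            mul_le_mul (mul_le_mul (pow_le_pow_left₀ h3 (Real.sin_le_one s) _)
              (pow_le_pow_left₀ hs1.1.le hs1.2.le _) (sq_nonneg s) (by positivity))
              (pow_le_pow_left₀ (hrρ s hs1).1 ((hrρ s hs1).2.trans (by nlinarith)) _)
              (pow_nonneg (hrρ s hs1).1 _) (by positivity)
          _ = Real.pi ^ 2 * 4 ^ (m + 1) := by rw [one_pow, one_mul]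
      · have h4 : s / Real.pi ≤ Real.sin (s / 2) := by
          have := Real.mul_le_sin (x := s / 2) (by linarith [hs1.1]) (by linarith [hs1.2])
          calc s / Real.pi = 2 / Real.pi * (s / 2) := by ring
            _ ≤ _ := this
        have h6 : ϑ / Real.pi ≤ s / Real.pi := div_le_div_of_nonneg_right hs.1 (by linarith)
        have h7 : 0 < ϑ / Real.pi := by positivity
        refine (h6.trans h4).trans (le_of_sq_le_sq ?_ (hz0 s hs1))
        rw [hz s hs1]
        have h8 := abs_le.1 (hr s hs1)
        have h9 := abs_le.1 (hρ s hs1)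
        have h10 : 1 / 4 ≤ r s * ρ s := by
          have : (1 / 2) * (1 / 2) ≤ r s * ρ s :=
            mul_le_mul (by linarith) (by linarith) (by norm_num) (by linarith)
          linarith
        nlinarith [sq_nonneg (r s - ρ s), sq_nonneg (Real.sin (s / 2))]
    refine (setLIntegral_mono' measurableSet_Ico h1).trans ?_
    rw [setLIntegral_const, Real.volume_Ico, mul_right_comm]
    refine mul_le_mul' ?_ le_rfl
    rw [← ENNReal.ofReal_mul (by positivity)]
    refine ENNReal.ofReal_le_ofReal ?_
    have : 0 ≤ Real.pi ^ 2 * 4 ^ (m + 1) := by positivity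
    calc Real.pi ^ 2 * 4 ^ (m + 1) * (Real.pi - ϑ) ≤ Real.pi ^ 2 * 4 ^ (m + 1) * Real.pi := by gcongr; linarith
      _ = _ := by ring

/-! ### The kernel between two points of the graph -/

theorem norm_smul_sub_smul_sq {n : ℕ} {x y : Rn n} (hx : ‖x‖ = 1) (hy : ‖y‖ = 1) (r ρ : ℝ) :
    ‖r • x - ρ • y‖ ^ 2 = r ^ 2 + ρ ^ 2 - 2 * (r * ρ) * ⟪x, y⟫ := by
  rw [norm_sub_sq_real, norm_smul, norm_smul, hx, hy, inner_smul_left, inner_smul_right]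
  simp only [Real.norm_eq_abs, mul_one, sq_abs, RCLike.conj_to_real]
  ring

theorem inner_arc {m : ℕ} (A : Rot (m + 2)) (s s' : ℝ) :
    ⟪arc A s, arc A s'⟫ = Real.cos (s' - s) := by
  rw [arc, arc, inner_frame, Real.cos_sub]
  ring

/-- The density of the interaction of the point at height `r` over `x` with the point at height
`ρ` over `y`, in polar coordinates. -/
def polarKernel (m : ℕ) (h : ℝ → ℝ≥0∞) (x y : Rn (m + 2)) (r ρ : ℝ) : ℝ≥0∞ :=
  ENNReal.ofReal ((r * ρ) ^ (m + 1)) * h ‖r • x - ρ • y‖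

theorem measurable_polarKernel {m : ℕ} {h : ℝ → ℝ≥0∞} (hh : Measurable h) {α : Type*}
    [MeasurableSpace α] {x y : α → Rn (m + 2)} {r ρ : α → ℝ} (hx : Measurable x)
    (hy : Measurable y) (hr : Measurable r) (hρ : Measurable ρ) :
    Measurable fun a => polarKernel m h (x a) (y a) (r a) (ρ a) := by
  unfold polarKernel
  fun_prop

/-- The height `1 + t (α u(x) + (1 - α) u(y))`, between those of the graph over `x` and `y`. -/
def midHeight {n : ℕ} (u : Rn n → ℝ) (t α : ℝ) (x y : Rn n) : ℝ :=
  1 + t * (α * u x + (1 - α) * u y)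

theorem measurable_midHeight {n : ℕ} {u : Rn n → ℝ} (hu : Measurable u) (t : ℝ) {β : Type*}
    [MeasurableSpace β] {α : β → ℝ} {x y : β → Rn n} (hα : Measurable α) (hx : Measurable x)
    (hy : Measurable y) : Measurable fun b => midHeight u t (α b) (x b) (y b) := by
  unfold midHeight
  fun_prop

theorem abs_convex_comb_le {α a b c : ℝ} (hα : α ∈ Icc (0 : ℝ) 1) (ha : |a| ≤ c) (hb : |b| ≤ c) :
    |α * a + (1 - α) * b| ≤ c := by
  have h1 : 0 ≤ 1 - α := sub_nonneg.2 hα.2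
  refine (abs_add_le _ _).trans ?_
  rw [abs_mul, abs_mul, abs_of_nonneg hα.1, abs_of_nonneg h1]
  have := mul_le_mul_of_nonneg_left ha hα.1
  have := mul_le_mul_of_nonneg_left hb h1
  linarith

/-- Along one great circle each intermediate height is a convex combination of the heights at the
two endpoints. It is therefore within `t` of `1` and `t`-Lipschitz in `θ`, and two such heights
differ by at most `t θ`, the angular distance being exactly `θ` for every `w`. -/
theorem polarKernel_arc_bracket_le {m : ℕ} {h : ℝ → ℝ≥0∞} (hh : Measurable h) {N : ℝ≥0∞}
    {t ϑ : ℝ} (ht : 0 ≤ t) (hϑ : 0 < ϑ) (htϑ : 19 * t + ϑ < 1)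
    (hN : ∀ x, ϑ / Real.pi ≤ x → h x ≤ N) {u : Rn (m + 2) → ℝ} {A : Rot (m + 2)}
    (hu : ∀ s, |t * u (arc A s)| ≤ t)
    (hul : ∀ s s', |t * (u (arc A s) - u (arc A s'))| ≤ t * |s - s'|) {α β w : ℝ}
    (hα : α ∈ Icc (0 : ℝ) 1) (hβ : β ∈ Icc (0 : ℝ) 1) (hw : w ∈ Icc (0 : ℝ) 1) :
    ∫⁻ θ in Ioo 0 Real.pi, ENNReal.ofReal (Real.sin θ ^ m * θ ^ 2) *
        polarKernel m h (arc A (-(w * θ))) (arc A ((1 - w) * θ))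
          (midHeight u t α (arc A (-(w * θ))) (arc A ((1 - w) * θ)))
          (midHeight u t β (arc A (-(w * θ))) (arc A ((1 - w) * θ))) ≤
      ENNReal.ofReal (((1 - 19 * t - ϑ)⁻¹) ^ (3 * m + 5)) *
          (∫⁻ x in Ioi 0, ENNReal.ofReal (x ^ (m + 2)) * h x) +
        ENNReal.ofReal (Real.pi ^ 3 * 4 ^ (m + 1)) * N := by
  have hw' : 0 ≤ 1 - w := sub_nonneg.2 hw.2
  have hheight : ∀ γ ∈ Icc (0 : ℝ) 1, ∀ x y : ℝ,
      |midHeight u t γ (arc A x) (arc A y) - 1| ≤ t := by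
    intro γ hγ x y
    have : midHeight u t γ (arc A x) (arc A y) - 1 =
        γ * (t * u (arc A x)) + (1 - γ) * (t * u (arc A y)) := by
      rw [midHeight]; ring
    rw [this]
    exact abs_convex_comb_le hγ (hu x) (hu y)
  have hlip : ∀ γ ∈ Icc (0 : ℝ) 1, ∀ s s' : ℝ,
      |midHeight u t γ (arc A (-(w * s))) (arc A ((1 - w) * s)) -
        midHeight u t γ (arc A (-(w * s'))) (arc A ((1 - w) * s'))| ≤ t * |s - s'| := by
    intro γ hγ s s'
    have h1 : midHeight u t γ (arc A (-(w * s))) (arc A ((1 - w) * s)) -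
        midHeight u t γ (arc A (-(w * s'))) (arc A ((1 - w) * s')) =
        γ * (t * (u (arc A (-(w * s))) - u (arc A (-(w * s'))))) +
        (1 - γ) * (t * (u (arc A ((1 - w) * s)) - u (arc A ((1 - w) * s')))) := by
      rw [midHeight, midHeight]; ring
    rw [h1]
    refine abs_convex_comb_le hγ ((hul _ _).trans ?_) ((hul _ _).trans ?_)
    · refine mul_le_mul_of_nonneg_left ?_ ht
      rw [show -(w * s) - -(w * s') = -(w * (s - s')) by ring, abs_neg, abs_mul, abs_of_nonneg hw.1]
      exact mul_le_of_le_one_left (abs_nonneg _) hw.2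
    · refine mul_le_mul_of_nonneg_left ?_ ht
      rw [← mul_sub, abs_mul, abs_of_nonneg hw']
      exact mul_le_of_le_one_left (abs_nonneg _) (by linarith [hw.1])
  refine arc_bracket_le hh ht hϑ htϑ hN
    (r := fun θ => midHeight u t α (arc A (-(w * θ))) (arc A ((1 - w) * θ)))
    (ρ := fun θ => midHeight u t β (arc A (-(w * θ))) (arc A ((1 - w) * θ)))
    (z := fun θ => ‖midHeight u t α (arc A (-(w * θ))) (arc A ((1 - w) * θ)) • arc A (-(w * θ)) -
      midHeight u t β (arc A (-(w * θ))) (arc A ((1 - w) * θ)) • arc A ((1 - w) * θ)‖)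
    (fun s _ => hheight α hα _ _) (fun s _ => hheight β hβ _ _) (fun s _ s' _ => hlip α hα s s')
    (fun s _ s' _ => hlip β hβ s s') (fun s hs => ?_) (fun s _ => norm_nonneg _) fun s _ => ?_
  · have h1 : midHeight u t α (arc A (-(w * s))) (arc A ((1 - w) * s)) -
        midHeight u t β (arc A (-(w * s))) (arc A ((1 - w) * s)) =
        (α - β) * (t * (u (arc A (-(w * s))) - u (arc A ((1 - w) * s)))) := by
      rw [midHeight, midHeight]; ring
    rw [h1, abs_mul]
    have h2 : |α - β| ≤ 1 := abs_le.2 ⟨by linarith [hα.1, hβ.2], by linarith [hα.2, hβ.1]⟩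
    refine (mul_le_of_le_one_left (abs_nonneg _) h2).trans ((hul _ _).trans_eq ?_)
    rw [show -(w * s) - (1 - w) * s = -s by ring, abs_neg, abs_of_pos hs.1]
  -- The law of cosines, with `cos s = 1 - 2 sin² (s / 2)`.
  · rw [norm_smul_sub_smul_sq (norm_arc _ _) (norm_arc _ _), inner_arc,
      show (1 - w) * s - -(w * s) = 2 * (s / 2) by ring, Real.cos_two_mul, Real.cos_sq']
    ring

/-- The nonlocal energy with the interaction kernel of a nearly spherical graph is at most
`1 + O(t)` times the Dirichlet energy. -/
theorem polarKernel_energy_le {m : ℕ} {h : ℝ → ℝ≥0∞} (hh : Measurable h) {N : ℝ≥0∞}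
    {t ϑ : ℝ} (ht : 0 ≤ t) (hϑ : 0 < ϑ) (htϑ : 19 * t + ϑ < 1)
    (hN : ∀ x, ϑ / Real.pi ≤ x → h x ≤ N) {u : Sph (m + 2) → ℝ} {L : ℝ≥0}
    (hL : LipschitzWith L u) (hu : ∀ σ, |t * u σ| ≤ t)
    (hul : ∀ᵐ A ∂(rotHaar (m + 2)), ∀ s s' : ℝ,
      |t * (homExt u (arc A s) - homExt u (arc A s'))| ≤ t * |s - s'|) {α β : ℝ}
    (hα : α ∈ Icc (0 : ℝ) 1) (hβ : β ∈ Icc (0 : ℝ) 1) :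
    (m + 1 : ℕ) * ∫⁻ x : Sph (m + 2), ∫⁻ y : Sph (m + 2), ENNReal.ofReal ((u x - u y) ^ 2) *
        polarKernel m h x y (midHeight (homExt u) t α x y) (midHeight (homExt u) t β x y)
        ∂(surf (m + 2)) ∂(surf (m + 2)) ≤
      sphArea m * (ENNReal.ofReal (((1 - 19 * t - ϑ)⁻¹) ^ (3 * m + 5)) *
          (∫⁻ x in Ioi 0, ENNReal.ofReal (x ^ (m + 2)) * h x) +
        ENNReal.ofReal (Real.pi ^ 3 * 4 ^ (m + 1)) * N) * ENNReal.ofReal (gradNormSqL2 u) := by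
  have hU : Measurable (homExt u) := measurable_homExt hL
  refine nonlocal_energy_le hL (K := fun x y =>
    polarKernel m h x y (midHeight (homExt u) t α x y) (midHeight (homExt u) t β x y)) ?_ ?_
  · exact measurable_polarKernel hh measurable_fst measurable_snd
      (measurable_midHeight hU t measurable_const measurable_fst measurable_snd)
      (measurable_midHeight hU t measurable_const measurable_fst measurable_snd)
  filter_upwards [hul] with A hA
  have hx : Measurable fun q : ℝ × ℝ => arc A (-(q.2 * q.1)) :=
    measurable_arc_comp (measurable_const (a := A)) (by fun_prop)
  have hy : Measurable fun q : ℝ × ℝ => arc A ((1 - q.2) * q.1) :=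
    measurable_arc_comp (measurable_const (a := A)) (by fun_prop)
  have hm : Measurable fun q : ℝ × ℝ => ENNReal.ofReal (Real.sin q.1 ^ m * q.1 ^ 2) *
      polarKernel m h (arc A (-(q.2 * q.1))) (arc A ((1 - q.2) * q.1))
        (midHeight (homExt u) t α (arc A (-(q.2 * q.1))) (arc A ((1 - q.2) * q.1)))
        (midHeight (homExt u) t β (arc A (-(q.2 * q.1))) (arc A ((1 - q.2) * q.1))) := by
    refine Measurable.mul (by fun_prop) (measurable_polarKernel hh hx hy
      (measurable_midHeight hU t measurable_const hx hy)
      (measurable_midHeight hU t measurable_const hx hy))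
  have h1 : ∀ θ : ℝ, ENNReal.ofReal (Real.sin θ ^ m * θ ^ 2) * ∫⁻ w in Ioo (0 : ℝ) 1,
      polarKernel m h (arc A (-(w * θ))) (arc A ((1 - w) * θ))
        (midHeight (homExt u) t α (arc A (-(w * θ))) (arc A ((1 - w) * θ)))
        (midHeight (homExt u) t β (arc A (-(w * θ))) (arc A ((1 - w) * θ))) =
      ∫⁻ w in Ioo (0 : ℝ) 1, ENNReal.ofReal (Real.sin θ ^ m * θ ^ 2) *
        polarKernel m h (arc A (-(w * θ))) (arc A ((1 - w) * θ))
        (midHeight (homExt u) t α (arc A (-(w * θ))) (arc A ((1 - w) * θ)))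
        (midHeight (homExt u) t β (arc A (-(w * θ))) (arc A ((1 - w) * θ))) := fun θ =>
    (lintegral_const_mul' _ _ ENNReal.ofReal_ne_top).symm
  simp only [h1]
  rw [lintegral_lintegral_swap hm.aemeasurable]
  refine (setLIntegral_mono' measurableSet_Ioo fun w hw =>
    polarKernel_arc_bracket_le hh ht hϑ htϑ hN (fun s => ?_) hA hα hβ ⟨hw.1.le, hw.2.le⟩).trans ?_
  · rw [homExt_of_norm_one u (norm_arc A s)]
    exact hu _
  · rw [setLIntegral_const, Real.volume_Ioo]
    simp

/-! ### Normalization of the profile -/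

theorem lintegral_sin_pow_mul_abs_cos (m : ℕ) :
    ∫⁻ θ in Ioo 0 Real.pi, ENNReal.ofReal (Real.sin θ ^ m) * ENNReal.ofReal |Real.cos θ| =
      ENNReal.ofReal (2 / (m + 1)) := by
  have hc : Continuous fun θ => Real.sin θ ^ m * |Real.cos θ| := by fun_prop
  have hd : ∀ θ, HasDerivAt (fun θ => Real.sin θ ^ (m + 1) / (m + 1))
      (Real.sin θ ^ m * Real.cos θ) θ := fun θ => by
    have h := ((Real.hasDerivAt_sin θ).pow (m + 1)).div_const ((m : ℝ) + 1)
    refine h.congr_deriv ?_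
    have : (m : ℝ) + 1 ≠ 0 := by positivity
    rw [Nat.add_sub_cancel]
    push_cast
    field_simp
  have hi : ∀ a b : ℝ, ∫ θ in a..b, Real.sin θ ^ m * Real.cos θ =
      Real.sin b ^ (m + 1) / (m + 1) - Real.sin a ^ (m + 1) / (m + 1) := fun a b =>
    intervalIntegral.integral_eq_sub_of_hasDerivAt (fun θ _ => hd θ)
      (Continuous.intervalIntegrable (by fun_prop) _ _)
  have hπ := Real.pi_pos
  have h1 : ∫ θ in (0)..(Real.pi / 2), Real.sin θ ^ m * |Real.cos θ| = 1 / (m + 1) := by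
    rw [← sub_zero (1 / ((m : ℝ) + 1))]
    have h2 := hi 0 (Real.pi / 2)
    simp only [Real.sin_pi_div_two, Real.sin_zero, one_pow, zero_pow m.succ_ne_zero, zero_div] at h2
    rw [← h2]
    refine intervalIntegral.integral_congr fun θ hθ => ?_
    rw [uIcc_of_le (by linarith)] at hθ
    rw [abs_of_nonneg (Real.cos_nonneg_of_neg_pi_div_two_le_of_le (by linarith [hθ.1]) hθ.2)]
  have h2 : ∫ θ in (Real.pi / 2)..Real.pi, Real.sin θ ^ m * |Real.cos θ| = 1 / (m + 1) := by
    have h2 := hi (Real.pi / 2) Real.pi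
    simp only [Real.sin_pi_div_two, Real.sin_pi, one_pow, zero_pow m.succ_ne_zero, zero_div] at h2
    rw [show 1 / ((m : ℝ) + 1) = -(0 - 1 / (m + 1)) by ring, ← h2, ← intervalIntegral.integral_neg]
    refine intervalIntegral.integral_congr fun θ hθ => ?_
    rw [uIcc_of_le (by linarith)] at hθ
    rw [abs_of_nonpos (Real.cos_nonpos_of_pi_div_two_le_of_le hθ.1 (by linarith [hθ.2]))]
    ring
  have h3 : ∫ θ in Ioo 0 Real.pi, Real.sin θ ^ m * |Real.cos θ| = 2 / (m + 1) := by
    rw [← integral_Ioc_eq_integral_Ioo, ← intervalIntegral.integral_of_le hπ.le,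
      ← intervalIntegral.integral_add_adjacent_intervals (hc.intervalIntegrable 0 (Real.pi / 2))
        (hc.intervalIntegrable _ _), h1, h2]
    ring
  have hs : ∀ θ ∈ Ioo 0 Real.pi, 0 ≤ Real.sin θ ^ m := fun θ hθ =>
    pow_nonneg (Real.sin_nonneg_of_nonneg_of_le_pi hθ.1.le hθ.2.le) m
  rw [← h3, ofReal_integral_eq_lintegral_ofReal]
  · refine setLIntegral_congr_fun measurableSet_Ioo fun θ hθ => ?_
    exact (ENNReal.ofReal_mul (hs θ hθ)).symm
  · exact (hc.integrableOn_Icc (a := 0) (b := Real.pi)).mono_set Ioo_subset_Icc_self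
  · filter_upwards [ae_restrict_mem measurableSet_Ioo] with θ hθ
    exact mul_nonneg (hs θ hθ) (abs_nonneg _)

/-- The function `|σ · ν|` is zonal, so `K1` reduces to an explicit integral in the polar angle.
This converts the normalization of the first moment into the one that makes the Dirichlet constant
equal to `1`. -/
theorem sphArea_mul_ofReal_K1 (m : ℕ) :
    sphArea (m + 1) * ENNReal.ofReal (K1 (e0 (m + 1))) =
      sphArea m * ENNReal.ofReal (2 / (m + 1)) := by
  rw [← lintegral_sin_pow_mul_abs_cos,
    ← lintegral_zonal (fun c => ENNReal.ofReal |c|) (by fun_prop), K1, average_eq,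
    smul_eq_mul, ENNReal.ofReal_mul (by positivity), measureReal_def,
    ← sphArea, ENNReal.ofReal_inv_of_pos (ENNReal.toReal_pos (sphArea_ne_zero (m + 1)) (sphArea_ne_top _)),
    ENNReal.ofReal_toReal (sphArea_ne_top (m + 1)), ← mul_assoc,
    ENNReal.mul_inv_cancel (sphArea_ne_zero (m + 1)) (sphArea_ne_top _), one_mul,
    ofReal_integral_eq_lintegral_ofReal]
  · simp only [real_inner_comm]
  · refine Continuous.integrable_of_hasCompactSupport (by fun_prop) ?_
    exact HasCompactSupport.of_compactSpace _
  · exact ae_of_all _ fun σ => abs_nonneg _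

/-- Polar coordinates lift a null set of radii to a null set of points. -/
theorem ae_norm_of_ae {m : ℕ} {p : ℝ → Prop} (hp : ∀ᵐ r ∂(volume.restrict (Ioi (0 : ℝ))), p r) :
    ∀ᵐ x : Rn (m + 2), p ‖x‖ := by
  obtain ⟨T, hT, hTm, hT0⟩ := exists_measurable_superset_of_null (ae_iff.1 hp)
  have h1 := lintegral_radial (k := m + 1) (T.indicator 1) (measurable_one.indicator hTm)
  have h2 : ∫⁻ r in Ioi (0 : ℝ), ENNReal.ofReal (r ^ (m + 1)) * T.indicator 1 r = 0 := by
    rw [← lintegral_zero (μ := volume.restrict (Ioi (0 : ℝ)))]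
    refine lintegral_congr_ae ?_
    have : ∀ᵐ r ∂(volume.restrict (Ioi (0 : ℝ))), r ∉ T := measure_eq_zero_iff_ae_notMem.1 hT0
    filter_upwards [this] with r hr
    simp [hr]
  rw [h2, mul_zero] at h1
  replace h1 := (lintegral_eq_zero_iff ((measurable_one.indicator hTm).comp measurable_norm)).1 h1
  filter_upwards [h1] with x hx
  by_contra hpx
  have : ‖x‖ ∈ T := hT hpx
  simp [this] at hx

/-- `h` is a measurable version of the profile of the kernel; it is dominated by
`M(r) / r^(n+1)`, where `M` vanishes at infinity. -/
structure IsProfile (m : ℕ) (h : ℝ → ℝ≥0∞) (M : ℝ → ℝ) : Prop where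
  measurable : Measurable h
  antitone : Antitone M
  tendsto : Tendsto M atTop (𝓝 0)
  nonneg : ∀ r, 0 ≤ M r
  le : ∀ r, 0 < r → h r ≤ ENNReal.ofReal (M r / r ^ (m + 3))
  moment : 2 * (sphArea m * ∫⁻ r in Ioi 0, ENNReal.ofReal (r ^ (m + 2)) * h r) = (m + 1 : ℕ)

/-- Combines the decay estimate with the value of `K1`. The moment identity in `IsProfile` is the
hypothesis on the first moment, rewritten with the area of the sphere of one dimension less. -/
theorem exists_isProfile {m : ℕ} {G : Rn (m + 2) → ℝ} {g : ℝ → ℝ} (hG : IsRadialKernel G g)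
    (hG1 : HasUnitFirstMoment G) (hG2 : HasHigherMoment G) :
    ∃ h M, IsProfile m h M ∧ (∀ᵐ r ∂(volume.restrict (Ioi (0 : ℝ))), ENNReal.ofReal (g r) = h r) ∧
      ∀ᵐ x, ENNReal.ofReal (G x) = h ‖x‖ := by
  obtain ⟨M, hMa, hMt, hM0, hM⟩ := exists_profile_bound hG hG1 hG2
  have hMm : Measurable M := hMa.measurable
  -- The profile is set to zero where the decay bound fails, so that the bound holds at every
  -- radius; this changes it only on a null set.
  set T : Set ℝ := {r | g r ≤ M r / r ^ (m + 3)} with hTdef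
  have hT : MeasurableSet T := measurableSet_le hG.profile_measurable (by fun_prop)
  set h : ℝ → ℝ≥0∞ := T.indicator fun r => ENNReal.ofReal (g r) with hh
  have hm : Measurable h := hG.profile_measurable.ennreal_ofReal.indicator hT
  have hae : ∀ᵐ r ∂(volume.restrict (Ioi (0 : ℝ))), ENNReal.ofReal (g r) = h r := by
    filter_upwards [hM] with r hr
    rw [hh, indicator_of_mem (show r ∈ T from hr)]
  have haeG : ∀ᵐ x, ENNReal.ofReal (G x) = h ‖x‖ := by
    filter_upwards [ae_norm_of_ae hae, hG.radial] with x h1 h2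
    rw [h2, h1]
  refine ⟨h, M, ⟨hm, hMa, hMt, hM0, fun r hr => ?_, ?_⟩, hae, haeG⟩
  · by_cases hrT : r ∈ T
    · rw [hh, indicator_of_mem hrT]
      exact ENNReal.ofReal_le_ofReal hrT
    · rw [hh, indicator_of_notMem hrT]
      exact zero_le
  · have h1 : ENNReal.ofReal (1 / K1 (e0 (m + 1))) = sphArea (m + 1) *
        ∫⁻ r in Ioi 0, ENNReal.ofReal (r ^ (m + 2)) * h r := by
      rw [← hG1.moment_eq, ofReal_integral_eq_lintegral_ofReal hG1.integrable
        (ae_of_all _ fun x => mul_nonneg (norm_nonneg _) (hG.nonneg x))]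
      have h2 := lintegral_radial (k := m + 1) (fun r => ENNReal.ofReal r * h r) (by fun_prop)
      have h3 : ∫⁻ x, ENNReal.ofReal (‖x‖ * G x) =
          ∫⁻ x : Rn (m + 2), ENNReal.ofReal ‖x‖ * h ‖x‖ := by
        refine lintegral_congr_ae ?_
        filter_upwards [haeG] with x hx
        rw [ENNReal.ofReal_mul (norm_nonneg _), hx]
      rw [h3, h2]
      congr 1
      refine setLIntegral_congr_fun measurableSet_Ioi fun r hr => ?_
      have hr0 : (0 : ℝ) < r := hr
      rw [← mul_assoc, ← ENNReal.ofReal_mul (by positivity), ← pow_succ]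
    have h2 := sphArea_mul_ofReal_K1 m
    set I := ∫⁻ r in Ioi 0, ENNReal.ofReal (r ^ (m + 2)) * h r
    have hK : 0 < K1 (e0 (m + 1)) := by
      by_contra hK
      rw [ENNReal.ofReal_of_nonpos (not_lt.1 hK), mul_zero] at h2
      have h3 : (0 : ℝ) < 2 / (m + 1) := by positivity
      exact mul_ne_zero (sphArea_ne_zero m) (ENNReal.ofReal_pos.2 h3).ne' h2.symm
    have h3 : ENNReal.ofReal (K1 (e0 (m + 1))) * ENNReal.ofReal (1 / K1 (e0 (m + 1))) = 1 := by
      rw [← ENNReal.ofReal_mul hK.le, mul_one_div_cancel hK.ne', ENNReal.ofReal_one]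
    have h4 : sphArea m * ENNReal.ofReal (2 / (m + 1)) * I = 1 := by
      rw [← h2, mul_right_comm, ← h1, mul_comm, h3]
    have h5 : ENNReal.ofReal (2 / (m + 1)) * (m + 1 : ℕ) = 2 := by
      rw [← ENNReal.ofReal_natCast, ← ENNReal.ofReal_mul (by positivity)]
      push_cast
      rw [div_mul_cancel₀ _ (by positivity), ENNReal.ofReal_ofNat]
    calc 2 * (sphArea m * I) = (sphArea m * ENNReal.ofReal (2 / (m + 1)) * I) * (m + 1 : ℕ) := by
          rw [← h5]; ring
      _ = _ := by rw [h4, one_mul]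

/-! ### Rescaling -/

/-- The rescaled profile `h_ε(r) = ε^{-(n+1)} h(r / ε)`. -/
def scaleProfile (m : ℕ) (h : ℝ → ℝ≥0∞) (ε r : ℝ) : ℝ≥0∞ :=
  ENNReal.ofReal (ε ^ (m + 3))⁻¹ * h (ε⁻¹ * r)

theorem lintegral_Ioi_comp_mul {ε : ℝ} (hε : 0 < ε) {F : ℝ → ℝ≥0∞} (hF : Measurable F) :
    ∫⁻ r in Ioi 0, F (ε⁻¹ * r) = ENNReal.ofReal ε * ∫⁻ r in Ioi 0, F r := by
  have h1 := Real.map_volume_mul_left (inv_pos.2 hε).ne'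
  rw [inv_inv, abs_of_pos hε] at h1
  have h2 : ∀ r, (Ioi (0 : ℝ)).indicator (fun r => F (ε⁻¹ * r)) r =
      (Ioi (0 : ℝ)).indicator F (ε⁻¹ * r) := fun r => by
    simp only [indicator_apply, mem_Ioi, mul_pos_iff_of_pos_left (inv_pos.2 hε)]
  rw [← lintegral_indicator measurableSet_Ioi, ← lintegral_indicator measurableSet_Ioi,
    ← smul_eq_mul, ← lintegral_smul_measure, ← h1, lintegral_map (hF.indicator measurableSet_Ioi)
      (by fun_prop)]
  simp only [h2]

theorem IsProfile.scale_measurable {m : ℕ} {h : ℝ → ℝ≥0∞} {M : ℝ → ℝ} (hh : IsProfile m h M)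
    (ε : ℝ) : Measurable (scaleProfile m h ε) := by
  have := hh.measurable
  unfold scaleProfile
  fun_prop

/-- The decay power `m + 3` is the exponent of the rescaling, so the powers of `ε` cancel and `ε`
survives only in the argument of `M`, which it drives to infinity. -/
theorem IsProfile.scale_le {m : ℕ} {h : ℝ → ℝ≥0∞} {M : ℝ → ℝ} (hh : IsProfile m h M)
    {ε δ r : ℝ} (hε : 0 < ε) (hδ : 0 < δ) (hr : δ ≤ r) :
    scaleProfile m h ε r ≤ ENNReal.ofReal (M (ε⁻¹ * δ) / δ ^ (m + 3)) := by
  have hr0 : 0 < r := hδ.trans_le hr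
  have h1 : 0 < ε⁻¹ * r := by positivity
  refine (mul_le_mul' le_rfl (hh.le _ h1)).trans ?_
  rw [← ENNReal.ofReal_mul (by positivity)]
  refine ENNReal.ofReal_le_ofReal ?_
  have h2 : (ε ^ (m + 3))⁻¹ * (M (ε⁻¹ * r) / (ε⁻¹ * r) ^ (m + 3)) =
      M (ε⁻¹ * r) / r ^ (m + 3) := by
    rw [mul_pow, inv_pow]
    field_simp
  rw [h2]
  have h3 : M (ε⁻¹ * r) ≤ M (ε⁻¹ * δ) := hh.antitone (by gcongr)
  have h4 := hh.nonneg (ε⁻¹ * δ)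
  gcongr

/-- The weight `r ^ (m + 2)` with the measure `dr` is exactly the scale-invariant choice for this
rescaling, so only the argument of `D` feels `ε`. -/
theorem IsProfile.scale_moment {m : ℕ} {h : ℝ → ℝ≥0∞} {M : ℝ → ℝ} (hh : IsProfile m h M)
    {ε : ℝ} (hε : 0 < ε) {D : ℝ → ℝ≥0∞} (hD : Measurable D) :
    ∫⁻ r in Ioi 0, ENNReal.ofReal (r ^ (m + 2)) * scaleProfile m h ε r * D r =
      ∫⁻ r in Ioi 0, ENNReal.ofReal (r ^ (m + 2)) * h r * D (ε * r) := by
  have hm := hh.measurable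
  have h1 := lintegral_Ioi_comp_mul hε
    (F := fun r => ENNReal.ofReal (r ^ (m + 2)) * h r * D (ε * r)) (by fun_prop)
  have h2 : ENNReal.ofReal ε⁻¹ * ENNReal.ofReal ε = 1 := by
    rw [← ENNReal.ofReal_mul (by positivity), inv_mul_cancel₀ hε.ne', ENNReal.ofReal_one]
  rw [← one_mul (∫⁻ r in Ioi 0, ENNReal.ofReal (r ^ (m + 2)) * h r * D (ε * r)), ← h2, mul_assoc,
    ← h1, ← lintegral_const_mul' _ _ ENNReal.ofReal_ne_top]
  refine setLIntegral_congr_fun measurableSet_Ioi fun r hr => ?_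
  have hr0 : (0 : ℝ) < r := hr
  simp only [scaleProfile]
  rw [mul_inv_cancel_left₀ hε.ne']
  have h3 : ENNReal.ofReal (r ^ (m + 2)) * ENNReal.ofReal (ε ^ (m + 3))⁻¹ =
      ENNReal.ofReal ε⁻¹ * ENNReal.ofReal ((ε⁻¹ * r) ^ (m + 2)) := by
    rw [← ENNReal.ofReal_mul (by positivity), ← ENNReal.ofReal_mul (by positivity)]
    congr 1
    rw [mul_pow, inv_pow]
    field_simp
    ring
  rw [← mul_assoc, h3]
  ring

theorem IsProfile.scale {m : ℕ} {h : ℝ → ℝ≥0∞} {M : ℝ → ℝ} (hh : IsProfile m h M)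
    {ε : ℝ} (hε : 0 < ε) :
    2 * (sphArea m * ∫⁻ r in Ioi 0, ENNReal.ofReal (r ^ (m + 2)) * scaleProfile m h ε r) =
      (m + 1 : ℕ) := by
  have h1 := hh.scale_moment hε (D := fun _ => 1) measurable_const
  simp only [mul_one] at h1
  rw [h1, hh.moment]

/-! ### The energy bound with optimized splitting angle -/

theorem one_add_pow_le {y : ℝ} (h0 : 0 ≤ y) (h1 : y ≤ 1) (k : ℕ) : (1 + y) ^ k ≤ 1 + 3 ^ k * y := by
  induction k with
  | zero => simp [h0]
  | succ k ih =>
    have h3 : (1 : ℝ) ≤ 3 ^ k := one_le_pow₀ (by norm_num)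
    calc (1 + y) ^ (k + 1) = (1 + y) ^ k * (1 + y) := pow_succ _ _
      _ ≤ (1 + 3 ^ k * y) * (1 + y) := by gcongr
      _ ≤ 1 + 3 ^ (k + 1) * y := by
        rw [pow_succ]
        nlinarith [mul_le_mul_of_nonneg_left h1 (mul_nonneg (by positivity : (0 : ℝ) ≤ 3 ^ k) h0)]

theorem inv_one_sub_pow_le {s : ℝ} (h0 : 0 ≤ s) (h1 : s ≤ 1 / 2) (k : ℕ) :
    ((1 - s)⁻¹) ^ k ≤ 1 + 2 * 3 ^ k * s := by
  have h2 : (1 - s)⁻¹ ≤ 1 + 2 * s := by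
    rw [inv_le_iff_one_le_mul₀ (by linarith)]
    nlinarith
  have h3 : 0 ≤ (1 - s)⁻¹ := inv_nonneg.2 (by linarith)
  refine (pow_le_pow_left₀ h3 h2 k).trans ((one_add_pow_le (by linarith) (by linarith) k).trans ?_)
  linarith

/-- The relative error of the energy of the kernel with tail bound `M` at scale `ε`, optimized
over the angle that separates near and far interactions. -/
def angularError (m : ℕ) (M : ℝ → ℝ) (ε : ℝ) : ℝ :=
  ⨅ ϑ : Ioc (0 : ℝ) (1 / 4), ((ϑ : ℝ) + M (ε⁻¹ * (ϑ / Real.pi)) / (ϑ / Real.pi) ^ (m + 3))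

theorem IsProfile.angularError_term_nonneg {m : ℕ} {h : ℝ → ℝ≥0∞} {M : ℝ → ℝ}
    (hh : IsProfile m h M) (ε : ℝ) (ϑ : Ioc (0 : ℝ) (1 / 4)) :
    0 ≤ (ϑ : ℝ) + M (ε⁻¹ * (ϑ / Real.pi)) / (ϑ / Real.pi) ^ (m + 3) := by
  have h1 := ϑ.2.1
  have h2 := hh.nonneg (ε⁻¹ * (ϑ / Real.pi))
  have := Real.pi_pos
  positivity

instance : Nonempty (Ioc (0 : ℝ) (1 / 4)) := ⟨⟨1 / 4, by norm_num⟩⟩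

theorem IsProfile.angularError_nonneg {m : ℕ} {h : ℝ → ℝ≥0∞} {M : ℝ → ℝ}
    (hh : IsProfile m h M) (ε : ℝ) : 0 ≤ angularError m M ε :=
  le_ciInf fun ϑ => hh.angularError_term_nonneg ε ϑ

theorem IsProfile.bddBelow_angularError {m : ℕ} {h : ℝ → ℝ≥0∞} {M : ℝ → ℝ}
    (hh : IsProfile m h M) (ε : ℝ) : BddBelow (range fun ϑ : Ioc (0 : ℝ) (1 / 4) =>
      ((ϑ : ℝ) + M (ε⁻¹ * (ϑ / Real.pi)) / (ϑ / Real.pi) ^ (m + 3))) := by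
  refine ⟨0, ?_⟩
  rintro _ ⟨ϑ, rfl⟩
  exact hh.angularError_term_nonneg ε ϑ

/-- First a fixed angle `ϑ ≤ a / 2` is chosen; for it, the second term tends to zero with `ε`
because `M` vanishes at infinity. -/
theorem IsProfile.tendsto_angularError {m : ℕ} {h : ℝ → ℝ≥0∞} {M : ℝ → ℝ}
    (hh : IsProfile m h M) : Tendsto (angularError m M) (𝓝[>] 0) (𝓝 0) := by
  rw [tendsto_order]
  refine ⟨fun a ha => Eventually.of_forall fun ε => ha.trans_le (hh.angularError_nonneg ε),
    fun a ha => ?_⟩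
  have hπ := Real.pi_pos
  set ϑ : Ioc (0 : ℝ) (1 / 4) := ⟨min (a / 2) (1 / 4), lt_min (half_pos ha) (by norm_num),
    min_le_right _ _⟩
  have hϑ0 : 0 < (ϑ : ℝ) / Real.pi := div_pos ϑ.2.1 hπ
  have h1 : Tendsto (fun ε : ℝ => M (ε⁻¹ * (ϑ / Real.pi)) / (ϑ / Real.pi) ^ (m + 3)) (𝓝[>] 0)
      (𝓝 (0 / (ϑ / Real.pi) ^ (m + 3))) :=
    (hh.tendsto.comp (tendsto_inv_nhdsGT_zero.atTop_mul_const hϑ0)).div_const _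
  rw [zero_div] at h1
  filter_upwards [h1.eventually (gt_mem_nhds (half_pos ha))] with ε hε
  refine (ciInf_le (hh.bddBelow_angularError ε) ϑ).trans_lt ?_
  have h2 : (ϑ : ℝ) ≤ a / 2 := min_le_left _ _
  linarith

/-- The infimum over angles need not be attained; the inequality passes to it because it is a closed
condition on the real parameter. -/
theorem le_of_forall_le_of_iInf {ι : Type*} [Nonempty ι] {f : ι → ℝ} (hf : BddBelow (range f))
    {F : ℝ → ℝ≥0∞} (hF : Continuous F) {X : ℝ≥0∞} (h : ∀ i, X ≤ F (f i)) : X ≤ F (⨅ i, f i) := by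
  have h1 : IsClosed {e | X ≤ F e} := isClosed_le continuous_const hF
  have h2 : range f ⊆ {e | X ≤ F e} := by
    rintro _ ⟨i, rfl⟩
    exact h i
  exact closure_minimal h2 h1 (csInf_mem_closure (range_nonempty f) hf)

/-- The near part has the leading constant `2 * sphArea m` times the `n`-th moment, which is `n - 1`
and cancels the isotropy factor. Everything else is of order `t`, `ϑ` or the far bound. The case `t
= 0` is the seminorm inequality; the case of small `t` bounds the interaction term. -/
theorem exists_energy_bound (m : ℕ) : ∃ C : ℝ, 0 < C ∧ ∀ (h : ℝ → ℝ≥0∞) (M : ℝ → ℝ),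
    IsProfile m h M → ∀ ε : ℝ, 0 < ε → ∀ t : ℝ, 0 ≤ t → t ≤ 1 / 76 →
    ∀ (u : Sph (m + 2) → ℝ) (L : ℝ≥0), LipschitzWith L u → (∀ σ, |t * u σ| ≤ t) →
    (∀ᵐ A ∂(rotHaar (m + 2)), ∀ s s' : ℝ,
      |t * (homExt u (arc A s) - homExt u (arc A s'))| ≤ t * |s - s'|) →
    ∀ α ∈ Icc (0 : ℝ) 1, ∀ β ∈ Icc (0 : ℝ) 1,
    2 * ∫⁻ x : Sph (m + 2), ∫⁻ y : Sph (m + 2), ENNReal.ofReal ((u x - u y) ^ 2) *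
        polarKernel m (scaleProfile m h ε) x y (midHeight (homExt u) t α x y)
          (midHeight (homExt u) t β x y) ∂(surf (m + 2)) ∂(surf (m + 2)) ≤
      ENNReal.ofReal ((1 + C * (t + angularError m M ε)) * gradNormSqL2 u) := by
  have hπ := Real.pi_pos
  set κ := (sphArea m).toReal with hκ
  set c := 2 * κ * (Real.pi ^ 3 * 4 ^ (m + 1)) / (m + 1) with hc
  have hc0 : 0 ≤ c := by positivity
  have hm0 : ((m + 1 : ℕ) : ℝ≥0∞) ≠ 0 := Nat.cast_ne_zero.2 m.succ_ne_zero
  have hcE : 2 * sphArea m * ENNReal.ofReal (Real.pi ^ 3 * 4 ^ (m + 1)) =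
      (m + 1 : ℕ) * ENNReal.ofReal c := by
    rw [← ENNReal.ofReal_toReal (sphArea_ne_top m), ← hκ, ← ENNReal.ofReal_natCast,
      ← ENNReal.ofReal_ofNat 2, ← ENNReal.ofReal_mul (by norm_num),
      ← ENNReal.ofReal_mul (by positivity), ← ENNReal.ofReal_mul (by positivity), hc]
    congr 1
    push_cast
    field_simp
  -- Here `38 = 2 * 19` comes from expanding the power of `(1 - 19 t - ϑ)⁻¹`, which requires `19 t +
  -- ϑ ≤ 1 / 2`; this is ensured by `t ≤ 1 / 76` and `ϑ ≤ 1 / 4`. The constant `c` is the far part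
  -- divided by `m + 1`.
  refine ⟨38 * 3 ^ (3 * m + 5) + c, by positivity, ?_⟩
  intro h M hh ε hε t ht0 ht1 u L hL hu hul α hα β hβ
  set C := 38 * 3 ^ (3 * m + 5) + c with hC
  have hg := gradNormSqL2_nonneg u
  refine le_of_forall_le_of_iInf (F := fun e => ENNReal.ofReal ((1 + C * (t + e)) * gradNormSqL2 u))
    (hh.bddBelow_angularError ε) (ENNReal.continuous_ofReal.comp (by fun_prop)) fun ϑ => ?_
  have hϑ0 := ϑ.2.1
  have hϑ1 := ϑ.2.2
  have h1 := polarKernel_energy_le (hh.scale_measurable ε) (t := t) (ϑ := ϑ) ht0 hϑ0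
    (by linarith) (fun x hx => hh.scale_le hε (by positivity) hx) hL hu hul hα hβ
  set X := ∫⁻ x : Sph (m + 2), ∫⁻ y : Sph (m + 2), ENNReal.ofReal ((u x - u y) ^ 2) *
        polarKernel m (scaleProfile m h ε) x y (midHeight (homExt u) t α x y)
          (midHeight (homExt u) t β x y) ∂(surf (m + 2)) ∂(surf (m + 2))
  set I := ∫⁻ r in Ioi 0, ENNReal.ofReal (r ^ (m + 2)) * scaleProfile m h ε r with hI
  set N := M (ε⁻¹ * (ϑ / Real.pi)) / (ϑ / Real.pi) ^ (m + 3) with hN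
  have hN0 : 0 ≤ N := div_nonneg (hh.nonneg _) (by positivity)
  set a := ((1 - 19 * t - ϑ)⁻¹) ^ (3 * m + 5) with ha
  have ha1 : a ≤ 1 + 2 * 3 ^ (3 * m + 5) * (19 * t + ϑ) := by
    rw [ha, sub_sub]
    exact inv_one_sub_pow_le (by positivity) (by linarith) _
  have ha0 : 0 ≤ a := pow_nonneg (inv_nonneg.2 (by linarith)) _
  have h2 : (m + 1 : ℕ) * (2 * X) ≤ (m + 1 : ℕ) *
      ((ENNReal.ofReal a + ENNReal.ofReal c * ENNReal.ofReal N) *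
        ENNReal.ofReal (gradNormSqL2 u)) := by
    calc (m + 1 : ℕ) * (2 * X) = 2 * ((m + 1 : ℕ) * X) := by ring
      _ ≤ _ := mul_le_mul' le_rfl h1
      _ = ((2 * (sphArea m * I)) * ENNReal.ofReal a +
          (2 * sphArea m * ENNReal.ofReal (Real.pi ^ 3 * 4 ^ (m + 1))) * ENNReal.ofReal N) *
          ENNReal.ofReal (gradNormSqL2 u) := by ring
      _ = _ := by rw [hI, hh.scale hε, hcE]; ring
  rw [ENNReal.mul_le_mul_iff_right hm0 (ENNReal.natCast_ne_top _)] at h2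
  refine h2.trans ?_
  rw [← ENNReal.ofReal_mul hc0, ← ENNReal.ofReal_add ha0 (by positivity),
    ← ENNReal.ofReal_mul (by positivity)]
  refine ENNReal.ofReal_le_ofReal (mul_le_mul_of_nonneg_right ?_ hg)
  have h3 : 0 ≤ c * (t + ϑ) := by positivity
  have h4 : (0 : ℝ) ≤ 3 ^ (3 * m + 5) * (36 * ϑ + 38 * N) := by positivity
  rw [hC]
  linarith

/-! ### The seminorm comparison and a Poincaré inequality -/

/-- The chord length is an injective function of the angle on `(0, π)` with nonvanishing derivative,
so preimages of null sets are null. -/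
theorem ae_restrict_two_mul_sin {T : Set ℝ} (hT : MeasurableSet T)
    (hT0 : volume.restrict (Ioi (0 : ℝ)) T = 0) {c : ℝ} (hc : 0 < c) :
    ∀ᵐ θ ∂(volume.restrict (Ioo 0 Real.pi)), c * (2 * Real.sin (θ / 2)) ∉ T := by
  have hcos : ∀ θ ∈ Ioo 0 Real.pi, 0 < Real.cos (θ / 2) := fun θ hθ =>
    Real.cos_pos_of_mem_Ioo ⟨by linarith [hθ.1, Real.pi_pos], by linarith [hθ.2]⟩
  have hd : ∀ θ ∈ Ioo 0 Real.pi, HasDerivWithinAt (fun θ => c * (2 * Real.sin (θ / 2)))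
      (c * Real.cos (θ / 2)) (Ioo 0 Real.pi) θ := fun θ _ => by
    have h := (((Real.hasDerivAt_sin (θ / 2)).comp θ
      ((hasDerivAt_id θ).div_const 2)).const_mul 2).const_mul c
    refine (h.congr_deriv ?_).hasDerivWithinAt
    ring
  have hinj : InjOn (fun θ => c * (2 * Real.sin (θ / 2))) (Ioo 0 Real.pi) := by
    intro x hx y hy hxy
    have h1 : Real.sin (x / 2) = Real.sin (y / 2) := by
      have := mul_left_cancel₀ hc.ne' hxy
      linarith
    have h2 := Real.injOn_sin (x₁ := x / 2) (x₂ := y / 2)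
      ⟨by linarith [hx.1, Real.pi_pos], by linarith [hx.2]⟩
      ⟨by linarith [hy.1, Real.pi_pos], by linarith [hy.2]⟩ h1
    linarith
  have h1 := lintegral_image_eq_lintegral_abs_deriv_mul measurableSet_Ioo hd hinj (T.indicator 1)
  have h2 : ∫⁻ x in (fun θ => c * (2 * Real.sin (θ / 2))) '' Ioo 0 Real.pi,
      (T.indicator 1 x : ℝ≥0∞) = 0 := by
    refine le_antisymm ?_ zero_le
    have h3 : (fun θ => c * (2 * Real.sin (θ / 2))) '' Ioo 0 Real.pi ⊆ Ioi 0 := by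
      rintro _ ⟨θ, hθ, rfl⟩
      have := Real.sin_pos_of_pos_of_lt_pi (x := θ / 2) (by linarith [hθ.1]) (by linarith [hθ.1, hθ.2])
      simp only [mem_Ioi]
      positivity
    refine (lintegral_mono_set h3).trans ?_
    rw [lintegral_indicator_one hT, hT0]
  rw [h2, eq_comm, lintegral_eq_zero_iff (by
    have : Measurable (T.indicator (1 : ℝ → ℝ≥0∞)) := measurable_one.indicator hT
    fun_prop)] at h1
  filter_upwards [h1, ae_restrict_mem measurableSet_Ioo] with θ h3 hθ hmem
  have h4 : 0 < |c * Real.cos (θ / 2)| := abs_pos.2 (mul_pos hc (hcos θ hθ)).ne'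
  simp only [indicator_of_mem hmem, Pi.one_apply, mul_one, Pi.zero_apply] at h3
  exact (ENNReal.ofReal_pos.2 h4).ne' h3

theorem norm_arc_zero_sub {m : ℕ} (A : Rot (m + 2)) {θ : ℝ} (hθ : θ ∈ Ioo 0 Real.pi) :
    ‖arc A 0 - arc A θ‖ = 2 * Real.sin (θ / 2) := by
  have h1 : 0 ≤ Real.sin (θ / 2) :=
    Real.sin_nonneg_of_nonneg_of_le_pi (by linarith [hθ.1]) (by linarith [hθ.1, hθ.2])
  rw [← sq_eq_sq₀ (norm_nonneg _) (by positivity)]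
  have h2 := norm_smul_sub_smul_sq (norm_arc A 0) (norm_arc A θ) 1 1
  rw [one_smul, one_smul, inner_arc, sub_zero, show θ = 2 * (θ / 2) by ring, Real.cos_two_mul,
    Real.cos_sq', ← show θ = 2 * (θ / 2) by ring] at h2
  rw [h2]
  ring

/-- The distance of two random points of the sphere has an absolutely continuous law. -/
theorem ae_ae_dist_notMem {m : ℕ} {T : Set ℝ} (hT : MeasurableSet T)
    (hT0 : volume.restrict (Ioi (0 : ℝ)) T = 0) {c : ℝ} (hc : 0 < c) :
    ∀ᵐ x : Sph (m + 2) ∂(surf (m + 2)), ∀ᵐ y : Sph (m + 2) ∂(surf (m + 2)),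
      c * ‖(x : Rn (m + 2)) - y‖ ∉ T := by
  have hTm : Measurable (T.indicator (1 : ℝ → ℝ≥0∞)) := measurable_one.indicator hT
  have hF : Measurable (Function.uncurry fun x y : Rn (m + 2) =>
      (T.indicator (1 : ℝ → ℝ≥0∞) (c * ‖x - y‖))) := by
    have : Measurable fun p : Rn (m + 2) × Rn (m + 2) => c * ‖p.1 - p.2‖ := by fun_prop
    exact hTm.comp this
  have h1 := lintegral_surf_surf (m := m) _ hF
  have h2 : ∫⁻ θ in Ioo 0 Real.pi, ENNReal.ofReal (Real.sin θ ^ m) *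
      ∫⁻ A : Rot (m + 2), T.indicator (1 : ℝ → ℝ≥0∞) (c * ‖arc A 0 - arc A θ‖)
        ∂(rotHaar (m + 2)) = 0 := by
    rw [← lintegral_zero (μ := volume.restrict (Ioo 0 Real.pi))]
    refine lintegral_congr_ae ?_
    filter_upwards [ae_restrict_two_mul_sin hT hT0 hc, ae_restrict_mem measurableSet_Ioo]
      with θ hθ hθ'
    simp [norm_arc_zero_sub _ hθ', hθ]
  rw [h2, mul_zero, mul_zero] at h1
  have hF' : Measurable fun p : Sph (m + 2) × Sph (m + 2) =>
      (T.indicator (1 : ℝ → ℝ≥0∞) (c * ‖(p.1 : Rn (m + 2)) - p.2‖)) :=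
    measurable_uncurry_comp hF (by fun_prop) (by fun_prop)
  replace h1 := (lintegral_eq_zero_iff hF'.lintegral_prod_right').1 h1
  filter_upwards [h1] with x hx
  replace hx := (lintegral_eq_zero_iff (hF'.comp measurable_prodMk_left)).1 hx
  filter_upwards [hx] with y hy hmem
  simp [hmem] at hy

/-- The energy estimate with kernel `1`, whose arc integral is at most `π ^ 3`. -/
theorem exists_poincare (m : ℕ) : ∃ C : ℝ, 0 < C ∧ ∀ (u : Sph (m + 2) → ℝ) (L : ℝ≥0),
    LipschitzWith L u →
    ∫⁻ x : Sph (m + 2), ∫⁻ y : Sph (m + 2), ENNReal.ofReal ((u x - u y) ^ 2)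
      ∂(surf (m + 2)) ∂(surf (m + 2)) ≤ ENNReal.ofReal (C * gradNormSqL2 u) := by
  have hπ := Real.pi_pos
  set κ := (sphArea m).toReal with hκ
  have hκ0 : 0 < κ := ENNReal.toReal_pos (sphArea_ne_zero m) (sphArea_ne_top m)
  refine ⟨κ * Real.pi ^ 3, by positivity, fun u L hL => ?_⟩
  have h1 := nonlocal_energy_le hL (K := fun _ _ => 1) measurable_const
    (Λ := ENNReal.ofReal (Real.pi ^ 3)) (ae_of_all _ fun A => ?_)
  · simp only [mul_one] at h1
    have h2 := le_trans (le_mul_of_one_le_left zero_le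
      (Nat.one_le_cast.2 (Nat.le_add_left 1 m))) h1
    rwa [← ENNReal.ofReal_toReal (sphArea_ne_top m), ← ENNReal.ofReal_mul (by positivity),
      ← ENNReal.ofReal_mul (by positivity)] at h2
  · have h2 : ∀ θ ∈ Ioo 0 Real.pi, ENNReal.ofReal (Real.sin θ ^ m * θ ^ 2) *
        ∫⁻ _ in Ioo (0 : ℝ) 1, 1 ≤ ENNReal.ofReal (Real.pi ^ 2) := fun θ hθ => by
      have hs := Real.sin_nonneg_of_nonneg_of_le_pi hθ.1.le hθ.2.le
      rw [setLIntegral_one, Real.volume_Ioo, sub_zero, ENNReal.ofReal_one, mul_one]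
      refine ENNReal.ofReal_le_ofReal ?_
      calc _ ≤ 1 * Real.pi ^ 2 := mul_le_mul (pow_le_one₀ hs (Real.sin_le_one θ))
            (pow_le_pow_left₀ hθ.1.le hθ.2.le 2) (sq_nonneg _) zero_le_one
        _ = _ := one_mul _
    refine (setLIntegral_mono' measurableSet_Ioo h2).trans ?_
    rw [setLIntegral_const, Real.volume_Ioo, ← ENNReal.ofReal_mul (by positivity)]
    refine ENNReal.ofReal_le_ofReal (le_of_eq ?_)
    ring

/-- The comparison of the nonlocal seminorm with the Dirichlet energy. -/
theorem seminorm_le_of_energy_bound {m : ℕ} {g : ℝ → ℝ} (hg0 : ∀ r, 0 < r → 0 ≤ g r)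
    {h : ℝ → ℝ≥0∞} (hgm : Measurable g) (hm : Measurable h)
    (hgh : ∀ᵐ r ∂(volume.restrict (Ioi (0 : ℝ))), ENNReal.ofReal (g r) = h r) {ε : ℝ} (hε : 0 < ε)
    (u : Sph (m + 2) → ℝ) :
    ∫⁻ x : Sph (m + 2), ∫⁻ y : Sph (m + 2),
      ENNReal.ofReal ((u x - u y) ^ 2 / ‖(x : Rn (m + 2)) - (y : Rn (m + 2))‖ ^ 2 *
        etaEps (m + 2) g ε ‖(x : Rn (m + 2)) - (y : Rn (m + 2))‖)
        ∂(surf (m + 2)) ∂(surf (m + 2)) ≤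
      2 * ∫⁻ x : Sph (m + 2), ∫⁻ y : Sph (m + 2), ENNReal.ofReal ((u x - u y) ^ 2) *
        polarKernel m (scaleProfile m h ε) x y (midHeight (homExt u) 0 0 x y)
          (midHeight (homExt u) 0 0 x y) ∂(surf (m + 2)) ∂(surf (m + 2)) := by
  have hT : MeasurableSet {r | ENNReal.ofReal (g r) ≠ h r} :=
    (measurableSet_eq_fun hgm.ennreal_ofReal hm).compl
  -- The functions `g` and `h` agree only at almost every radius, so almost every pair of points
  -- must have its rescaled distance outside the exceptional set.
  have h1 := ae_ae_dist_notMem (m := m) hT (ae_iff.1 hgh) (inv_pos.2 hε)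
  rw [← lintegral_const_mul' _ _ (by norm_num)]
  refine lintegral_mono_ae ?_
  filter_upwards [h1] with x hx
  rw [← lintegral_const_mul' _ _ (by norm_num)]
  refine lintegral_mono_ae ?_
  filter_upwards [hx] with y hy
  simp only [not_not] at hy
  rcases eq_or_ne x y with rfl | hxy
  · simp
  have hd : 0 < ‖(x : Rn (m + 2)) - (y : Rn (m + 2))‖ :=
    norm_pos_iff.2 (sub_ne_zero.2 fun h => hxy (Subtype.ext h))
  set d := ‖(x : Rn (m + 2)) - (y : Rn (m + 2))‖ with hdd
  -- The factor `d ^ 2` in the rescaled `η` cancels the denominator and leaves `2 ε ^ (-(n + 1)) g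
  -- (d / ε)`, which is the kernel at heights `1`.
  have h2 : (u x - u y) ^ 2 / d ^ 2 * etaEps (m + 2) g ε d =
      2 * ((u x - u y) ^ 2 * ((ε ^ (m + 3))⁻¹ * g (ε⁻¹ * d))) := by
    rw [etaEps, show m + 2 - 1 = m + 1 by omega, mul_pow, inv_pow]
    field_simp
    ring
  have hg1 : 0 ≤ g (ε⁻¹ * d) := hg0 _ (by positivity)
  rw [h2, ENNReal.ofReal_mul (by norm_num), ENNReal.ofReal_mul (by positivity),
    ENNReal.ofReal_mul (by positivity), hy, polarKernel, midHeight, scaleProfile]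
  simp [hdd]

/-! ### Perimeter of star-shaped sets -/

/-- The nonlocal perimeter with kernel `h(|x - y|)`. -/
def radialPer {n : ℕ} (h : ℝ → ℝ≥0∞) (E : Set (Rn n)) : ℝ≥0∞ :=
  2 * ∫⁻ x in E, ∫⁻ y in Eᶜ, h ‖x - y‖

theorem radialPer_congr {n : ℕ} (h : ℝ → ℝ≥0∞) {E F : Set (Rn n)} (hEF : E =ᵐ[volume] F) :
    radialPer h E = radialPer h F := by
  unfold radialPer
  rw [Measure.restrict_congr_set hEF, Measure.restrict_congr_set hEF.compl]

theorem nonlocalPer_rescale_eq {m : ℕ} {G : Rn (m + 2) → ℝ} {h : ℝ → ℝ≥0∞}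
    (hG : ∀ᵐ x, ENNReal.ofReal (G x) = h ‖x‖) {ε : ℝ} (hε : 0 < ε) (E : Set (Rn (m + 2))) :
    nonlocalPer (rescale G ε) E = radialPer (scaleProfile m h ε) E := by
  have h1 : ∀ᵐ x, ENNReal.ofReal (rescale G ε x) = scaleProfile m h ε ‖x‖ := by
    have h2 := (Measure.quasiMeasurePreserving_smul (volume : Measure (Rn (m + 2)))
      (inv_pos.2 hε).ne').ae hG
    filter_upwards [h2] with x hx
    rw [rescale, ENNReal.ofReal_mul (by positivity), hx, norm_smul, Real.norm_eq_abs,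
      abs_of_pos (inv_pos.2 hε), scaleProfile]
  unfold nonlocalPer radialPer
  congr 1
  refine lintegral_congr fun x => ?_
  refine lintegral_congr_ae (ae_restrict_of_ae ?_)
  exact (Measure.measurePreserving_sub_left volume x).quasiMeasurePreserving.ae h1

/-- The measure on pairs of radii with density `polarKernel m h x y`. -/
def polarMeas (m : ℕ) (h : ℝ → ℝ≥0∞) (x y : Rn (m + 2)) : Measure (ℝ × ℝ) :=
  ((volume.restrict (Ioi (0 : ℝ))).prod (volume.restrict (Ioi (0 : ℝ)))).withDensity
    fun p => polarKernel m h x y p.1 p.2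

/-- A decomposition of quadrants into disjoint rectangles, stated as an equality of sums so that it
holds for infinite measures. The leftover square has side `|a - b|`, the source of the quadratic
dependence on the oscillation of the radius. -/
theorem measure_prod_exchange (μ : Measure (ℝ × ℝ)) (a b : ℝ) :
    μ (Iio a ×ˢ Ici b) + μ (Iio b ×ˢ Ici a) =
      μ (Iio a ×ˢ Ici a) + μ (Iio b ×ˢ Ici b) +
        μ (Ico (min a b) (max a b) ×ˢ Ico (min a b) (max a b)) := by
  wlog hab : b ≤ a generalizing a b
  · rw [add_comm, this b a (le_of_not_ge hab), min_comm, max_comm, add_comm (μ (Iio b ×ˢ Ici b))]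
  rw [min_eq_right hab, max_eq_left hab]
  have h1 : Iio a ×ˢ Ici b = (Iio a ×ˢ Ici a) ∪ ((Iio b ×ˢ Ico b a) ∪ (Ico b a ×ˢ Ico b a)) := by
    ext ⟨r, ρ⟩
    simp only [mem_prod, mem_union, mem_Iio, mem_Ici, mem_Ico]
    grind
  have h2 : Iio b ×ˢ Ici b = (Iio b ×ˢ Ico b a) ∪ (Iio b ×ˢ Ici a) := by
    ext ⟨r, ρ⟩
    simp only [mem_prod, mem_union, mem_Iio, mem_Ici, mem_Ico]
    grind
  rw [h1, h2, measure_union, measure_union, measure_union]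
  · ring
  · refine disjoint_left.2 fun p hp hp' => ?_
    exact absurd hp.2.2 (not_lt.2 hp'.2)
  · exact measurableSet_Iio.prod measurableSet_Ici
  · refine disjoint_left.2 fun p hp hp' => ?_
    exact absurd hp.1 (not_lt.2 hp'.1.1)
  · exact measurableSet_Ico.prod measurableSet_Ico
  · refine disjoint_left.2 fun p hp hp' => ?_
    rcases hp' with hp' | hp'
    · exact absurd hp'.2.2 (not_lt.2 hp.2)
    · exact absurd hp'.2.2 (not_lt.2 hp.2)
  · exact (measurableSet_Iio.prod measurableSet_Ico).union (measurableSet_Ico.prod measurableSet_Ico)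

/-- By the law of cosines the distance depends on the unit vectors only through their inner product.
This symmetry allows the pairs `(x, y)` and `(y, x)` to be combined. -/
theorem polarMeas_comm {m : ℕ} (h : ℝ → ℝ≥0∞) {x y : Rn (m + 2)} (hx : ‖x‖ = 1) (hy : ‖y‖ = 1) :
    polarMeas m h x y = polarMeas m h y x := by
  unfold polarMeas polarKernel
  congr 1
  ext p
  congr 2
  rw [← sq_eq_sq₀ (norm_nonneg _) (norm_nonneg _), norm_smul_sub_smul_sq hx hy,
    norm_smul_sub_smul_sq hy hx, real_inner_comm]

theorem polarMeas_rot {m : ℕ} (h : ℝ → ℝ≥0∞) (A : Rot (m + 2)) (x y : Rn (m + 2)) :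
    polarMeas m h ((A : Rn (m + 2) →L[ℝ] Rn (m + 2)) x) ((A : Rn (m + 2) →L[ℝ] Rn (m + 2)) y) =
      polarMeas m h x y := by
  unfold polarMeas polarKernel
  simp only [← map_smul, ← map_sub, norm_rot_apply]

theorem polarMeas_apply {m : ℕ} (h : ℝ → ℝ≥0∞) (x y : Rn (m + 2)) {S : Set (ℝ × ℝ)}
    (hS : MeasurableSet S) : polarMeas m h x y S =
      ∫⁻ p, S.indicator (fun p => polarKernel m h x y p.1 p.2) p
        ∂((volume.restrict (Ioi (0 : ℝ))).prod (volume.restrict (Ioi (0 : ℝ)))) := by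
  rw [polarMeas, withDensity_apply _ hS, lintegral_indicator hS]

theorem polarMeas_prod {m : ℕ} {h : ℝ → ℝ≥0∞} (hh : Measurable h) (x y : Rn (m + 2)) {S T : Set ℝ}
    (hS : MeasurableSet S) (hT : MeasurableSet T) : polarMeas m h x y (S ×ˢ T) =
      ∫⁻ r in Ioi 0, S.indicator (fun r => ∫⁻ ρ in Ioi 0,
        T.indicator (fun ρ => polarKernel m h x y r ρ) ρ) r := by
  rw [polarMeas_apply h x y (hS.prod hT), lintegral_prod]
  · refine lintegral_congr fun r => ?_
    by_cases hr : r ∈ S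
    · rw [indicator_of_mem hr]
      refine lintegral_congr fun ρ => ?_
      by_cases hρ : ρ ∈ T
      · rw [indicator_of_mem hρ, indicator_of_mem (mk_mem_prod hr hρ)]
      · rw [indicator_of_notMem hρ, indicator_of_notMem fun h => hρ h.2]
    · simp [hr]
  · exact ((measurable_polarKernel hh measurable_const measurable_const measurable_fst
      measurable_snd).indicator (hS.prod hT)).aemeasurable

theorem measurable_polarMeas {m : ℕ} {h : ℝ → ℝ≥0∞} (hh : Measurable h) {β : Type*}
    [MeasurableSpace β] {x y : β → Rn (m + 2)} (hx : Measurable x) (hy : Measurable y)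
    {S : β → Set (ℝ × ℝ)} (hS : MeasurableSet {q : β × (ℝ × ℝ) | q.2 ∈ S q.1}) :
    Measurable fun b => polarMeas m h (x b) (y b) (S b) := by
  have hSb : ∀ b, MeasurableSet (S b) := fun b => hS.preimage measurable_prodMk_left
  simp only [polarMeas_apply h _ _ (hSb _)]
  refine Measurable.lintegral_prod_right' (f := fun q : β × (ℝ × ℝ) =>
    (S q.1).indicator (fun p => polarKernel m h (x q.1) (y q.1) p.1 p.2) q.2) ?_
  have : (fun q : β × (ℝ × ℝ) =>
      (S q.1).indicator (fun p => polarKernel m h (x q.1) (y q.1) p.1 p.2) q.2) =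
      {q : β × (ℝ × ℝ) | q.2 ∈ S q.1}.indicator
        (fun q => polarKernel m h (x q.1) (y q.1) q.2.1 q.2.2) := by
    rfl
  rw [this]
  exact (measurable_polarKernel hh (hx.comp measurable_fst) (hy.comp measurable_fst)
    (by fun_prop) (by fun_prop)).indicator hS

/-- The region inside the graph of the function `R` of the direction. -/
def starSet {n : ℕ} (R : Rn n → ℝ) : Set (Rn n) := {x | ‖x‖ < R x}

theorem measurableSet_starSet {n : ℕ} {R : Rn n → ℝ} (hR : Measurable R) :
    MeasurableSet (starSet R) := measurableSet_lt measurable_norm hR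

theorem smul_mem_starSet {n : ℕ} {R : Rn n → ℝ} (hR0 : ∀ r : ℝ, 0 < r → ∀ x, R (r • x) = R x)
    (σ : Sph n) {r : ℝ} (hr : 0 < r) : r • (σ : Rn n) ∈ starSet R ↔ r < R σ := by
  have : ‖(σ : Rn n)‖ = 1 := by simp
  rw [starSet, mem_ofPred_eq, norm_smul, this, mul_one, Real.norm_eq_abs, abs_of_pos hr, hR0 r hr]

theorem lintegral_starSet {m : ℕ} {R : Rn (m + 2) → ℝ} (hR : Measurable R)
    (hR0 : ∀ r : ℝ, 0 < r → ∀ x, R (r • x) = R x) {f : Rn (m + 2) → ℝ≥0∞} (hf : Measurable f) :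
    ∫⁻ x in starSet R, f x = ∫⁻ σ : Sph (m + 2), (∫⁻ r in Ioi 0, (Iio (R σ)).indicator
      (fun r => ENNReal.ofReal (r ^ (m + 1)) * f (r • (σ : Rn (m + 2)))) r) ∂(surf (m + 2)) := by
  rw [← lintegral_indicator (measurableSet_starSet hR),
    lintegral_polar (k := m + 1) _ (hf.indicator (measurableSet_starSet hR))]
  refine lintegral_congr fun σ => setLIntegral_congr_fun measurableSet_Ioi fun r hr => ?_
  by_cases hrR : r ∈ Iio (R σ)
  · rw [indicator_of_mem ((smul_mem_starSet hR0 σ hr).2 hrR), indicator_of_mem hrR]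
  · rw [indicator_of_notMem (fun h => hrR ((smul_mem_starSet hR0 σ hr).1 h)),
      indicator_of_notMem hrR, mul_zero]

theorem lintegral_compl_starSet {m : ℕ} {R : Rn (m + 2) → ℝ} (hR : Measurable R)
    (hR0 : ∀ r : ℝ, 0 < r → ∀ x, R (r • x) = R x) {f : Rn (m + 2) → ℝ≥0∞} (hf : Measurable f) :
    ∫⁻ x in (starSet R)ᶜ, f x = ∫⁻ σ : Sph (m + 2), (∫⁻ r in Ioi 0, (Ici (R σ)).indicator
      (fun r => ENNReal.ofReal (r ^ (m + 1)) * f (r • (σ : Rn (m + 2)))) r) ∂(surf (m + 2)) := by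
  rw [← lintegral_indicator (measurableSet_starSet hR).compl,
    lintegral_polar (k := m + 1) _ (hf.indicator (measurableSet_starSet hR).compl)]
  refine lintegral_congr fun σ => setLIntegral_congr_fun measurableSet_Ioi fun r hr => ?_
  by_cases hrR : r ∈ Ici (R σ)
  · rw [indicator_of_mem (show _ ∈ (starSet R)ᶜ from
      fun h => not_lt.2 hrR ((smul_mem_starSet hR0 σ hr).1 h)), indicator_of_mem hrR]
  · rw [indicator_of_notMem (notMem_compl_iff.2 ((smul_mem_starSet hR0 σ hr).2 (not_le.1 hrR))),
      indicator_of_notMem hrR, mul_zero]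

theorem measurable_polarKernel_tail {m : ℕ} {h : ℝ → ℝ≥0∞} (hh : Measurable h)
    {R : Sph (m + 2) → ℝ} (hR : Measurable R) (x : Rn (m + 2)) :
    Measurable fun q : ℝ × Sph (m + 2) => ∫⁻ ρ in Ioi 0,
        (Ici (R q.2)).indicator (fun ρ => polarKernel m h x q.2 q.1 ρ) ρ := by
  refine Measurable.lintegral_prod_right' (f := fun q : (ℝ × Sph (m + 2)) × ℝ =>
    (Ici (R q.1.2)).indicator (fun ρ => polarKernel m h x q.1.2 q.1.1 ρ) q.2) ?_
  have : (fun q : (ℝ × Sph (m + 2)) × ℝ =>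
      (Ici (R q.1.2)).indicator (fun ρ => polarKernel m h x q.1.2 q.1.1 ρ) q.2) =
      {q : (ℝ × Sph (m + 2)) × ℝ | R q.1.2 ≤ q.2}.indicator
        (fun q => polarKernel m h x q.1.2 q.1.1 q.2) := by
    ext q
    rfl
  rw [this]
  exact (measurable_polarKernel hh measurable_const (by fun_prop) (by fun_prop)
    (by fun_prop)).indicator (measurableSet_le (by fun_prop) measurable_snd)

theorem lintegral_compl_starSet_polar {m : ℕ} {h : ℝ → ℝ≥0∞} (hh : Measurable h)
    {R : Rn (m + 2) → ℝ} (hR : Measurable R) (hR0 : ∀ r : ℝ, 0 < r → ∀ x, R (r • x) = R x)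
    (x : Rn (m + 2)) {r : ℝ} (hr : 0 < r) :
    ENNReal.ofReal (r ^ (m + 1)) * ∫⁻ y in (starSet R)ᶜ, h ‖r • x - y‖ =
      ∫⁻ y : Sph (m + 2), (∫⁻ ρ in Ioi 0, (Ici (R y)).indicator
        (fun ρ => polarKernel m h x y r ρ) ρ) ∂(surf (m + 2)) := by
  rw [lintegral_compl_starSet hR hR0 (f := fun y => h ‖r • x - y‖) (by fun_prop),
    ← lintegral_const_mul' _ _ ENNReal.ofReal_ne_top]
  refine lintegral_congr fun y => ?_
  rw [← lintegral_const_mul' _ _ ENNReal.ofReal_ne_top]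
  refine setLIntegral_congr_fun measurableSet_Ioi fun ρ hρ => ?_
  have hρ0 : (0 : ℝ) < ρ := hρ
  by_cases hρR : ρ ∈ Ici (R y)
  · simp only [indicator_of_mem hρR]
    rw [polarKernel, ← mul_assoc, ← ENNReal.ofReal_mul (by positivity), mul_pow]
  · simp [indicator_of_notMem hρR]

theorem lintegral_indicator_swap {X : Type*} [MeasurableSpace X] {μ : Measure X} [SFinite μ]
    {ν : Measure ℝ} [SFinite ν] {F : ℝ → X → ℝ≥0∞} (hF : Measurable (Function.uncurry F))
    {S : Set ℝ} (hS : MeasurableSet S) :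
    ∫⁻ r, S.indicator (fun r => ∫⁻ y, F r y ∂μ) r ∂ν =
      ∫⁻ y, (∫⁻ r, S.indicator (fun r => F r y) r ∂ν) ∂μ := by
  have h2 : ∀ r, S.indicator (fun r => ∫⁻ y, F r y ∂μ) r =
      ∫⁻ y, S.indicator (fun r => F r y) r ∂μ := fun r => by
    by_cases hr : r ∈ S
    · simp [indicator_of_mem hr]
    · simp [indicator_of_notMem hr]
  simp only [h2]
  have h3 : Measurable (Function.uncurry fun (r : ℝ) (y : X) => S.indicator (fun r => F r y) r) :=
    Measurable.indicator hF (hS.preimage (measurable_fst (α := ℝ) (β := X)))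
  exact lintegral_lintegral_swap h3.aemeasurable

/-- Polar coordinates in both points, with the angular and radial integrals exchanged: for given
directions the condition is that one radius is below the graph and the other is not. -/
theorem radialPer_starSet {m : ℕ} {h : ℝ → ℝ≥0∞} (hh : Measurable h) {R : Rn (m + 2) → ℝ}
    (hR : Measurable R) (hR0 : ∀ r : ℝ, 0 < r → ∀ x, R (r • x) = R x) :
    radialPer h (starSet R) = 2 * ∫⁻ x : Sph (m + 2), ∫⁻ y : Sph (m + 2),
      polarMeas m h x y (Iio (R x) ×ˢ Ici (R y)) ∂(surf (m + 2)) ∂(surf (m + 2)) := by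
  have hRσ : Measurable fun σ : Sph (m + 2) => R σ := hR.comp measurable_subtype_coe
  rw [radialPer]
  congr 1
  have hm : Measurable fun x : Rn (m + 2) => ∫⁻ y in (starSet R)ᶜ, h ‖x - y‖ :=
    Measurable.lintegral_prod_right' (f := fun q : Rn (m + 2) × Rn (m + 2) => h ‖q.1 - q.2‖)
      (by fun_prop)
  rw [lintegral_starSet hR hR0 hm]
  refine lintegral_congr fun x => ?_
  have h0 := lintegral_indicator_swap (μ := surf (m + 2)) (ν := volume.restrict (Ioi (0 : ℝ)))
    (F := fun r y => ∫⁻ ρ in Ioi 0, (Ici (R y)).indicator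
      (fun ρ => polarKernel m h (x : Rn (m + 2)) y r ρ) ρ)
    (measurable_polarKernel_tail hh hRσ (x : Rn (m + 2))) (measurableSet_Iio (a := R x))
  have h1 : ∀ y : Sph (m + 2), polarMeas m h x y (Iio (R x) ×ˢ Ici (R y)) =
      ∫⁻ r in Ioi 0, (Iio (R x)).indicator (fun r => ∫⁻ ρ in Ioi 0,
        (Ici (R y)).indicator (fun ρ => polarKernel m h x y r ρ) ρ) r := fun y =>
    polarMeas_prod hh _ _ measurableSet_Iio measurableSet_Ici
  simp only [h1]
  refine Eq.trans ?_ h0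
  refine setLIntegral_congr_fun measurableSet_Ioi fun r hr => ?_
  by_cases hrR : r ∈ Iio (R x)
  · rw [indicator_of_mem hrR, indicator_of_mem hrR]
    exact lintegral_compl_starSet_polar hh hR hR0 _ hr
  · rw [indicator_of_notMem hrR, indicator_of_notMem hrR]

theorem starSet_const {n : ℕ} (a : ℝ) : starSet (fun _ : Rn n => a) = Metric.ball 0 a := by
  ext x
  simp [starSet]

/-- A rotation carrying one base direction to another preserves the interaction. Hence the
equal-radius term, for a fixed radius, is the perimeter of a ball up to a constant. -/
theorem lintegral_polarMeas_rot {m : ℕ} {h : ℝ → ℝ≥0∞} (hh : Measurable h) {S : Set (ℝ × ℝ)}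
    (hS : MeasurableSet S) (x x' : Sph (m + 2)) :
    ∫⁻ y : Sph (m + 2), polarMeas m h x y S ∂(surf (m + 2)) =
      ∫⁻ y : Sph (m + 2), polarMeas m h x' y S ∂(surf (m + 2)) := by
  have key : ∀ x : Sph (m + 2), ∫⁻ y : Sph (m + 2), polarMeas m h x y S ∂(surf (m + 2)) =
      ∫⁻ y : Sph (m + 2), polarMeas m h (e0 (m + 1)) y S ∂(surf (m + 2)) := fun x => by
    obtain ⟨A, hA⟩ := exists_rot_single (m := m) (x := (x : Rn (m + 2))) (by simp)
    rw [← lintegral_surf_rot A (f := fun y => polarMeas m h x y S)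
      (measurable_polarMeas hh measurable_const measurable_id (hS.preimage measurable_snd)), ← hA]
    simp only [polarMeas_rot]
  rw [key x, key x']

/-- Twice a double integral is the integral of the symmetrized integrand, so a pointwise identity
between symmetrized functions is enough; nothing is subtracted. -/
theorem two_mul_lintegral_lintegral_exchange {X : Type*} [MeasurableSpace X] {μ : Measure X}
    [SFinite μ] {a c j : X → X → ℝ≥0∞} (ha : Measurable (Function.uncurry a))
    (hc : Measurable (Function.uncurry c))
    (h : ∀ x y, a x y + a y x = c x y + c y x + j x y) :
    2 * ∫⁻ x, ∫⁻ y, a x y ∂μ ∂μ = 2 * (∫⁻ x, ∫⁻ y, c x y ∂μ ∂μ) + ∫⁻ x, ∫⁻ y, j x y ∂μ ∂μ := by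
  have key : ∀ f : X → X → ℝ≥0∞, Measurable (Function.uncurry f) →
      2 * ∫⁻ x, ∫⁻ y, f x y ∂μ ∂μ = ∫⁻ x, ∫⁻ y, (f x y + f y x) ∂μ ∂μ := fun f hf => by
    have h1 : ∀ x, ∫⁻ y, (f x y + f y x) ∂μ = ∫⁻ y, f x y ∂μ + ∫⁻ y, f y x ∂μ := fun x =>
      lintegral_add_left (measurable_uncurry_left hf x) _
    have hfm : Measurable fun x => ∫⁻ y, f x y ∂μ := hf.lintegral_prod_right'
    simp only [h1]
    rw [lintegral_add_left hfm, two_mul]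
    congr 1
    exact lintegral_lintegral_swap hf.aemeasurable
  have hs : ∀ f : X → X → ℝ≥0∞, Measurable (Function.uncurry f) →
      Measurable (Function.uncurry fun x y => f x y + f y x) := fun f hf =>
    hf.add (hf.comp measurable_swap)
  have hcm : Measurable fun x => ∫⁻ y, (c x y + c y x) ∂μ := (hs c hc).lintegral_prod_right'
  rw [key a ha, key c hc, ← lintegral_add_left hcm]
  refine lintegral_congr fun x => ?_
  refine Eq.trans ?_ (lintegral_add_left (measurable_uncurry_left (hs c hc) x) _)
  exact lintegral_congr fun y => h x y

/-- The perimeter of a star-shaped set as an average of perimeters of balls and an interaction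
term that is quadratic in the oscillation of the radius. -/
theorem sphArea_mul_radialPer_starSet {m : ℕ} {h : ℝ → ℝ≥0∞} (hh : Measurable h)
    {R : Rn (m + 2) → ℝ} (hR : Measurable R) (hR0 : ∀ r : ℝ, 0 < r → ∀ x, R (r • x) = R x) :
    sphArea (m + 1) * radialPer h (starSet R) =
      (∫⁻ x : Sph (m + 2), radialPer h (Metric.ball (0 : Rn (m + 2)) (R x)) ∂(surf (m + 2))) +
      sphArea (m + 1) * ∫⁻ x : Sph (m + 2), ∫⁻ y : Sph (m + 2), polarMeas m h x y
        (Ico (min (R x) (R y)) (max (R x) (R y)) ×ˢ Ico (min (R x) (R y)) (max (R x) (R y)))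
        ∂(surf (m + 2)) ∂(surf (m + 2)) := by
  have hRσ : Measurable fun σ : Sph (m + 2) => R σ := hR.comp measurable_subtype_coe
  set J := ∫⁻ x : Sph (m + 2), ∫⁻ y : Sph (m + 2), polarMeas m h x y
        (Ico (min (R x) (R y)) (max (R x) (R y)) ×ˢ Ico (min (R x) (R y)) (max (R x) (R y)))
        ∂(surf (m + 2)) ∂(surf (m + 2)) with hJ
  have hm1 : Measurable fun q : Sph (m + 2) × Sph (m + 2) =>
      polarMeas m h q.1 q.2 (Iio (R q.1) ×ˢ Ici (R q.2)) := by
    refine measurable_polarMeas hh (by fun_prop) (by fun_prop) ?_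
    exact (measurableSet_lt (by fun_prop) (by fun_prop)).inter
      (measurableSet_le (by fun_prop) (by fun_prop))
  have hm2 : Measurable fun q : Sph (m + 2) × Sph (m + 2) =>
      polarMeas m h q.1 q.2 (Iio (R q.1) ×ˢ Ici (R q.1)) := by
    refine measurable_polarMeas hh (by fun_prop) (by fun_prop) ?_
    exact (measurableSet_lt (by fun_prop) (by fun_prop)).inter
      (measurableSet_le (by fun_prop) (by fun_prop))
  have hcomm : ∀ x y : Sph (m + 2), polarMeas m h x y = polarMeas m h y x := fun x y =>
    polarMeas_comm h (by simp) (by simp)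
  have h1 : radialPer h (starSet R) = 2 * (∫⁻ x : Sph (m + 2), ∫⁻ y : Sph (m + 2),
      polarMeas m h x y (Iio (R x) ×ˢ Ici (R x)) ∂(surf (m + 2)) ∂(surf (m + 2))) + J := by
    rw [radialPer_starSet hh hR hR0]
    refine two_mul_lintegral_lintegral_exchange hm1 hm2 fun x y => ?_
    rw [hcomm y x]
    exact measure_prod_exchange _ _ _
  -- For a constant radius the outer integrand is constant, and the outer integral produces the
  -- factor `sphArea (m + 1)`.
  have h2 : ∀ x : Sph (m + 2), radialPer h (Metric.ball (0 : Rn (m + 2)) (R x)) =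
      sphArea (m + 1) * (2 * ∫⁻ y : Sph (m + 2),
        polarMeas m h x y (Iio (R x) ×ˢ Ici (R x)) ∂(surf (m + 2))) := fun x => by
    rw [← starSet_const, radialPer_starSet hh measurable_const fun _ _ _ => rfl]
    simp only [lintegral_polarMeas_rot hh (measurableSet_Iio.prod measurableSet_Ici) _ x,
      lintegral_const]
    rw [sphArea]
    ring
  rw [h1, mul_add]
  congr 1
  simp only [h2]
  rw [lintegral_const_mul' _ _ (sphArea_ne_top _), lintegral_const_mul' _ _ (by norm_num)]

/-! ### The interaction term -/

theorem lintegral_Ico_min_max (a b : ℝ) (f : ℝ → ℝ≥0∞) :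
    ∫⁻ r in Ico (min a b) (max a b), f r =
      ENNReal.ofReal |a - b| * ∫⁻ α in Ioo (0 : ℝ) 1, f (α * a + (1 - α) * b) := by
  rcases eq_or_ne a b with rfl | hab
  · simp
  have h1 : (fun α => α * a + (1 - α) * b) '' Ioo (0 : ℝ) 1 = Ioo (min a b) (max a b) := by
    rw [min_comm, max_comm, ← openSegment_eq_Ioo' hab.symm, openSegment_eq_image]
    refine image_congr fun α _ => ?_
    simp only [smul_eq_mul]
    ring
  have hd : ∀ α ∈ Ioo (0 : ℝ) 1, HasDerivWithinAt (fun α => α * a + (1 - α) * b) (a - b)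
      (Ioo (0 : ℝ) 1) α := fun α _ => by
    have h := ((hasDerivAt_id α).mul_const a).add (((hasDerivAt_id α).const_sub 1).mul_const b)
    refine (h.congr_deriv ?_).hasDerivWithinAt
    ring
  have hinj : InjOn (fun α => α * a + (1 - α) * b) (Ioo (0 : ℝ) 1) := fun x _ y _ hxy => by
    simp only at hxy
    have : (x - y) * (a - b) = 0 := by linarith
    exact sub_eq_zero.1 ((mul_eq_zero.1 this).resolve_right (sub_ne_zero.2 hab))
  rw [← Measure.restrict_congr_set Ioo_ae_eq_Ico, ← h1,
    lintegral_image_eq_lintegral_abs_deriv_mul measurableSet_Ioo hd hinj,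
    lintegral_const_mul' _ _ ENNReal.ofReal_ne_top]

/-- Both radii are parametrized as convex combinations of `a` and `b`; each substitution contributes
a factor `|a - b|`. -/
theorem polarMeas_square {m : ℕ} {h : ℝ → ℝ≥0∞} (hh : Measurable h) (x y : Rn (m + 2)) {a b : ℝ}
    (ha : 0 < a) (hb : 0 < b) :
    polarMeas m h x y (Ico (min a b) (max a b) ×ˢ Ico (min a b) (max a b)) =
      ENNReal.ofReal ((a - b) ^ 2) * ∫⁻ α in Ioo (0 : ℝ) 1, ∫⁻ β in Ioo (0 : ℝ) 1,
        polarKernel m h x y (α * a + (1 - α) * b) (β * a + (1 - β) * b) := by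
  have hsub : Ico (min a b) (max a b) ⊆ Ioi 0 := fun r hr => (lt_min ha hb).trans_le hr.1
  rw [polarMeas_prod hh x y measurableSet_Ico measurableSet_Ico,
    setLIntegral_indicator measurableSet_Ico, inter_eq_left.2 hsub, lintegral_Ico_min_max]
  simp only [setLIntegral_indicator measurableSet_Ico, inter_eq_left.2 hsub, lintegral_Ico_min_max]
  rw [lintegral_const_mul' _ _ ENNReal.ofReal_ne_top, ← mul_assoc,
    ← ENNReal.ofReal_mul (abs_nonneg _), ← pow_two, sq_abs]

/-- The radius `1 + t u` of a nearly spherical set. -/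
def graphRadius {n : ℕ} (t : ℝ) (u : Sph n → ℝ) (x : Rn n) : ℝ := 1 + t * homExt u x

theorem graphRadius_coe {n : ℕ} (t : ℝ) (u : Sph n → ℝ) (σ : Sph n) :
    graphRadius t u σ = 1 + t * u σ := by rw [graphRadius, homExt_coe]

theorem graphRadius_smul {n : ℕ} (t : ℝ) (u : Sph n → ℝ) {r : ℝ} (hr : 0 < r) (x : Rn n) :
    graphRadius t u (r • x) = graphRadius t u x := by
  rw [graphRadius, graphRadius, homExt_smul u hr]

theorem measurable_graphRadius {n : ℕ} (t : ℝ) {u : Sph n → ℝ} {L : ℝ≥0} (hu : LipschitzWith L u) :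
    Measurable (graphRadius t u) :=
  ((measurable_homExt hu).const_mul t).const_add 1

/-- By Tonelli the parameters `(α, β)` are integrated last. For fixed parameters the hypothesis
applies, and the parameters range over a square of measure one. -/
theorem lintegral_polarMeas_graph_le {m : ℕ} {h : ℝ → ℝ≥0∞} (hh : Measurable h)
    {u : Sph (m + 2) → ℝ} {L : ℝ≥0} (hL : LipschitzWith L u) {t : ℝ} (ht1 : t < 1)
    (hu : ∀ σ, |t * u σ| ≤ t) {Λ : ℝ≥0∞}
    (hΛ : ∀ α ∈ Icc (0 : ℝ) 1, ∀ β ∈ Icc (0 : ℝ) 1,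
      2 * ∫⁻ x : Sph (m + 2), ∫⁻ y : Sph (m + 2), ENNReal.ofReal ((u x - u y) ^ 2) *
        polarKernel m h x y (midHeight (homExt u) t α x y)
          (midHeight (homExt u) t β x y) ∂(surf (m + 2)) ∂(surf (m + 2)) ≤ Λ) :
    2 * ∫⁻ x : Sph (m + 2), ∫⁻ y : Sph (m + 2), polarMeas m h x y
      (Ico (min (graphRadius t u x) (graphRadius t u y))
        (max (graphRadius t u x) (graphRadius t u y)) ×ˢ
      Ico (min (graphRadius t u x) (graphRadius t u y))
        (max (graphRadius t u x) (graphRadius t u y))) ∂(surf (m + 2)) ∂(surf (m + 2)) ≤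
      ENNReal.ofReal (t ^ 2) * Λ := by
  have hU : Measurable (homExt u) := measurable_homExt hL
  have hum : Measurable u := hL.continuous.measurable
  have hpos : ∀ σ : Sph (m + 2), 0 < graphRadius t u σ := fun σ => by
    rw [graphRadius_coe]
    have := (abs_le.1 (hu σ)).1
    linarith
  set F : (Sph (m + 2) × Sph (m + 2)) × (ℝ × ℝ) → ℝ≥0∞ := fun q =>
    ENNReal.ofReal ((u q.1.1 - u q.1.2) ^ 2) * polarKernel m h q.1.1 q.1.2
      (midHeight (homExt u) t q.2.1 q.1.1 q.1.2) (midHeight (homExt u) t q.2.2 q.1.1 q.1.2) with hF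
  have hFm : Measurable F := by
    have h1 : Measurable fun q : (Sph (m + 2) × Sph (m + 2)) × (ℝ × ℝ) => (q.1.1 : Rn (m + 2)) := by
      fun_prop
    have h2 : Measurable fun q : (Sph (m + 2) × Sph (m + 2)) × (ℝ × ℝ) => (q.1.2 : Rn (m + 2)) := by
      fun_prop
    refine Measurable.mul (by fun_prop) (measurable_polarKernel hh h1 h2
      (measurable_midHeight hU t (by fun_prop) h1 h2) (measurable_midHeight hU t (by fun_prop) h1 h2))
  set ν : Measure (ℝ × ℝ) := (volume.restrict (Ioo (0 : ℝ) 1)).prod (volume.restrict (Ioo (0 : ℝ) 1))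
    with hν
  have h1 : ∀ x y : Sph (m + 2), polarMeas m h x y
      (Ico (min (graphRadius t u x) (graphRadius t u y))
        (max (graphRadius t u x) (graphRadius t u y)) ×ˢ
      Ico (min (graphRadius t u x) (graphRadius t u y))
        (max (graphRadius t u x) (graphRadius t u y))) =
      ENNReal.ofReal (t ^ 2) * ∫⁻ p, F ((x, y), p) ∂ν := fun x y => by
    have hKm : Measurable fun p : ℝ × ℝ => polarKernel m h x y
        (midHeight (homExt u) t p.1 x y) (midHeight (homExt u) t p.2 x y) :=
      measurable_polarKernel hh measurable_const measurable_const
        (measurable_midHeight hU t measurable_fst measurable_const measurable_const)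
        (measurable_midHeight hU t measurable_snd measurable_const measurable_const)
    have e1 : ∀ α : ℝ, α * graphRadius t u x + (1 - α) * graphRadius t u y =
        midHeight (homExt u) t α x y := fun α => by
      rw [graphRadius, graphRadius, midHeight]
      ring
    have e2 : (graphRadius t u x - graphRadius t u y) ^ 2 = t ^ 2 * (u x - u y) ^ 2 := by
      rw [graphRadius_coe, graphRadius_coe]
      ring
    rw [polarMeas_square hh _ _ (hpos x) (hpos y), e2, ENNReal.ofReal_mul (sq_nonneg t), mul_assoc]
    congr 1
    simp only [e1, hF]
    rw [lintegral_const_mul' _ _ ENNReal.ofReal_ne_top, hν, lintegral_prod _ hKm.aemeasurable]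
  simp only [h1]
  have h2 : ∀ x : Sph (m + 2), ∫⁻ y : Sph (m + 2), ENNReal.ofReal (t ^ 2) * ∫⁻ p, F ((x, y), p) ∂ν
      ∂(surf (m + 2)) = ENNReal.ofReal (t ^ 2) * ∫⁻ y : Sph (m + 2), ∫⁻ p, F ((x, y), p) ∂ν
      ∂(surf (m + 2)) := fun x => lintegral_const_mul' _ _ ENNReal.ofReal_ne_top
  simp only [h2]
  rw [lintegral_const_mul' _ _ ENNReal.ofReal_ne_top, mul_left_comm]
  refine mul_le_mul' le_rfl ?_
  have h3 : Measurable fun q : Sph (m + 2) × Sph (m + 2) => ∫⁻ p, F (q, p) ∂ν :=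
    hFm.lintegral_prod_right'
  have h4 : ∫⁻ x : Sph (m + 2), ∫⁻ y : Sph (m + 2), ∫⁻ p, F ((x, y), p) ∂ν ∂(surf (m + 2))
      ∂(surf (m + 2)) = ∫⁻ p, ∫⁻ q, F (q, p) ∂((surf (m + 2)).prod (surf (m + 2))) ∂ν := by
    rw [← lintegral_prod (fun q : Sph (m + 2) × Sph (m + 2) => ∫⁻ p, F (q, p) ∂ν) h3.aemeasurable]
    exact lintegral_lintegral_swap (f := fun q p => F (q, p)) hFm.aemeasurable
  rw [h4, ← lintegral_const_mul' _ _ (by norm_num)]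
  have h5 : ∀ᵐ p ∂ν, 2 * ∫⁻ q, F (q, p) ∂((surf (m + 2)).prod (surf (m + 2))) ≤ Λ := by
    rw [hν, Measure.prod_restrict]
    filter_upwards [ae_restrict_mem (measurableSet_Ioo.prod measurableSet_Ioo)] with p hp
    have e1 : Measurable fun q => F (q, p) := hFm.comp measurable_prodMk_right
    rw [lintegral_prod _ e1.aemeasurable]
    exact hΛ p.1 ⟨hp.1.1.le, hp.1.2.le⟩ p.2 ⟨hp.2.1.le, hp.2.2.le⟩
  refine (lintegral_mono_ae h5).trans ?_
  rw [lintegral_const, hν, ← univ_prod_univ, Measure.prod_prod]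
  simp

/-! ### Perimeter of balls -/

/-- The chord is `(-c, c)` with `c = √(R ^ 2 - q)`. A shift by `r` moves out an end piece of length
`r`, or the whole chord if `r` exceeds its length. -/
theorem volume_interval_shift {R q r : ℝ} (hr : 0 < r) :
    volume {a : ℝ | a ^ 2 + q < R ^ 2 ∧ R ^ 2 ≤ (a - r) ^ 2 + q} =
      ENNReal.ofReal (min r (2 * √(R ^ 2 - q))) := by
  rcases le_or_gt (R ^ 2 - q) 0 with h | h
  · rw [Real.sqrt_eq_zero_of_nonpos h, mul_zero, min_eq_right hr.le, ENNReal.ofReal_zero]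
    have h0 : {a : ℝ | a ^ 2 + q < R ^ 2 ∧ R ^ 2 ≤ (a - r) ^ 2 + q} = ∅ :=
      eq_empty_of_forall_notMem fun a ha => by
        have := ha.1
        nlinarith [sq_nonneg a]
    rw [h0, measure_empty]
  set c := √(R ^ 2 - q) with hc
  have hc0 : 0 < c := Real.sqrt_pos.2 h
  have hc2 : c ^ 2 = R ^ 2 - q := Real.sq_sqrt h.le
  have hset : {a : ℝ | a ^ 2 + q < R ^ 2 ∧ R ^ 2 ≤ (a - r) ^ 2 + q} = Ioo (-c) c ∩ Iic (r - c) := by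
    ext a
    have e1 : a ^ 2 + q < R ^ 2 ↔ |a| < c := by
      rw [← lt_sub_iff_add_lt, ← hc2, sq_lt_sq, abs_of_pos hc0]
    have e2 : R ^ 2 ≤ (a - r) ^ 2 + q ↔ c ≤ |a - r| := by
      rw [← sub_le_iff_le_add, ← hc2, sq_le_sq, abs_of_pos hc0]
    simp only [mem_ofPred_eq, e1, e2, abs_lt, mem_inter_iff, mem_Ioo, mem_Iic, le_abs]
    refine and_congr_right fun h1 => ⟨fun h2 => ?_, fun h2 => Or.inr (by linarith)⟩
    rcases h2 with h2 | h2 <;> linarith [h1.2]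
  rw [hset]
  rcases le_or_gt c (r - c) with h1 | h1
  · rw [inter_eq_left.2 fun a ha => (ha.2.le.trans h1), Real.volume_Ioo, min_eq_right (by linarith)]
    congr 1
    ring
  · have h2 : Ioo (-c) c ∩ Iic (r - c) = Ioc (-c) (r - c) := by
      ext a
      simp only [mem_inter_iff, mem_Ioo, mem_Iic, mem_Ioc]
      exact ⟨fun h => ⟨h.1.1, h.2⟩, fun h => ⟨⟨h.1, h.2.trans_lt h1⟩, h.2⟩⟩
    rw [h2, Real.volume_Ioc, min_eq_left (by linarith)]
    congr 1
    ring

/-- The volume of the points of a ball of radius `R` that a translation by `r` moves out. -/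
def shiftVol (m : ℕ) (R r : ℝ) : ℝ≥0∞ :=
  ∫⁻ y : Rn (m + 1), ENNReal.ofReal (min r (2 * √(R ^ 2 - ‖y‖ ^ 2)))

theorem measurable_indicator_sub {k : ℕ} {B : Set (Rn k)} (hB : MeasurableSet B) (z : Rn k) :
    Measurable fun x => B.indicator (1 : Rn k → ℝ≥0∞) (x - z) :=
  (measurable_one.indicator hB).comp (measurable_id.sub_const z)

theorem volume_ball_shift_e0 {m : ℕ} {R r : ℝ} (hR : 0 < R) (hr : 0 < r) :
    ∫⁻ x in Metric.ball (0 : Rn (m + 2)) R,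
      (Metric.ball (0 : Rn (m + 2)) R)ᶜ.indicator 1 (x - r • (e0 (m + 1) : Rn (m + 2))) =
      shiftVol m R r := by
  have hB : MeasurableSet (Metric.ball (0 : Rn (m + 2)) R) := measurableSet_ball
  rw [← lintegral_indicator hB, lintegral_slice (k := m + 1) _
    ((measurable_indicator_sub hB.compl _).indicator hB)]
  refine lintegral_congr fun y => ?_
  set T : Set ℝ := {a : ℝ | a ^ 2 + ‖y‖ ^ 2 < R ^ 2 ∧ R ^ 2 ≤ (a - r) ^ 2 + ‖y‖ ^ 2} with hT
  have hTm : MeasurableSet T :=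
    (measurableSet_lt (f := fun a : ℝ => a ^ 2 + ‖y‖ ^ 2) (g := fun _ => R ^ 2)
      (by fun_prop) (by fun_prop)).inter
    (measurableSet_le (f := fun _ : ℝ => R ^ 2) (g := fun a => (a - r) ^ 2 + ‖y‖ ^ 2)
      (by fun_prop) (by fun_prop))
  rw [← volume_interval_shift hr, ← hT, ← lintegral_indicator_one hTm]
  · refine lintegral_congr fun a => ?_
    have e1 : consPt a y ∈ Metric.ball (0 : Rn (m + 2)) R ↔ a ^ 2 + ‖y‖ ^ 2 < R ^ 2 := by
      rw [mem_ball_zero_iff, ← sq_lt_sq₀ (norm_nonneg _) hR.le, norm_consPt_sq]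
    have e2 : consPt a y - r • (e0 (m + 1) : Rn (m + 2)) ∈ (Metric.ball (0 : Rn (m + 2)) R)ᶜ ↔
        R ^ 2 ≤ (a - r) ^ 2 + ‖y‖ ^ 2 := by
      rw [mem_compl_iff, mem_ball_zero_iff, not_lt, ← sq_le_sq₀ hR.le (norm_nonneg _),
        norm_sub_sq_real, norm_consPt_sq, inner_smul_right, real_inner_comm, inner_e0_consPt,
        norm_smul, Real.norm_eq_abs, mul_pow, sq_abs]
      have : ‖(e0 (m + 1) : Rn (m + 2))‖ = 1 := by simp
      rw [this, show a ^ 2 + ‖y‖ ^ 2 - 2 * (r * a) + r ^ 2 * 1 ^ 2 = (a - r) ^ 2 + ‖y‖ ^ 2 by ring]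
    by_cases h1 : consPt a y ∈ Metric.ball (0 : Rn (m + 2)) R
    · rw [indicator_of_mem h1]
      by_cases h2 : consPt a y - r • (e0 (m + 1) : Rn (m + 2)) ∈ (Metric.ball (0 : Rn (m + 2)) R)ᶜ
      · rw [indicator_of_mem h2, indicator_of_mem (show a ∈ T from ⟨e1.1 h1, e2.1 h2⟩)]
        rfl
      · rw [indicator_of_notMem h2, indicator_of_notMem fun h => h2 (e2.2 h.2)]
    · rw [indicator_of_notMem h1, indicator_of_notMem fun h => h1 (e1.2 h.1)]

theorem measurePreserving_rot {n : ℕ} (A : Rot n) :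
    MeasurePreserving fun x => (A : Rn n →L[ℝ] Rn n) x :=
  (Unitary.linearIsometryEquiv A).measurePreserving

theorem volume_ball_shift {m : ℕ} {R : ℝ} (hR : 0 < R) {z : Rn (m + 2)} (hz : z ≠ 0) :
    ∫⁻ x in Metric.ball (0 : Rn (m + 2)) R,
      (Metric.ball (0 : Rn (m + 2)) R)ᶜ.indicator 1 (x - z) = shiftVol m R ‖z‖ := by
  have hB : MeasurableSet (Metric.ball (0 : Rn (m + 2)) R) := measurableSet_ball
  have hz0 : 0 < ‖z‖ := norm_pos_iff.2 hz
  obtain ⟨A, hA⟩ := exists_rot_single (m := m) (x := ‖z‖⁻¹ • z)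
    (by rw [norm_smul, norm_inv, norm_norm, inv_mul_cancel₀ hz0.ne'])
  have hA' : z = (A : Rn (m + 2) →L[ℝ] Rn (m + 2)) (‖z‖ • (e0 (m + 1) : Rn (m + 2))) := by
    rw [map_smul, hA, smul_inv_smul₀ hz0.ne']
  rw [← volume_ball_shift_e0 hR hz0, ← lintegral_indicator hB, ← lintegral_indicator hB,
    ← (measurePreserving_rot A).lintegral_comp
      ((measurable_indicator_sub hB.compl z).indicator hB)]
  refine lintegral_congr fun x => ?_
  have e1 : ∀ x, (A : Rn (m + 2) →L[ℝ] Rn (m + 2)) x ∈ Metric.ball (0 : Rn (m + 2)) R ↔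
      x ∈ Metric.ball (0 : Rn (m + 2)) R := fun x => by
    rw [mem_ball_zero_iff, mem_ball_zero_iff, norm_rot_apply]
  have e2 : (A : Rn (m + 2) →L[ℝ] Rn (m + 2)) x - z =
      (A : Rn (m + 2) →L[ℝ] Rn (m + 2)) (x - ‖z‖ • (e0 (m + 1) : Rn (m + 2))) := by
    rw [map_sub, ← hA']
  have e3 : (A : Rn (m + 2) →L[ℝ] Rn (m + 2)) x - z ∈ (Metric.ball (0 : Rn (m + 2)) R)ᶜ ↔
      x - ‖z‖ • (e0 (m + 1) : Rn (m + 2)) ∈ (Metric.ball (0 : Rn (m + 2)) R)ᶜ := by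
    rw [e2, mem_compl_iff, mem_compl_iff, e1]
  by_cases h1 : x ∈ Metric.ball (0 : Rn (m + 2)) R
  · rw [indicator_of_mem h1, indicator_of_mem ((e1 x).2 h1)]
    by_cases h2 : x - ‖z‖ • (e0 (m + 1) : Rn (m + 2)) ∈ (Metric.ball (0 : Rn (m + 2)) R)ᶜ
    · rw [indicator_of_mem h2, indicator_of_mem (e3.2 h2)]
      rfl
    · rw [indicator_of_notMem h2, indicator_of_notMem fun h => h2 (e3.1 h)]
  · rw [indicator_of_notMem h1, indicator_of_notMem fun h => h1 ((e1 x).1 h)]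

/-- In the variables `x` and `z = x - y`, the integral over `x` is the volume that the translation
by `z` moves out, which depends only on `‖z‖`. -/
theorem radialPer_ball {m : ℕ} {h : ℝ → ℝ≥0∞} (hh : Measurable h) {R : ℝ} (hR : 0 < R) :
    radialPer h (Metric.ball (0 : Rn (m + 2)) R) =
      2 * ∫⁻ z : Rn (m + 2), h ‖z‖ * shiftVol m R ‖z‖ := by
  set B := Metric.ball (0 : Rn (m + 2)) R with hBd
  have hB : MeasurableSet B := measurableSet_ball
  rw [radialPer]
  congr 1
  have h1 : ∀ x : Rn (m + 2), ∫⁻ y in Bᶜ, h ‖x - y‖ =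
      ∫⁻ z, h ‖z‖ * Bᶜ.indicator 1 (x - z) := fun x => by
    rw [← lintegral_indicator hB.compl, ← lintegral_sub_left_eq_self _ x]
    refine lintegral_congr fun z => ?_
    by_cases hz : x - z ∈ Bᶜ
    · rw [indicator_of_mem hz, indicator_of_mem hz, sub_sub_cancel, Pi.one_apply, mul_one]
    · rw [indicator_of_notMem hz, indicator_of_notMem hz, mul_zero]
  simp only [h1]
  rw [lintegral_lintegral_swap]
  · refine lintegral_congr_ae ?_
    filter_upwards [compl_mem_ae_iff.2 (measure_singleton (0 : Rn (m + 2)))] with z hz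
    rw [lintegral_const_mul _ (measurable_indicator_sub hB.compl z),
      volume_ball_shift hR hz]
  · refine Measurable.aemeasurable (Measurable.mul (by fun_prop) ?_)
    exact (measurable_one.indicator hB.compl).comp
      (by fun_prop : Measurable fun p : Rn (m + 2) × Rn (m + 2) => p.1 - p.2)

theorem lintegral_comp_smul_pos {k : ℕ} {R : ℝ} (hR : 0 < R) {f : Rn k → ℝ≥0∞}
    (hf : Measurable f) : ∫⁻ y, f y = ENNReal.ofReal (R ^ k) * ∫⁻ y, f (R • y) := by
  have h1 : ∫⁻ y, f (R • y) = ENNReal.ofReal (R ^ k)⁻¹ * ∫⁻ y, f y := by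
    rw [← lintegral_map hf (by fun_prop), Measure.map_addHaar_smul _ hR.ne', lintegral_smul_measure,
      finrank_euclideanSpace_fin, abs_of_pos (by positivity), smul_eq_mul]
  rw [h1, ← mul_assoc, ← ENNReal.ofReal_mul (by positivity), mul_inv_cancel₀ (by positivity),
    ENNReal.ofReal_one, one_mul]

/-- The volume of the points of the unit ball of the hyperplane over which the unit ball has
thickness larger than `r`. -/
def capVol (m : ℕ) (r : ℝ) : ℝ≥0∞ :=
  ENNReal.ofReal (√(1 - r ^ 2 / 4) ^ (m + 1)) * volume (Metric.ball (0 : Rn (m + 1)) 1)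

theorem thickness_gt_iff {k : ℕ} {r : ℝ} (hr : 0 < r) (y : Rn k) :
    r < 2 * √(1 ^ 2 - ‖y‖ ^ 2) ↔ y ∈ Metric.ball (0 : Rn k) √(1 - r ^ 2 / 4) := by
  rw [mem_ball_zero_iff, Real.lt_sqrt (norm_nonneg _), ← div_lt_iff₀' (by norm_num),
    Real.lt_sqrt (by positivity)]
  constructor <;> intro h <;> nlinarith

theorem capVol_eq {m : ℕ} {r : ℝ} : capVol m r =
    volume (Metric.ball (0 : Rn (m + 1)) √(1 - r ^ 2 / 4)) := by
  rw [Measure.addHaar_ball _ _ (Real.sqrt_nonneg _), finrank_euclideanSpace_fin, capVol]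

theorem measurable_capVol (m : ℕ) : Measurable (capVol m) := by
  unfold capVol
  fun_prop

theorem capVol_le (m : ℕ) (r : ℝ) : capVol m r ≤ volume (Metric.ball (0 : Rn (m + 1)) 1) := by
  rw [capVol_eq]
  refine measure_mono (Metric.ball_subset_ball ?_)
  rw [Real.sqrt_le_one]
  nlinarith [sq_nonneg r]

theorem tendsto_capVol (m : ℕ) (r : ℝ) : Tendsto (fun ε : ℝ => capVol m (ε * r)) (𝓝[>] 0)
    (𝓝 (volume (Metric.ball (0 : Rn (m + 1)) 1))) := by
  have h1 : Tendsto (fun ε : ℝ => √(1 - (ε * r) ^ 2 / 4) ^ (m + 1)) (𝓝 0)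
      (𝓝 (√(1 - (0 * r) ^ 2 / 4) ^ (m + 1))) := by
    have : Continuous fun ε : ℝ => √(1 - (ε * r) ^ 2 / 4) ^ (m + 1) := by fun_prop
    exact this.tendsto 0
  have h2 := ENNReal.Tendsto.mul_const (ENNReal.tendsto_ofReal (h1.mono_left (nhdsWithin_le_nhds (s := Ioi 0))))
    (Or.inr (measure_ball_lt_top (μ := volume) (x := (0 : Rn (m + 1))) (r := 1)).ne)
  simpa [capVol] using h2

theorem shiftVol_scale {m : ℕ} {R r : ℝ} (hR : 0 < R) : shiftVol m R r =
    ENNReal.ofReal (R ^ (m + 1)) *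
      ∫⁻ y : Rn (m + 1), ENNReal.ofReal (min r (R * (2 * √(1 ^ 2 - ‖y‖ ^ 2)))) := by
  rw [shiftVol, lintegral_comp_smul_pos hR (by fun_prop)]
  congr 1
  refine lintegral_congr fun y => ?_
  rw [norm_smul, Real.norm_eq_abs, abs_of_pos hR,
    show R ^ 2 - (R * ‖y‖) ^ 2 = R ^ 2 * (1 ^ 2 - ‖y‖ ^ 2) by ring, Real.sqrt_mul (sq_nonneg R),
    Real.sqrt_sq hR.le]
  congr 2
  ring

/-- Concavity of the volume moved out by a translation, as a function of the translation. -/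
theorem shiftVol_add_le {m : ℕ} {R r : ℝ} (hR : 0 < R) (hr : 0 < r) :
    shiftVol m R r + ENNReal.ofReal (R ^ (m + 2)) * (ENNReal.ofReal r * capVol m r) ≤
      ENNReal.ofReal (R ^ (m + 2)) * shiftVol m 1 r +
        ENNReal.ofReal (R ^ (m + 1)) * (ENNReal.ofReal r * capVol m r) := by
  set S := Metric.ball (0 : Rn (m + 1)) √(1 - r ^ 2 / 4) with hS
  have hSm : MeasurableSet S := measurableSet_ball
  have hcap : capVol m r = ∫⁻ y, S.indicator 1 y := by
    rw [lintegral_indicator_one hSm, capVol_eq]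
  have hp : (R ^ (m + 2) : ℝ) = R ^ (m + 1) * R := pow_succ _ _
  rw [shiftVol_scale hR, hp, ENNReal.ofReal_mul (by positivity), mul_assoc, mul_assoc, ← mul_add,
    ← mul_add]
  refine mul_le_mul' le_rfl ?_
  rw [hcap, ← lintegral_const_mul _ (measurable_one.indicator hSm),
    ← lintegral_const_mul _ ((measurable_one.indicator hSm).const_mul _), shiftVol,
    ← lintegral_const_mul _ (by fun_prop), ← lintegral_add_left (by fun_prop),
    ← lintegral_add_left (by fun_prop)]
  refine lintegral_mono fun y => ?_
  have hl : 0 ≤ 2 * √(1 ^ 2 - ‖y‖ ^ 2) := by positivity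
  -- On each chord of length `ℓ` this is the tangent line at `R = 1` of the concave function `R ↦
  -- min r (R ℓ)`: slope zero over the cap, where `ℓ > r`, and slope `ℓ` elsewhere.
  by_cases hy : y ∈ S
  · have h1 := (thickness_gt_iff hr y).2 hy
    simp only [indicator_of_mem hy, Pi.one_apply, mul_one]
    rw [min_eq_left h1.le, ← ENNReal.ofReal_mul hR.le]
    exact (add_le_add (ENNReal.ofReal_le_ofReal (min_le_left _ _)) le_rfl).trans_eq (add_comm _ _)
  · have h1 : 2 * √(1 ^ 2 - ‖y‖ ^ 2) ≤ r := not_lt.1 fun h => hy ((thickness_gt_iff hr y).1 h)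
    simp only [indicator_of_notMem hy, mul_zero, add_zero]
    rw [min_eq_right h1, ← ENNReal.ofReal_mul hR.le]
    exact ENNReal.ofReal_le_ofReal (min_le_right _ _)

theorem shiftVol_one_le {m : ℕ} {r : ℝ} (hr : 0 < r) :
    shiftVol m 1 r ≤ ENNReal.ofReal r * volume (Metric.ball (0 : Rn (m + 1)) 1) := by
  rw [shiftVol, ← lintegral_indicator_one measurableSet_ball,
    ← lintegral_const_mul _ (measurable_one.indicator measurableSet_ball)]
  refine lintegral_mono fun y => ?_
  by_cases hy : y ∈ Metric.ball (0 : Rn (m + 1)) 1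
  · simp only [indicator_of_mem hy, Pi.one_apply, mul_one]
    exact ENNReal.ofReal_le_ofReal (min_le_left _ _)
  · simp only [indicator_of_notMem hy, mul_zero]
    rw [mem_ball_zero_iff, not_lt] at hy
    rw [Real.sqrt_eq_zero_of_nonpos (by nlinarith), mul_zero, min_eq_right hr.le,
      ENNReal.ofReal_zero]

/-- The first moment of the kernel weighted by `capVol`. -/
def capMoment (m : ℕ) (h : ℝ → ℝ≥0∞) : ℝ≥0∞ :=
  2 * ∫⁻ z : Rn (m + 2), h ‖z‖ * (ENNReal.ofReal ‖z‖ * capVol m ‖z‖)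

/-- Integration of the tangent line bound against the kernel. The slope terms stay on both sides so
that no difference of possibly infinite quantities occurs. -/
theorem radialPer_ball_add_le {m : ℕ} {h : ℝ → ℝ≥0∞} (hh : Measurable h) {R : ℝ} (hR : 0 < R) :
    radialPer h (Metric.ball (0 : Rn (m + 2)) R) + ENNReal.ofReal (R ^ (m + 2)) * capMoment m h ≤
      ENNReal.ofReal (R ^ (m + 2)) * radialPer h (Metric.ball (0 : Rn (m + 2)) 1) +
        ENNReal.ofReal (R ^ (m + 1)) * capMoment m h := by
  have hcap := measurable_capVol m
  have hsv : ∀ R, Measurable (shiftVol m R) := fun R =>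
    Measurable.lintegral_prod_right' (f := fun q : ℝ × Rn (m + 1) =>
      ENNReal.ofReal (min q.1 (2 * √(R ^ 2 - ‖q.2‖ ^ 2)))) (by fun_prop)
  have hs1 := hsv R
  have hs2 := hsv 1
  rw [radialPer_ball hh hR, radialPer_ball hh one_pos, capMoment, mul_left_comm, ← mul_add,
    mul_left_comm, mul_left_comm (ENNReal.ofReal (R ^ (m + 1))), ← mul_add]
  refine mul_le_mul' le_rfl ?_
  rw [← lintegral_const_mul' _ _ ENNReal.ofReal_ne_top,
    ← lintegral_const_mul' _ _ ENNReal.ofReal_ne_top,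
    ← lintegral_const_mul' _ _ ENNReal.ofReal_ne_top, ← lintegral_add_left (by fun_prop),
    ← lintegral_add_left (by fun_prop)]
  refine lintegral_mono_ae ?_
  filter_upwards [compl_mem_ae_iff.2 (measure_singleton (0 : Rn (m + 2)))] with z hz
  have h1 := shiftVol_add_le (m := m) hR (norm_pos_iff.2 hz)
  simp only [mul_left_comm _ (h ‖z‖), ← mul_add]
  exact mul_le_mul' le_rfl h1

theorem IsProfile.lintegral_weight {m : ℕ} {h : ℝ → ℝ≥0∞} {M : ℝ → ℝ} (hh : IsProfile m h M)
    {ε : ℝ} (hε : 0 < ε) {D : ℝ → ℝ≥0∞} (hD : Measurable D) :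
    ∫⁻ z : Rn (m + 2), scaleProfile m h ε ‖z‖ * (ENNReal.ofReal ‖z‖ * D ‖z‖) =
      sphArea (m + 1) * ∫⁻ r in Ioi 0, ENNReal.ofReal (r ^ (m + 2)) * h r * D (ε * r) := by
  have hm := hh.scale_measurable ε
  rw [← hh.scale_moment hε hD, lintegral_radial (k := m + 1)
    (fun r => scaleProfile m h ε r * (ENNReal.ofReal r * D r)) (by fun_prop)]
  congr 1
  refine setLIntegral_congr_fun measurableSet_Ioi fun r hr => ?_
  have hr0 : (0 : ℝ) < r := hr
  rw [pow_succ _ (m + 1), ENNReal.ofReal_mul (by positivity)]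
  ring

/-- The sphere of one dimension less has area `m + 1` times the volume `w` of its ball, so the
moment identity says `2 w ∫ r ^ (m + 2) h = 1`. -/
theorem IsProfile.ball_moment {m : ℕ} {h : ℝ → ℝ≥0∞} {M : ℝ → ℝ} (hh : IsProfile m h M) :
    2 * (sphArea (m + 1) * ∫⁻ r in Ioi 0, ENNReal.ofReal (r ^ (m + 2)) * h r *
      volume (Metric.ball (0 : Rn (m + 1)) 1)) = sphArea (m + 1) := by
  have h1 := hh.moment
  rw [sphArea_eq m] at h1
  have hm0 : ((m + 1 : ℕ) : ℝ≥0∞) ≠ 0 := Nat.cast_ne_zero.2 m.succ_ne_zero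
  have hm := hh.measurable
  rw [lintegral_mul_const _ (by fun_prop)]
  set I := ∫⁻ r in Ioi 0, ENNReal.ofReal (r ^ (m + 2)) * h r
  set w := volume (Metric.ball (0 : Rn (m + 1)) 1)
  have h2 : 2 * (w * I) = 1 := by
    refine (ENNReal.mul_right_inj hm0 (ENNReal.natCast_ne_top _)).1 ?_
    rw [mul_one]
    refine Eq.trans ?_ h1
    ring
  calc 2 * (sphArea (m + 1) * (I * w)) = sphArea (m + 1) * (2 * (w * I)) := by ring
    _ = _ := by rw [h2, mul_one]

/-- A translation by `z` moves out at most `‖z‖` times the volume of the equatorial ball. The bound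
is uniform in `ε` and supplies all finiteness statements. -/
theorem IsProfile.radialPer_ball_one_le {m : ℕ} {h : ℝ → ℝ≥0∞} {M : ℝ → ℝ} (hh : IsProfile m h M)
    {ε : ℝ} (hε : 0 < ε) :
    radialPer (scaleProfile m h ε) (Metric.ball (0 : Rn (m + 2)) 1) ≤ sphArea (m + 1) := by
  rw [radialPer_ball (hh.scale_measurable ε) one_pos, ← hh.ball_moment,
    ← hh.lintegral_weight hε (D := fun _ => volume (Metric.ball (0 : Rn (m + 1)) 1))
      measurable_const]
  refine mul_le_mul' le_rfl (lintegral_mono_ae ?_)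
  filter_upwards [compl_mem_ae_iff.2 (measure_singleton (0 : Rn (m + 2)))] with z hz
  exact mul_le_mul' le_rfl (shiftVol_one_le (norm_pos_iff.2 hz))

theorem IsProfile.capMoment_le {m : ℕ} {h : ℝ → ℝ≥0∞} {M : ℝ → ℝ} (hh : IsProfile m h M)
    {ε : ℝ} (hε : 0 < ε) : capMoment m (scaleProfile m h ε) ≤ sphArea (m + 1) := by
  rw [← hh.ball_moment, capMoment, hh.lintegral_weight hε (measurable_capVol m)]
  gcongr
  exact capVol_le _ _

/-- Dominated convergence: after rescaling, the cap is evaluated at `ε r`, where it fills the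
equatorial ball in the limit. -/
theorem IsProfile.tendsto_capMoment {m : ℕ} {h : ℝ → ℝ≥0∞} {M : ℝ → ℝ} (hh : IsProfile m h M) :
    Tendsto (fun ε => capMoment m (scaleProfile m h ε)) (𝓝[>] 0) (𝓝 (sphArea (m + 1))) := by
  have hm := hh.measurable
  have hcap := measurable_capVol m
  have hI : ∫⁻ r in Ioi 0, ENNReal.ofReal (r ^ (m + 2)) * h r *
      volume (Metric.ball (0 : Rn (m + 1)) 1) ≠ ⊤ := fun htop => by
    have := hh.ball_moment
    rw [htop, ENNReal.mul_top (sphArea_ne_zero _), ENNReal.mul_top (by norm_num)] at this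
    exact sphArea_ne_top _ this.symm
  have h1 : Tendsto (fun ε => ∫⁻ r in Ioi 0, ENNReal.ofReal (r ^ (m + 2)) * h r * capVol m (ε * r))
      (𝓝[>] 0) (𝓝 (∫⁻ r in Ioi 0, ENNReal.ofReal (r ^ (m + 2)) * h r *
        volume (Metric.ball (0 : Rn (m + 1)) 1))) := by
    refine tendsto_lintegral_filter_of_dominated_convergence _ (Eventually.of_forall fun ε => by
      fun_prop) (Eventually.of_forall fun ε => ae_of_all _ fun r => ?_) hI ?_
    · exact mul_le_mul' le_rfl (capVol_le _ _)
    · filter_upwards [ae_restrict_mem measurableSet_Ioi] with r hr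
      refine ENNReal.Tendsto.const_mul (tendsto_capVol m r) (Or.inr ?_)
      exact ENNReal.mul_ne_top ENNReal.ofReal_ne_top
        ((hh.le r hr).trans_lt ENNReal.ofReal_lt_top).ne
  have h2 := ENNReal.Tendsto.const_mul (a := 2) (ENNReal.Tendsto.const_mul
    (a := sphArea (m + 1)) h1 (Or.inr (sphArea_ne_top _))) (Or.inr (by norm_num))
  rw [hh.ball_moment] at h2
  refine h2.congr' ?_
  filter_upwards [self_mem_nhdsWithin] with ε hε
  rw [capMoment, hh.lintegral_weight hε hcap]

/-! ### Nearly spherical sets as star-shaped sets -/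

theorem IsCenteredNearlySpherical.ae_norm_tanGrad_le {n : ℕ} {t : ℝ} {E : Set (Rn n)}
    {u : Sph n → ℝ} (hE : IsCenteredNearlySpherical t E u) :
    ∀ᵐ σ ∂(surf n), ‖tanGrad u σ‖ ≤ 1 := by
  have h1 : eLpNorm (tanGrad u) ⊤ (surf n) ≤ 1 := le_trans le_add_self hE.norm_le
  rw [eLpNorm_exponent_top] at h1
  filter_upwards [enorm_ae_le_eLpNormEssSup (tanGrad u) (surf n)] with σ hσ
  have h2 := hσ.trans h1
  rwa [← ofReal_norm, ENNReal.ofReal_le_one] at h2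

/-- The essential bound holds everywhere because `u` is continuous and the surface measure charges
nonempty open sets. -/
theorem IsCenteredNearlySpherical.abs_le_one {n : ℕ} {t : ℝ} {E : Set (Rn n)}
    {u : Sph n → ℝ} (hE : IsCenteredNearlySpherical t E u) (σ : Sph n) : |u σ| ≤ 1 := by
  obtain ⟨L, hL⟩ := hE.lipschitz
  have h1 : eLpNorm u ⊤ (surf n) ≤ 1 := le_trans le_self_add hE.norm_le
  rw [eLpNorm_exponent_top] at h1
  have h2 : ∀ᵐ σ ∂(surf n), |u σ| ≤ 1 := by
    filter_upwards [enorm_ae_le_eLpNormEssSup u (surf n)] with σ hσ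
    have h2 := hσ.trans h1
    rwa [← ofReal_norm, ENNReal.ofReal_le_one, Real.norm_eq_abs] at h2
  by_contra hσ
  have h3 : IsOpen {σ | 1 < |u σ|} := isOpen_lt continuous_const hL.continuous.abs
  refine h3.measure_ne_zero (surf n) ⟨σ, not_le.1 hσ⟩ ?_
  refine measure_mono_null (fun x hx => ?_) (ae_iff.1 h2)
  exact not_le.2 hx

/-- Away from the frontier the space is the disjoint union of two open sets, the interiors of `E`
and of its complement. -/
theorem IsPreconnected.subset_or_subset_compl {X : Type*} [TopologicalSpace X] {s E : Set X}
    (hs : IsPreconnected s) (h : s ∩ frontier E = ∅) : s ⊆ E ∨ s ⊆ Eᶜ := by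
  have h1 : s ⊆ interior E ∪ interior Eᶜ := fun x hx => by
    by_contra hc
    rw [mem_union, not_or, interior_compl, mem_compl_iff, not_not] at hc
    exact eq_empty_iff_forall_notMem.1 h x ⟨hx, hc.2, hc.1⟩
  have h2 : Disjoint (interior E) (interior Eᶜ) :=
    disjoint_compl_right.mono interior_subset interior_subset
  exact (hs.subset_or_subset isOpen_interior isOpen_interior h2 h1).imp
    (fun h => h.trans interior_subset) fun h => h.trans interior_subset

theorem isPreconnected_starSet {n : ℕ} {R : Rn n → ℝ} (hR0 : ∀ r : ℝ, 0 < r → ∀ x, R (r • x) = R x)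
    (h0 : 0 < R 0) : IsPreconnected (starSet R) := by
  have hs : StarConvex ℝ 0 (starSet R) := by
    refine starConvex_zero_iff.2 fun x hx a ha0 ha1 => ?_
    rcases ha0.eq_or_lt with rfl | ha
    · rw [zero_smul]
      simpa [starSet] using h0
    · change ‖a • x‖ < R (a • x)
      rw [hR0 a ha, norm_smul, Real.norm_eq_abs, abs_of_pos ha]
      exact (mul_le_of_le_one_left (norm_nonneg _) ha1).trans_lt hx
  exact (hs.isPathConnected (by simpa [starSet] using h0)).isConnected.isPreconnected

theorem isPreconnected_compl_graph {m : ℕ} {R : Rn (m + 2) → ℝ}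
    (hR0 : ∀ r : ℝ, 0 < r → ∀ x, R (r • x) = R x)
    (hRc : Continuous fun σ : Sph (m + 2) => R σ) (hpos : ∀ x, 0 < R x) :
    IsPreconnected {x | R x < ‖x‖} := by
  have h1 : {x | R x < ‖x‖} = (fun p : Sph (m + 2) × ℝ => (R p.1 + p.2) • (p.1 : Rn (m + 2))) ''
      (univ ×ˢ Ioi 0) := by
    ext x
    simp only [mem_ofPred_eq, mem_image, mem_prod, mem_univ, true_and, mem_Ioi, Prod.exists]
    constructor
    · intro hx
      have hx0 : 0 < ‖x‖ := (hpos x).trans hx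
      refine ⟨⟨‖x‖⁻¹ • x, by
        rw [mem_sphere_zero_iff_norm, norm_smul, norm_inv, norm_norm, inv_mul_cancel₀ hx0.ne']⟩,
        ‖x‖ - R x, sub_pos.2 hx, ?_⟩
      rw [hR0 _ (inv_pos.2 hx0), add_sub_cancel, smul_inv_smul₀ hx0.ne']
    · rintro ⟨σ, s, hs, rfl⟩
      have h2 : 0 < R σ + s := add_pos (hpos _) hs
      have h3 : ‖(σ : Rn (m + 2))‖ = 1 := by simp
      rw [hR0 _ h2, norm_smul, h3, mul_one, Real.norm_eq_abs, abs_of_pos h2]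
      linarith
  rw [h1]
  have h2 : IsPreconnected (univ : Set (Sph (m + 2))) := by
    have h3 : IsPreconnected (Metric.sphere (0 : Rn (m + 2)) 1) := by
      refine isPreconnected_sphere ?_ 0 1
      rw [← Module.finrank_eq_rank, finrank_euclideanSpace_fin]
      exact_mod_cast (by omega : 1 < m + 2)
    exact (Subtype.preconnectedSpace h3).isPreconnected_univ
  refine (h2.prod isPreconnected_Ioi).image _ (Continuous.continuousOn ?_)
  exact ((hRc.comp continuous_fst).add continuous_snd).smul
    (continuous_subtype_val.comp continuous_fst)

theorem volume_graph {m : ℕ} {R : Rn (m + 2) → ℝ} (hR : Measurable R)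
    (hR0 : ∀ r : ℝ, 0 < r → ∀ x, R (r • x) = R x) : volume {x | ‖x‖ = R x} = 0 := by
  have hm : MeasurableSet {x | ‖x‖ = R x} := measurableSet_eq_fun measurable_norm hR
  rw [← lintegral_indicator_one hm, lintegral_polar (k := m + 1) _ (measurable_one.indicator hm),
    ← lintegral_zero (μ := surf (m + 2))]
  refine lintegral_congr fun σ => ?_
  rw [← lintegral_zero (μ := volume.restrict (Ioi (0 : ℝ)))]
  refine lintegral_congr_ae ?_
  filter_upwards [ae_restrict_mem measurableSet_Ioi,
    ae_restrict_of_ae (compl_mem_ae_iff.2 (measure_singleton (R (σ : Rn (m + 2)))))] with r hr hr'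
  have hr0 : (0 : ℝ) < r := hr
  rw [indicator_of_notMem, mul_zero]
  intro h
  have h1 : ‖(σ : Rn (m + 2))‖ = 1 := by simp
  have h2 : ‖r • (σ : Rn (m + 2))‖ = R (r • (σ : Rn (m + 2))) := h
  rw [hR0 r hr0, norm_smul, h1, mul_one, Real.norm_eq_abs, abs_of_pos hr0] at h2
  exact hr' h2

/-- A nearly spherical set is, up to a null set, the region inside its graph. -/
theorem IsCenteredNearlySpherical.ae_eq_starSet {m : ℕ} {t : ℝ} {E : Set (Rn (m + 2))}
    {u : Sph (m + 2) → ℝ} (hE : IsCenteredNearlySpherical t E u) :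
    E =ᵐ[volume] starSet (graphRadius t u) := by
  obtain ⟨L, hL⟩ := hE.lipschitz
  have ht0 := hE.t_pos
  have ht1 := hE.t_lt_half
  set R := graphRadius t u with hRdef
  have hR : Measurable R := measurable_graphRadius t hL
  have hR0 : ∀ r : ℝ, 0 < r → ∀ x, R (r • x) = R x := fun r hr x => graphRadius_smul t u hr x
  have hbound : ∀ σ : Sph (m + 2), |t * u σ| ≤ t := fun σ => by
    rw [abs_mul, abs_of_pos ht0]
    exact mul_le_of_le_one_right ht0.le (hE.abs_le_one σ)
  have hRz : R 0 = 1 := by simp [hRdef, graphRadius, homExt]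
  have hunit : ∀ x : Rn (m + 2), x ≠ 0 → ∃ σ : Sph (m + 2), R x = 1 + t * u σ ∧
      (σ : Rn (m + 2)) = ‖x‖⁻¹ • x := fun x hx => by
    have hx0 : 0 < ‖x‖ := norm_pos_iff.2 hx
    refine ⟨⟨‖x‖⁻¹ • x, by
      rw [mem_sphere_zero_iff_norm, norm_smul, norm_inv, norm_norm, inv_mul_cancel₀ hx0.ne']⟩, ?_,
      rfl⟩
    rw [← graphRadius_coe, ← hRdef]
    exact (hR0 _ (inv_pos.2 hx0) x).symm
  have hRb : ∀ x, 0 < R x ∧ R x ≤ 2 := fun x => by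
    rcases eq_or_ne x 0 with rfl | hx
    · rw [hRz]
      norm_num
    · obtain ⟨σ, hσ, -⟩ := hunit x hx
      rw [hσ]
      have := abs_le.1 (hbound σ)
      constructor <;> linarith [this.1, this.2]
  have hfr : frontier E = {x | ‖x‖ = R x} := by
    rw [hE.frontier_eq]
    ext x
    simp only [mem_range, mem_ofPred_eq]
    constructor
    · rintro ⟨σ, rfl⟩
      have h2 : 0 < 1 + t * u σ := by linarith [(abs_le.1 (hbound σ)).1]
      have h3 : ‖(σ : Rn (m + 2))‖ = 1 := by simp
      rw [hR0 _ h2, norm_smul, h3, mul_one, Real.norm_eq_abs, abs_of_pos h2, hRdef, graphRadius_coe]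
    · intro hx
      have hx0 : x ≠ 0 := fun h => by
        rw [h, hRz, norm_zero] at hx
        exact zero_ne_one hx
      obtain ⟨σ, h1, h2⟩ := hunit x hx0
      refine ⟨σ, ?_⟩
      rw [← h1, ← hx, h2, smul_inv_smul₀ (norm_ne_zero_iff.2 hx0)]
  have hRc : Continuous fun σ : Sph (m + 2) => R σ := by
    have : (fun σ : Sph (m + 2) => R σ) = fun σ => 1 + t * u σ := by
      ext σ
      rw [hRdef, graphRadius_coe]
    rw [this]
    exact continuous_const.add (continuous_const.mul hL.continuous)
  have hU := IsPreconnected.subset_or_subset_compl (E := E)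
    (isPreconnected_starSet hR0 (by rw [hRz]; exact one_pos)) (by
      rw [hfr]
      refine eq_empty_of_forall_notMem fun x hx => ?_
      exact (hx.1 : ‖x‖ < R x).ne hx.2)
  have hV := IsPreconnected.subset_or_subset_compl (E := E)
    (isPreconnected_compl_graph hR0 hRc fun x => (hRb x).1) (by
      rw [hfr]
      refine eq_empty_of_forall_notMem fun x hx => ?_
      exact (hx.1 : R x < ‖x‖).ne' hx.2)
  have hnull := volume_graph hR hR0
  -- The outer region has infinite volume, so it cannot lie in `E`.
  have hVE : {x | R x < ‖x‖} ⊆ Eᶜ := by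
    refine hV.resolve_left fun h => ?_
    have h1 : (Metric.closedBall (0 : Rn (m + 2)) 2)ᶜ ⊆ E := fun x hx => by
      refine h ?_
      rw [mem_compl_iff, mem_closedBall_zero_iff, not_le] at hx
      exact (hRb x).2.trans_lt hx
    have h2 : volume (univ : Set (Rn (m + 2))) < ⊤ := by
      rw [← union_compl_self (Metric.closedBall (0 : Rn (m + 2)) 2)]
      refine (measure_union_le _ _).trans_lt (ENNReal.add_lt_top.2
        ⟨measure_closedBall_lt_top, (measure_mono h1).trans_lt ?_⟩)
      rw [hE.volume_eq]
      exact measure_ball_lt_top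
    rw [measure_univ_of_isAddLeftInvariant] at h2
    exact lt_irrefl _ h2
  -- Otherwise `E` would be contained in the graph, which is null, whereas `E` has positive volume.
  have hUE : starSet R ⊆ E := by
    refine hU.resolve_right fun h => ?_
    have h1 : E ⊆ {x | ‖x‖ = R x} := fun x hx => by
      rcases lt_trichotomy ‖x‖ (R x) with h2 | h2 | h2
      · exact absurd hx (h h2)
      · exact h2
      · exact absurd hx (hVE h2)
    have h2 := measure_mono_null h1 hnull
    rw [hE.volume_eq] at h2
    exact (Metric.measure_ball_pos volume (0 : Rn (m + 2)) one_pos).ne' h2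
  refine Filter.EventuallyLE.antisymm ?_ hUE.eventuallyLE
  rw [ae_le_set]
  refine measure_mono_null (fun x hx => ?_) hnull
  rcases lt_trichotomy ‖x‖ (R x) with h2 | h2 | h2
  · exact absurd h2 hx.2
  · exact h2
  · exact absurd hx.1 (hVE h2)

/-! ### Consequences of the volume constraint -/

theorem volume_starSet {m : ℕ} {R : Rn (m + 2) → ℝ} (hR : Measurable R)
    (hR0 : ∀ r : ℝ, 0 < r → ∀ x, R (r • x) = R x) (hpos : ∀ σ : Sph (m + 2), 0 < R σ) :
    (m + 2 : ℕ) * volume (starSet R) =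
      ∫⁻ σ : Sph (m + 2), ENNReal.ofReal (R σ ^ (m + 2)) ∂(surf (m + 2)) := by
  have h1 := lintegral_starSet hR hR0 (f := fun _ => 1) measurable_const
  simp only [mul_one, lintegral_const, Measure.restrict_apply_univ, one_mul] at h1
  rw [h1, ← lintegral_const_mul' _ _ (ENNReal.natCast_ne_top _)]
  refine lintegral_congr fun σ => ?_
  rw [setLIntegral_indicator measurableSet_Iio, inter_comm, Ioi_inter_Iio,
    Measure.restrict_congr_set Ioo_ae_eq_Ioc, ← ofReal_integral_eq_lintegral_ofReal
      (intervalIntegral.intervalIntegrable_pow _).1,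
    ← intervalIntegral.integral_of_le (hpos σ).le, integral_pow, ← ENNReal.ofReal_natCast,
    ← ENNReal.ofReal_mul (by positivity)]
  · congr 1
    push_cast
    field_simp
    ring
  · filter_upwards [ae_restrict_mem measurableSet_Ioc] with r hr
    exact pow_nonneg hr.1.le _

theorem exists_one_add_pow_taylor (j : ℕ) : ∃ c : ℝ, 0 ≤ c ∧ ∀ τ : ℝ, |τ| ≤ 1 →
    |(1 + τ) ^ j - (1 + j * τ + j * (j - 1) / 2 * τ ^ 2)| ≤ c * |τ| ^ 3 := by
  induction j with
  | zero => exact ⟨0, le_rfl, fun τ _ => by simp⟩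
  | succ j ih =>
    obtain ⟨c, hc0, hc⟩ := ih
    refine ⟨2 * c + |(j : ℝ) * (j - 1) / 2|, by positivity, fun τ hτ => ?_⟩
    have h1 : (1 + τ) ^ (j + 1) - (1 + ((j + 1 : ℕ) : ℝ) * τ +
        ((j + 1 : ℕ) : ℝ) * (((j + 1 : ℕ) : ℝ) - 1) / 2 * τ ^ 2) =
        ((1 + τ) ^ j - (1 + j * τ + j * (j - 1) / 2 * τ ^ 2)) * (1 + τ) +
          (j : ℝ) * (j - 1) / 2 * τ ^ 3 := by
      push_cast
      ring
    rw [h1]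
    refine (abs_add_le _ _).trans ?_
    rw [abs_mul, abs_mul, abs_pow]
    have h2 : |1 + τ| ≤ 2 := (abs_add_le _ _).trans (by rw [abs_one]; linarith)
    have h3 := mul_le_mul (hc τ hτ) h2 (abs_nonneg _) (by positivity)
    linarith

theorem integrable_of_continuous {n : ℕ} {f : Sph n → ℝ} (hf : Continuous f) :
    Integrable f (surf n) :=
  hf.integrable_of_hasCompactSupport (HasCompactSupport.of_compactSpace _)

theorem integral_const_surf (m : ℕ) (c : ℝ) :
    ∫ _ : Sph (m + 2), c ∂(surf (m + 2)) = (sphArea (m + 1)).toReal * c := by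
  rw [integral_const, smul_eq_mul, measureReal_def]
  rfl

/-- Consequences of the volume constraint for the function that describes the boundary. -/
structure IsVolumePreserving {m : ℕ} (t : ℝ) (u : Sph (m + 2) → ℝ) : Prop where
  t_pos : 0 < t
  t_lt_half : t < 1 / 2
  continuous : Continuous u
  abs_le_one : ∀ σ, |u σ| ≤ 1
  integral_eq : ∫ σ, (1 + t * u σ) ^ (m + 2) ∂(surf (m + 2)) = (sphArea (m + 1)).toReal

theorem IsCenteredNearlySpherical.isVolumePreserving {m : ℕ} {t : ℝ} {E : Set (Rn (m + 2))}
    {u : Sph (m + 2) → ℝ} (hE : IsCenteredNearlySpherical t E u) : IsVolumePreserving t u := by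
  obtain ⟨L, hL⟩ := hE.lipschitz
  have hpos : ∀ σ : Sph (m + 2), 0 < 1 + t * u σ := fun σ => by
    have h1 : |t * u σ| ≤ t := by
      rw [abs_mul, abs_of_pos hE.t_pos]
      exact mul_le_of_le_one_right hE.t_pos.le (hE.abs_le_one σ)
    linarith [(_root_.abs_le.1 h1).1, hE.t_lt_half]
  have hRc : Continuous fun σ : Sph (m + 2) => (1 + t * u σ) ^ (m + 2) :=
    (continuous_const.add (continuous_const.mul hL.continuous)).pow _
  refine ⟨hE.t_pos, hE.t_lt_half, hL.continuous, hE.abs_le_one, ?_⟩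
  have h1 := volume_starSet (measurable_graphRadius t hL)
    (fun r hr x => graphRadius_smul t u hr x) fun σ => by rw [graphRadius_coe]; exact hpos σ
  rw [← measure_congr hE.ae_eq_starSet, hE.volume_eq, ← sphArea_eq (m + 1)] at h1
  simp only [graphRadius_coe] at h1
  rw [h1, ← ofReal_integral_eq_lintegral_ofReal (integrable_of_continuous hRc)
    (ae_of_all _ fun σ => (pow_pos (hpos σ) _).le), ENNReal.toReal_ofReal]
  exact integral_nonneg fun σ => (pow_pos (hpos σ) _).le

theorem IsVolumePreserving.abs_mul_le {m : ℕ} {t : ℝ} {u : Sph (m + 2) → ℝ}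
    (hu : IsVolumePreserving t u) (σ : Sph (m + 2)) : |t * u σ| ≤ 1 := by
  rw [abs_mul, abs_of_pos hu.t_pos]
  have := hu.abs_le_one σ
  have := hu.t_lt_half
  nlinarith [abs_nonneg (u σ), hu.t_pos]

theorem IsVolumePreserving.cube_le {m : ℕ} {t : ℝ} {u : Sph (m + 2) → ℝ}
    (hu : IsVolumePreserving t u) (σ : Sph (m + 2)) : |t * u σ| ^ 3 ≤ t ^ 3 * u σ ^ 2 := by
  rw [abs_mul, abs_of_pos hu.t_pos, mul_pow, pow_succ |u σ| 2, sq_abs]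
  exact mul_le_mul_of_nonneg_left (mul_le_of_le_one_right (sq_nonneg _) (hu.abs_le_one σ))
    (pow_nonneg hu.t_pos.le 3)

theorem normSqL2_nonneg {n : ℕ} (u : Sph n → ℝ) : 0 ≤ normSqL2 u :=
  integral_nonneg fun _ => sq_nonneg _

/-- The second variation of the perimeter under the volume constraint. -/
theorem exists_integral_pow_ge (m : ℕ) : ∃ C : ℝ, 0 ≤ C ∧
    ∀ (t : ℝ) (u : Sph (m + 2) → ℝ), IsVolumePreserving t u →
      (m + 1) / 2 * t ^ 2 * normSqL2 u - C * t ^ 3 * normSqL2 u ≤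
        (sphArea (m + 1)).toReal - ∫ σ, (1 + t * u σ) ^ (m + 1) ∂(surf (m + 2)) := by
  obtain ⟨c₁, hc₁, h₁⟩ := exists_one_add_pow_taylor (m + 1)
  obtain ⟨c₂, hc₂, h₂⟩ := exists_one_add_pow_taylor (m + 2)
  refine ⟨c₁ + c₂, by positivity, fun t u hu => ?_⟩
  have hcu := hu.continuous
  have hi1 : Integrable (fun σ => (1 + t * u σ) ^ (m + 1)) (surf (m + 2)) :=
    integrable_of_continuous (by fun_prop)
  have hi2 : Integrable (fun σ => (1 + t * u σ) ^ (m + 2)) (surf (m + 2)) :=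
    integrable_of_continuous (by fun_prop)
  have hi3 : Integrable (fun σ => u σ ^ 2) (surf (m + 2)) :=
    integrable_of_continuous (by fun_prop)
  have hi4 : Integrable (fun _ : Sph (m + 2) => (1 : ℝ)) (surf (m + 2)) := integrable_const _
  -- The factor `(m + 1) / (m + 2)` is the Lagrange multiplier of the constraint: it cancels the
  -- linear terms and leaves the coefficient `(m + 1) / 2` of the square. The added multiple of the
  -- constraint integrates to zero.
  have hpt : ∀ σ, ((m + 1) / 2 * t ^ 2 - (c₁ + c₂) * t ^ 3) * u σ ^ 2 ≤
      1 - (1 + t * u σ) ^ (m + 1) + (m + 1) / (m + 2) * ((1 + t * u σ) ^ (m + 2) - 1) := by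
    intro σ
    have e1 := (abs_le.1 (h₁ _ (hu.abs_mul_le σ))).2
    have e2 := (abs_le.1 (h₂ _ (hu.abs_mul_le σ))).1
    have e3 := hu.cube_le σ
    set τ := t * u σ with hτ
    push_cast at e1 e2
    have e4 : (0 : ℝ) ≤ (m + 1) / (m + 2) := by positivity
    have e5 : ((m : ℝ) + 1) / (m + 2) ≤ 1 := by
      rw [div_le_one (by positivity)]
      linarith
    have e6 : ((m : ℝ) + 1) / (m + 2) * (c₂ * |τ| ^ 3) ≤ c₂ * |τ| ^ 3 :=
      mul_le_of_le_one_left (by positivity) e5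
    have e7 := mul_le_mul_of_nonneg_left e2 e4
    have e8 : ((m : ℝ) + 1) / (m + 2) * ((1 + ((m : ℝ) + 2) * τ +
        ((m : ℝ) + 2) * (m + 2 - 1) / 2 * τ ^ 2)) =
        ((m : ℝ) + 1) / (m + 2) + (m + 1) * τ + (m + 1) * (m + 1) / 2 * τ ^ 2 := by
      field_simp
      ring
    have e9 : (c₁ + c₂) * |τ| ^ 3 ≤ (c₁ + c₂) * (t ^ 3 * u σ ^ 2) := by gcongr
    have e10 : τ ^ 2 = t ^ 2 * u σ ^ 2 := by rw [hτ]; ring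
    rw [mul_sub] at e7
    rw [e8] at e7
    rw [mul_sub, mul_one]
    nlinarith
  have h3 := integral_mono (hi3.const_mul ((m + 1) / 2 * t ^ 2 - (c₁ + c₂) * t ^ 3))
    ((hi4.sub hi1).add ((hi2.sub hi4).const_mul (((m : ℝ) + 1) / (m + 2)))) hpt
  rw [integral_const_mul] at h3
  have h4 : ∫ σ, (((fun _ : Sph (m + 2) => (1 : ℝ)) - fun σ => (1 + t * u σ) ^ (m + 1)) +
      fun σ => ((m : ℝ) + 1) / (m + 2) * (((fun σ => (1 + t * u σ) ^ (m + 2)) -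
        fun _ : Sph (m + 2) => (1 : ℝ)) σ)) σ ∂(surf (m + 2)) =
      (sphArea (m + 1)).toReal - ∫ σ, (1 + t * u σ) ^ (m + 1) ∂(surf (m + 2)) := by
    rw [integral_add' (hi4.sub hi1) ((hi2.sub hi4).const_mul _), integral_sub' hi4 hi1,
      integral_const_mul, integral_sub' hi2 hi4, hu.integral_eq, integral_const_surf, mul_one,
      sub_self, mul_zero, add_zero]
  rw [h4] at h3
  refine le_trans (le_of_eq ?_) h3
  rw [normSqL2]
  ring

/-- The volume constraint expanded to first order: the linear term `(m + 2) t ∫ u` is balanced by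
terms of order `t² u²`. The mean of `u` is therefore small compared with its norm, as the Poincaré
inequality requires. -/
theorem exists_abs_integral_le (m : ℕ) : ∃ C : ℝ, 0 ≤ C ∧
    ∀ (t : ℝ) (u : Sph (m + 2) → ℝ), IsVolumePreserving t u →
      |∫ σ, u σ ∂(surf (m + 2))| ≤ C * t * normSqL2 u := by
  obtain ⟨c, hc, h⟩ := exists_one_add_pow_taylor (m + 2)
  refine ⟨c + (m + 2) * (m + 1) / 2, by positivity, fun t u hu => ?_⟩
  have hcu := hu.continuous
  have ht := hu.t_pos
  have hi1 : Integrable u (surf (m + 2)) := integrable_of_continuous hcu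
  have hi2 : Integrable (fun σ => (1 + t * u σ) ^ (m + 2)) (surf (m + 2)) :=
    integrable_of_continuous (by fun_prop)
  have hi3 : Integrable (fun σ => u σ ^ 2) (surf (m + 2)) :=
    integrable_of_continuous (by fun_prop)
  have hi4 : Integrable (fun _ : Sph (m + 2) => (1 : ℝ)) (surf (m + 2)) := integrable_const _
  have h1 : ∫ σ, ((1 + t * u σ) ^ (m + 2) - 1 - (m + 2) * t * u σ) ∂(surf (m + 2)) =
      -((m + 2) * t * ∫ σ, u σ ∂(surf (m + 2))) := by
    have hA : Integrable (fun σ => (1 + t * u σ) ^ (m + 2) - 1) (surf (m + 2)) := hi2.sub hi4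
    rw [integral_sub hA (hi1.const_mul _), integral_sub hi2 hi4, hu.integral_eq,
      integral_const_surf, integral_const_mul]
    ring
  have h2 : |∫ σ, ((1 + t * u σ) ^ (m + 2) - 1 - (m + 2) * t * u σ) ∂(surf (m + 2))| ≤
      ∫ σ, (c + (m + 2) * (m + 1) / 2) * t ^ 2 * u σ ^ 2 ∂(surf (m + 2)) := by
    rw [← Real.norm_eq_abs]
    refine norm_integral_le_of_norm_le (hi3.const_mul _) (ae_of_all _ fun σ => ?_)
    have e1 := h _ (hu.abs_mul_le σ)
    have e2 := hu.cube_le σ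
    push_cast at e1
    have e3 : (1 + t * u σ) ^ (m + 2) - 1 - (m + 2) * t * u σ =
        ((1 + t * u σ) ^ (m + 2) - (1 + (m + 2) * (t * u σ) +
          (m + 2) * (m + 2 - 1) / 2 * (t * u σ) ^ 2)) + (m + 2) * (m + 1) / 2 * (t * u σ) ^ 2 := by
      ring
    rw [Real.norm_eq_abs, e3]
    refine (abs_add_le _ _).trans ?_
    have e4 : |((m : ℝ) + 2) * (m + 1) / 2 * (t * u σ) ^ 2| =
        (m + 2) * (m + 1) / 2 * (t ^ 2 * u σ ^ 2) := by
      rw [abs_of_nonneg (by positivity), mul_pow]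
    have e5 : t ^ 3 * u σ ^ 2 ≤ t ^ 2 * u σ ^ 2 := by
      refine mul_le_mul_of_nonneg_right ?_ (sq_nonneg _)
      exact pow_le_pow_of_le_one ht.le (by linarith [hu.t_lt_half]) (by norm_num)
    have e6 := mul_le_mul_of_nonneg_left (e2.trans e5) hc
    rw [e4]
    linarith
  rw [h1, abs_neg, integral_const_mul, abs_mul, abs_of_pos (by positivity)] at h2
  change _ ≤ _ * normSqL2 u at h2
  set I := |∫ σ, u σ ∂(surf (m + 2))|
  have hI : 0 ≤ I := abs_nonneg _
  have h3 : t * I ≤ t * ((c + (m + 2) * (m + 1) / 2) * t * normSqL2 u) := by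
    have : t * I ≤ (m + 2) * t * I := by
      have : 0 ≤ (m + 1) * (t * I) := by positivity
      linarith
    calc t * I ≤ _ := this
      _ ≤ _ := h2
      _ = _ := by ring
  exact le_of_mul_le_mul_left h3 ht

theorem integral_sq_sub {m : ℕ} {u : Sph (m + 2) → ℝ} (hu : Continuous u) :
    ∫⁻ x : Sph (m + 2), ∫⁻ y : Sph (m + 2), ENNReal.ofReal ((u x - u y) ^ 2)
      ∂(surf (m + 2)) ∂(surf (m + 2)) =
    ENNReal.ofReal (2 * (sphArea (m + 1)).toReal * normSqL2 u -
      2 * (∫ σ, u σ ∂(surf (m + 2))) ^ 2) := by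
  have hi1 : Integrable u (surf (m + 2)) := integrable_of_continuous hu
  have hi3 : Integrable (fun σ => u σ ^ 2) (surf (m + 2)) :=
    integrable_of_continuous (by fun_prop)
  set I := ∫ σ, u σ ∂(surf (m + 2)) with hI
  set S := (sphArea (m + 1)).toReal with hS
  have h1 : ∀ x : Sph (m + 2), ∫⁻ y : Sph (m + 2), ENNReal.ofReal ((u x - u y) ^ 2)
      ∂(surf (m + 2)) = ENNReal.ofReal (S * u x ^ 2 - 2 * u x * I + normSqL2 u) := fun x => by
    rw [← ofReal_integral_eq_lintegral_ofReal (integrable_of_continuous (by fun_prop))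
      (ae_of_all _ fun y => sq_nonneg _)]
    congr 1
    have e1 : ∀ y, (u x - u y) ^ 2 = u x ^ 2 - 2 * u x * u y + u y ^ 2 := fun y => by ring
    simp only [e1]
    have hA : Integrable (fun y => u x ^ 2 - 2 * u x * u y) (surf (m + 2)) :=
      (integrable_const _).sub (hi1.const_mul _)
    rw [integral_add hA hi3,
      integral_sub (integrable_const _) (hi1.const_mul _), integral_const_surf, integral_const_mul,
      normSqL2]
  have h0 : ∀ x, 0 ≤ S * u x ^ 2 - 2 * u x * I + normSqL2 u := fun x => by
    have e1 : ∫ y, (u x - u y) ^ 2 ∂(surf (m + 2)) = S * u x ^ 2 - 2 * u x * I + normSqL2 u := by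
      have e1 : ∀ y, (u x - u y) ^ 2 = u x ^ 2 - 2 * u x * u y + u y ^ 2 := fun y => by ring
      simp only [e1]
      have hA : Integrable (fun y => u x ^ 2 - 2 * u x * u y) (surf (m + 2)) :=
        (integrable_const _).sub (hi1.const_mul _)
      rw [integral_add hA hi3,
        integral_sub (integrable_const _) (hi1.const_mul _), integral_const_surf,
        integral_const_mul, normSqL2]
    rw [← e1]
    exact integral_nonneg fun y => sq_nonneg _
  simp only [h1]
  rw [← ofReal_integral_eq_lintegral_ofReal (integrable_of_continuous (by fun_prop))
    (ae_of_all _ h0)]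
  congr 1
  have e2 : ∀ x, S * u x ^ 2 - 2 * u x * I + normSqL2 u =
      S * u x ^ 2 - 2 * I * u x + normSqL2 u := fun x => by ring
  simp only [e2]
  have hA : Integrable (fun x => S * u x ^ 2 - 2 * I * u x) (surf (m + 2)) :=
    (hi3.const_mul _).sub (hi1.const_mul _)
  rw [integral_add hA (integrable_const _),
    integral_sub (hi3.const_mul _) (hi1.const_mul _), integral_const_surf, integral_const_mul,
    integral_const_mul, ← hI, ← hS, normSqL2]
  ring

/-- The Poincaré inequality for functions that satisfy the volume constraint. -/
theorem exists_normSqL2_le (m : ℕ) : ∃ t₁ C : ℝ, 0 < t₁ ∧ 0 < C ∧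
    ∀ (t : ℝ) (u : Sph (m + 2) → ℝ) (L : ℝ≥0), LipschitzWith L u → IsVolumePreserving t u →
      t < t₁ → normSqL2 u ≤ C * gradNormSqL2 u := by
  obtain ⟨c, hc, h⟩ := exists_poincare m
  obtain ⟨a, ha, h'⟩ := exists_abs_integral_le m
  set S := (sphArea (m + 1)).toReal with hS
  have hS0 : 0 < S := ENNReal.toReal_pos (sphArea_ne_zero _) (sphArea_ne_top _)
  -- Below this threshold `a * t ≤ 1 / 2`, so the squared mean absorbs at most half of the full term
  -- `2 S ‖u‖²` in the Poincaré inequality.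
  refine ⟨1 / (2 * (a + 1)), c / S, by positivity, by positivity, fun t u L hL hu ht => ?_⟩
  have h1 := h u L hL
  rw [integral_sq_sub hL.continuous, ENNReal.ofReal_le_ofReal_iff
    (mul_nonneg hc.le (gradNormSqL2_nonneg u))] at h1
  have h2 := h' t u hu
  have h3 : |∫ σ, u σ ∂(surf (m + 2))| ≤ S := by
    have := norm_integral_le_of_norm_le (μ := surf (m + 2)) (f := u) (integrable_const (1 : ℝ))
      (ae_of_all _ fun σ => hu.abs_le_one σ)
    rwa [integral_const_surf, mul_one] at this
  set I := ∫ σ, u σ ∂(surf (m + 2))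
  have hN := normSqL2_nonneg u
  have ht0 := hu.t_pos
  have h4 : I ^ 2 ≤ a * t * normSqL2 u * S := by
    rw [← sq_abs, pow_two]
    exact mul_le_mul h2 h3 (abs_nonneg _) (by positivity)
  have h5 : a * t ≤ 1 / 2 := by
    rw [lt_div_iff₀ (by positivity)] at ht
    nlinarith
  have h6 : a * t * normSqL2 u * S ≤ 1 / 2 * (normSqL2 u * S) := by
    rw [mul_assoc]
    exact mul_le_mul_of_nonneg_right h5 (by positivity)
  rw [div_mul_eq_mul_div, le_div_iff₀ hS0]
  linarith

/-! ### Assembly of the estimate -/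

/-- The relative defect of `capMoment` from its limit `sphArea`, which vanishes as the
kernel concentrates at the origin. -/
def capError (m : ℕ) (h : ℝ → ℝ≥0∞) (ε : ℝ) : ℝ :=
  1 - (capMoment m (scaleProfile m h ε)).toReal / (sphArea (m + 1)).toReal

theorem sphArea_toReal_pos (m : ℕ) : 0 < (sphArea (m + 1)).toReal :=
  ENNReal.toReal_pos (sphArea_ne_zero _) (sphArea_ne_top _)

theorem IsProfile.capError_nonneg {m : ℕ} {h : ℝ → ℝ≥0∞} {M : ℝ → ℝ} (hh : IsProfile m h M)
    {ε : ℝ} (hε : 0 < ε) : 0 ≤ capError m h ε := by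
  rw [capError, sub_nonneg, div_le_one (sphArea_toReal_pos m)]
  exact ENNReal.toReal_mono (sphArea_ne_top _) (hh.capMoment_le hε)

theorem capError_le_one (m : ℕ) (h : ℝ → ℝ≥0∞) (ε : ℝ) : capError m h ε ≤ 1 := by
  rw [capError]
  have : 0 ≤ (capMoment m (scaleProfile m h ε)).toReal / (sphArea (m + 1)).toReal := by positivity
  linarith

theorem IsProfile.tendsto_capError {m : ℕ} {h : ℝ → ℝ≥0∞} {M : ℝ → ℝ} (hh : IsProfile m h M) :
    Tendsto (capError m h) (𝓝[>] 0) (𝓝 0) := by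
  have h1 := (ENNReal.tendsto_toReal (sphArea_ne_top (m + 1))).comp hh.tendsto_capMoment
  have h2 := (h1.div_const (sphArea (m + 1)).toReal).const_sub 1
  rwa [div_self (sphArea_toReal_pos m).ne', sub_self] at h2

/-- Comparison of the nonlocal perimeters of a nearly spherical set and of the unit ball, in terms
of the interaction energy of the graph. -/
theorem sphArea_mul_radialPer_add_le {m : ℕ} {h : ℝ → ℝ≥0∞} (hh : Measurable h)
    {t : ℝ} {E : Set (Rn (m + 2))} {u : Sph (m + 2) → ℝ} (hE : IsCenteredNearlySpherical t E u)
    {Λ : ℝ}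
    (hΛ : ∀ α ∈ Icc (0 : ℝ) 1, ∀ β ∈ Icc (0 : ℝ) 1,
      2 * ∫⁻ x : Sph (m + 2), ∫⁻ y : Sph (m + 2), ENNReal.ofReal ((u x - u y) ^ 2) *
        polarKernel m h x y (midHeight (homExt u) t α x y)
          (midHeight (homExt u) t β x y) ∂(surf (m + 2)) ∂(surf (m + 2)) ≤ ENNReal.ofReal Λ) :
    sphArea (m + 1) * radialPer h E + sphArea (m + 1) * capMoment m h ≤
      sphArea (m + 1) * radialPer h (Metric.ball (0 : Rn (m + 2)) 1) +
      ENNReal.ofReal (∫ σ, (1 + t * u σ) ^ (m + 1) ∂(surf (m + 2))) * capMoment m h +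
      sphArea (m + 1) * ENNReal.ofReal (t ^ 2 / 2 * Λ) := by
  obtain ⟨L, hL⟩ := hE.lipschitz
  have hu := hE.isVolumePreserving
  have hcu := hu.continuous
  have ht := hE.t_pos
  have ht1 : t < 1 := by linarith [hE.t_lt_half]
  have hut : ∀ σ, |t * u σ| ≤ t := fun σ => by
    rw [abs_mul, abs_of_pos ht]
    exact mul_le_of_le_one_right ht.le (hE.abs_le_one σ)
  have hpos : ∀ σ, 0 < 1 + t * u σ := fun σ => by
    linarith [(_root_.abs_le.1 (hut σ)).1]
  have hJ := lintegral_polarMeas_graph_le hh hL ht1 hut hΛ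
  set J := ∫⁻ x : Sph (m + 2), ∫⁻ y : Sph (m + 2), polarMeas m h x y
      (Ico (min (graphRadius t u x) (graphRadius t u y))
        (max (graphRadius t u x) (graphRadius t u y)) ×ˢ
      Ico (min (graphRadius t u x) (graphRadius t u y))
        (max (graphRadius t u x) (graphRadius t u y))) ∂(surf (m + 2)) ∂(surf (m + 2)) with hJdef
  have hJ' : J ≤ ENNReal.ofReal (t ^ 2 / 2 * Λ) := by
    rw [← ENNReal.ofReal_mul (sq_nonneg t)] at hJ
    have h2 : ENNReal.ofReal (t ^ 2 * Λ) = 2 * ENNReal.ofReal (t ^ 2 / 2 * Λ) := by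
      rw [← ENNReal.ofReal_ofNat 2, ← ENNReal.ofReal_mul (by norm_num)]
      congr 1
      ring
    rw [h2] at hJ
    exact (ENNReal.mul_le_mul_iff_right two_ne_zero ENNReal.ofNat_ne_top).1 hJ
  have hpow : ∀ k, ∫⁻ σ : Sph (m + 2), ENNReal.ofReal ((1 + t * u σ) ^ k) ∂(surf (m + 2)) =
      ENNReal.ofReal (∫ σ, (1 + t * u σ) ^ k ∂(surf (m + 2))) := fun k =>
    (ofReal_integral_eq_lintegral_ofReal (integrable_of_continuous (by fun_prop))
      (ae_of_all _ fun σ => (pow_pos (hpos σ) k).le)).symm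
  have hS : ∫⁻ σ : Sph (m + 2), ENNReal.ofReal ((1 + t * u σ) ^ (m + 2)) ∂(surf (m + 2)) =
      sphArea (m + 1) := by
    rw [hpow, hu.integral_eq, ENNReal.ofReal_toReal (sphArea_ne_top _)]
  have hmeas : ∀ k, Measurable fun σ => ENNReal.ofReal ((1 + t * u σ) ^ k) := fun k =>
    ((continuous_const.add (continuous_const.mul hcu)).pow k).measurable.ennreal_ofReal
  -- The tangent line bound averaged over directions. By the volume constraint the coefficients `R ^
  -- (m + 2)` integrate to the sphere area, so only the mean of `R ^ (m + 1)` remains.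
  have hball : (∫⁻ x : Sph (m + 2), radialPer h (Metric.ball (0 : Rn (m + 2)) (graphRadius t u x))
      ∂(surf (m + 2))) + sphArea (m + 1) * capMoment m h ≤
      sphArea (m + 1) * radialPer h (Metric.ball (0 : Rn (m + 2)) 1) +
      ENNReal.ofReal (∫ σ, (1 + t * u σ) ^ (m + 1) ∂(surf (m + 2))) * capMoment m h := by
    rw [← hpow, ← hS, ← lintegral_mul_const _ (hmeas _), ← lintegral_mul_const _ (hmeas _),
      ← lintegral_mul_const _ (hmeas _), ← lintegral_add_right _ ((hmeas _).mul_const _),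
      ← lintegral_add_right _ ((hmeas _).mul_const _)]
    refine lintegral_mono fun σ => ?_
    rw [graphRadius_coe]
    exact radialPer_ball_add_le hh (hpos σ)
  rw [radialPer_congr h hE.ae_eq_starSet, sphArea_mul_radialPer_starSet hh
    (measurable_graphRadius t hL) fun r hr x => graphRadius_smul t u hr x, add_right_comm]
  gcongr

/-- The right-hand side is finite, hence so is the perimeter on the left; only then can `capMoment`,
which is `1 - capError` times the sphere area, be moved across. -/
theorem radialPer_toReal_le {m : ℕ} {h : ℝ → ℝ≥0∞} {M : ℝ → ℝ} (hh : IsProfile m h M)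
    {ε : ℝ} (hε : 0 < ε) {E : Set (Rn (m + 2))} {I Λ : ℝ} (hI : 0 ≤ I) (hΛ : 0 ≤ Λ)
    (hle : sphArea (m + 1) * radialPer (scaleProfile m h ε) E +
        sphArea (m + 1) * capMoment m (scaleProfile m h ε) ≤
      sphArea (m + 1) * radialPer (scaleProfile m h ε) (Metric.ball (0 : Rn (m + 2)) 1) +
      ENNReal.ofReal I * capMoment m (scaleProfile m h ε) +
      sphArea (m + 1) * ENNReal.ofReal Λ) :
    radialPer (scaleProfile m h ε) E ≠ ⊤ ∧
    (radialPer (scaleProfile m h ε) E).toReal ≤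
      (radialPer (scaleProfile m h ε) (Metric.ball (0 : Rn (m + 2)) 1)).toReal + Λ -
        (1 - capError m h ε) * ((sphArea (m + 1)).toReal - I) := by
  have hS := sphArea_toReal_pos m
  have hSt := sphArea_ne_top (m + 1)
  have hK : capMoment m (scaleProfile m h ε) ≠ ⊤ := ne_top_of_le_ne_top hSt (hh.capMoment_le hε)
  have hp : radialPer (scaleProfile m h ε) (Metric.ball (0 : Rn (m + 2)) 1) ≠ ⊤ :=
    ne_top_of_le_ne_top hSt (hh.radialPer_ball_one_le hε)
  have hr1 := ENNReal.mul_ne_top hSt hp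
  have hr2 := ENNReal.mul_ne_top (ENNReal.ofReal_ne_top (r := I)) hK
  have hr3 := ENNReal.mul_ne_top hSt (ENNReal.ofReal_ne_top (r := Λ))
  have hr := ENNReal.add_ne_top.2 ⟨ENNReal.add_ne_top.2 ⟨hr1, hr2⟩, hr3⟩
  have hl := ENNReal.add_ne_top.1 (ne_top_of_le_ne_top hr hle)
  have hP : radialPer (scaleProfile m h ε) E ≠ ⊤ := fun htop => by
    rw [htop, ENNReal.mul_top (sphArea_ne_zero _)] at hl
    exact hl.1 rfl
  refine ⟨hP, ?_⟩
  have h1 := ENNReal.toReal_mono hr hle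
  rw [ENNReal.toReal_add hl.1 hl.2, ENNReal.toReal_add (ENNReal.add_ne_top.2 ⟨hr1, hr2⟩) hr3,
    ENNReal.toReal_add hr1 hr2] at h1
  simp only [ENNReal.toReal_mul, ENNReal.toReal_ofReal hI, ENNReal.toReal_ofReal hΛ] at h1
  rw [capError, sub_sub_cancel]
  set S := (sphArea (m + 1)).toReal
  set K := (capMoment m (scaleProfile m h ε)).toReal
  refine le_of_mul_le_mul_left ?_ hS
  have h2 : S * (K / S * (S - I)) = K * (S - I) := by
    field_simp
  rw [mul_sub, h2]
  linarith

/-- The main estimate in dimension `m + 2`. -/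
theorem exists_radialPer_le (m : ℕ) : ∃ t₀ C₁ C : ℝ, 0 < t₀ ∧ 0 < C ∧ 0 < C₁ ∧
    ∀ (h : ℝ → ℝ≥0∞) (M : ℝ → ℝ), IsProfile m h M → ∀ ε : ℝ, 0 < ε →
    (∀ (u : Sph (m + 2) → ℝ) (L : ℝ≥0), LipschitzWith L u →
      2 * ∫⁻ x : Sph (m + 2), ∫⁻ y : Sph (m + 2), ENNReal.ofReal ((u x - u y) ^ 2) *
        polarKernel m (scaleProfile m h ε) x y (midHeight (homExt u) 0 0 x y)
          (midHeight (homExt u) 0 0 x y) ∂(surf (m + 2)) ∂(surf (m + 2)) ≤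
      ENNReal.ofReal ((1 + (C₁ * angularError m M ε + capError m h ε)) * gradNormSqL2 u)) ∧
    ∀ (t : ℝ) (E : Set (Rn (m + 2))) (u : Sph (m + 2) → ℝ),
      IsCenteredNearlySpherical t E u → t < t₀ →
      radialPer (scaleProfile m h ε) E ≠ ⊤ ∧
      (radialPer (scaleProfile m h ε) E).toReal ≤
        (radialPer (scaleProfile m h ε) (Metric.ball (0 : Rn (m + 2)) 1)).toReal +
        t ^ 2 / 2 * ((1 + C * (C₁ * angularError m M ε + capError m h ε)) * gradNormSqL2 u -
          (m + 1) * normSqL2 u) + C * t ^ 3 * (gradNormSqL2 u + normSqL2 u) := by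
  obtain ⟨C₁, hC₁, h₁⟩ := exists_energy_bound m
  obtain ⟨c, hc, h₂⟩ := exists_integral_pow_ge m
  obtain ⟨t₁, cP, ht₁, hcP, h₃⟩ := exists_normSqL2_le m
  -- The summands of `C` cover the defect `κ` through the Poincaré constant, the part `C₁ * t` of
  -- the energy error, and the cubic remainder of the expansion; `1` covers the angular error
  -- already contained in the seminorm error.
  refine ⟨min (1 / 76) t₁, C₁, 1 + (m + 1) * cP + C₁ + c, by positivity, by positivity, hC₁,
    fun h M hh ε hε => ⟨fun u L hL => ?_, fun t E u hE ht => ?_⟩⟩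
  · have h4 := h₁ h M hh ε hε 0 le_rfl (by norm_num) u L hL (fun σ => by simp)
      (ae_of_all _ fun A s s' => by simp) 0 (by simp) 0 (by simp)
    rw [zero_add] at h4
    refine h4.trans (ENNReal.ofReal_le_ofReal ?_)
    have := hh.capError_nonneg hε
    exact mul_le_mul_of_nonneg_right (by linarith) (gradNormSqL2_nonneg u)
  · obtain ⟨L, hL⟩ := hE.lipschitz
    have hu := hE.isVolumePreserving
    have ht0 := hE.t_pos
    have ht76 : t ≤ 1 / 76 := (ht.trans_le (min_le_left _ _)).le
    have hut : ∀ σ, |t * u σ| ≤ t := fun σ => by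
      rw [abs_mul, abs_of_pos ht0]
      exact mul_le_of_le_one_right ht0.le (hE.abs_le_one σ)
    have harc : ∀ᵐ A ∂(rotHaar (m + 2)), ∀ s s' : ℝ,
        |t * (homExt u (arc A s) - homExt u (arc A s'))| ≤ t * |s - s'| := by
      filter_upwards [ae_lipschitzWith_homExt_arc hL hE.ae_norm_tanGrad_le] with A hA s s'
      rw [abs_mul, abs_of_pos ht0]
      exact mul_le_mul_of_nonneg_left (hA s s') ht0.le
    have h4 := sphArea_mul_radialPer_add_le (hh.scale_measurable ε) hE
      (h₁ h M hh ε hε t ht0.le ht76 u L hL hut harc)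
    have hD := gradNormSqL2_nonneg u
    have hN := normSqL2_nonneg u
    have ha := hh.angularError_nonneg ε
    have hκ := hh.capError_nonneg hε
    have hκ1 := capError_le_one m h ε
    have hI : 0 ≤ ∫ σ, (1 + t * u σ) ^ (m + 1) ∂(surf (m + 2)) :=
      integral_nonneg fun σ => pow_nonneg (by linarith [(_root_.abs_le.1 (hu.abs_mul_le σ)).1]) _
    obtain ⟨h5, h6⟩ := radialPer_toReal_le hh hε hI (by positivity) h4
    refine ⟨h5, h6.trans ?_⟩
    have h7 := mul_le_mul_of_nonneg_left (h₂ t u hu) (sub_nonneg.2 hκ1)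
    have h8 := h₃ t u L hL hu (ht.trans_le (min_le_right _ _))
    generalize angularError m M ε = a at *
    generalize capError m h ε = κ at *
    generalize gradNormSqL2 u = D at *
    generalize normSqL2 u = N at *
    -- The defect weakens the negative term by a multiple of `κ * N`; Poincaré charges it to the
    -- Dirichlet energy, where the admissible error already has a factor `κ`.
    have e1 : κ * ((m + 1) / 2 * t ^ 2 * N) ≤ κ * ((m + 1) / 2 * t ^ 2 * (cP * D)) := by gcongr
    have e2 : 0 ≤ κ * (c * t ^ 3 * N) := by positivity
    have e3 : 0 ≤ t ^ 2 / 2 * (((m + 1) * cP + C₁ + c) * (C₁ * a) * D) := by positivity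
    have e4 : 0 ≤ t ^ 2 / 2 * ((1 + C₁ + c) * κ * D) := by positivity
    have e5 : 0 ≤ (1 + (m + 1) * cP + C₁ / 2 + c) * t ^ 3 * D := by positivity
    have e6 : 0 ≤ (1 + (m + 1) * cP + C₁) * t ^ 3 * N := by positivity
    linarith

end

end NonlocalPerimeter

theorem mainTheorem5 (n : ℕ) (hn : 2 ≤ n) :
    ∃ t₀ : ℝ, 0 < t₀ ∧
      ∀ (G : NonlocalPerimeter.Rn n → ℝ) (g : ℝ → ℝ),
        NonlocalPerimeter.IsRadialKernel G g →
        NonlocalPerimeter.HasUnitFirstMoment G →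
        NonlocalPerimeter.HasHigherMoment G →
        ∃ (ε₅ C : ℝ) (q : ℝ → ℝ), 0 < ε₅ ∧ 0 < C ∧
          NonlocalPerimeter.IsSeminormError n g q ∧
          ∀ (t : ℝ) (E : Set (NonlocalPerimeter.Rn n)) (u : NonlocalPerimeter.Sph n → ℝ),
            NonlocalPerimeter.IsCenteredNearlySpherical t E u → t < t₀ →
            ∀ ε : ℝ, 0 < ε → ε < ε₅ →
              NonlocalPerimeter.nonlocalPer (NonlocalPerimeter.rescale G ε) E ≠ ⊤ ∧
              NonlocalPerimeter.nonlocalPer (NonlocalPerimeter.rescale G ε)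
                (Metric.ball 0 1) ≠ ⊤ ∧
              (NonlocalPerimeter.nonlocalPer (NonlocalPerimeter.rescale G ε) E).toReal ≤
                (NonlocalPerimeter.nonlocalPer (NonlocalPerimeter.rescale G ε)
                  (Metric.ball 0 1)).toReal
                + t ^ 2 / 2 * ((1 + C * q ε) * NonlocalPerimeter.gradNormSqL2 u
                    - ((n : ℝ) - 1) * NonlocalPerimeter.normSqL2 u)
                + C * t ^ 3 * (NonlocalPerimeter.gradNormSqL2 u
                    + NonlocalPerimeter.normSqL2 u) := by
  obtain ⟨m, rfl⟩ := Nat.exists_eq_add_of_le' hn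
  obtain ⟨t₀, C₁, C, ht₀, hC, -, h⟩ := NonlocalPerimeter.exists_radialPer_le m
  refine ⟨t₀, ht₀, fun G g hG hG1 hG2 => ?_⟩
  obtain ⟨H, M, hH, hg, hGH⟩ := NonlocalPerimeter.exists_isProfile hG hG1 hG2
  -- The estimate holds at every positive `ε`, so any positive threshold will do. The seminorm
  -- inequality needs only the angular part of `q`; the defect `capError` is included for the
  -- perimeter estimate.
  refine ⟨1, C, fun ε => C₁ * NonlocalPerimeter.angularError m M ε +
    NonlocalPerimeter.capError m H ε, one_pos, hC, ⟨?_, fun ε hε u ⟨L, hL⟩ => ?_⟩,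
    fun t E u hE ht ε hε _ => ?_⟩
  · simpa using (hH.tendsto_angularError.const_mul C₁).add hH.tendsto_capError
  · exact (NonlocalPerimeter.seminorm_le_of_energy_bound hG.profile_nonneg hG.profile_measurable
      hH.measurable hg hε u).trans ((h H M hH ε hε).1 u L hL)
  · rw [NonlocalPerimeter.nonlocalPer_rescale_eq hGH hε,
      NonlocalPerimeter.nonlocalPer_rescale_eq hGH hε]
    obtain ⟨h1, h2⟩ := (h H M hH ε hε).2 t E u hE ht
    refine ⟨h1, ne_top_of_le_ne_top (NonlocalPerimeter.sphArea_ne_top (m + 1))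
      (hH.radialPer_ball_one_le hε), h2.trans (le_of_eq ?_)⟩
    push_cast
    ring
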